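/- A tree is \emph{normal} if it has a unique least node, all its levels are countable, every non-maximal node has infinitely many immediate successors, every node has successors at every higher level of the tree, and two nodes of the same limit level with the same predecessors are equal. A \emph{Suslin tree} is a normal tree of height $\omega_1$ without uncountable antichains. The product of trees is the tree product: its nodes are the tuples of nodes of equal height, and one node is below another if it is below it in every coordinate. Jech's forcing $\mathbb{P}_J$ consists of the countable normal trees whose nodes are functions from ordinals to $\omega$ (closed under restriction to smaller ordinals and ordered by inclusion); a condition is stronger than another if it end-extends it. Let $V$ be the universe of sets, let $S\in V$ be a Suslin tree, and let $\mathbb{P}$ be the fully supported iteration of length $\omega$ of the forcings $\mathbb{P}_J$, where at step $n$ one forces with $\mathbb{P}_J$ as computed in the extension by the first $n$ steps. Let $G$ be $\mathbb{P}$-generic over $V$, and let $\vec T=(T_n : n\in\omega)\in V[G]$ be the sequence of generic trees, that is, $T_n$ is the union of the conditions chosen by $G$ in coordinate $n$, ordered by inclusion. Then in $V[G]$ every $T_n$ is a Suslin tree, and for every finite $e\subseteq\omega$ the tree product $$S\times\prod_{i\in e}T_i$$ is a Suslin tree. (Statements about $V[G]$ are understood as being forced by every condition of $\mathbb{P}$,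 which is a nonempty partial preorder.) -/

import Mathlib

universe u v

namespace JechForcing

/-! ## First-order formulas of set theory -/

/-- Formulas of set theory with parameters from `N`; a quantifier binds a variable by a function
from `N` to formulas. -/
inductive Fml (N : Type v) : Type v
  | mem (x y : N) : Fml N
  | eq (x y : N) : Fml N
  | bot : Fml N
  | imp (φ ψ : Fml N) : Fml N
  | and (φ ψ : Fml N) : Fml N
  | or (φ ψ : Fml N) : Fml N
  | all (φ : N → Fml N) : Fml N
  | ex (φ : N → Fml N) : Fml N

infix:60 " ∈' " => Fml.mem
infix:60 " =' " => Fml.eq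
infixr:50 " ∧' " => Fml.and
infixr:45 " ∨' " => Fml.or
infixr:40 " →' " => Fml.imp

namespace Fml

variable {N : Type v}

def not (φ : Fml N) : Fml N := φ →' bot
def iff (φ ψ : Fml N) : Fml N := (φ →' ψ) ∧' (ψ →' φ)
/-- `∀ x ∈ A, φ x` -/
def allIn (A : N) (φ : N → Fml N) : Fml N := all fun x => x ∈' A →' φ x
/-- `∃ x ∈ A, φ x` -/
def exIn (A : N) (φ : N → Fml N) : Fml N := ex fun x => x ∈' A ∧' φ x

/-! ### Pairs, functions, ordinals, cardinality -/

def subset (x y : N) : Fml N := allIn x fun z => z ∈' y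
/-- `z = {x, y}` -/
def isPair (z x y : N) : Fml N := all fun w => iff (w ∈' z) (w =' x ∨' w =' y)
/-- `z = (x, y) = {{x}, {x, y}}` -/
def isOPair (z x y : N) : Fml N := all fun w => iff (w ∈' z) (isPair w x x ∨' isPair w x y)
/-- `(x, y) ∈ f` -/
def pairMem (x y f : N) : Fml N := exIn f fun z => isOPair z x y
/-- `f : X → Y` is a function with domain `X` -/
def isFunction (f X Y : N) : Fml N :=
  (allIn f fun z => exIn X fun x => exIn Y fun y => isOPair z x y) ∧'
  (allIn X fun x => ex fun y => pairMem x y f ∧' (all fun y' => pairMem x y' f →' y' =' y))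
def isInjective (f : N) : Fml N :=
  all fun x => all fun x' => all fun y => pairMem x y f →' pairMem x' y f →' x =' x'
def isTransitive (x : N) : Fml N := allIn x fun y => subset y x
def isOrdinal (x : N) : Fml N := isTransitive x ∧' allIn x fun y => isTransitive y
/-- The ordinal `x` is a nonzero limit ordinal. -/
def isLimit (x : N) : Fml N := (ex fun y => y ∈' x) ∧' allIn x fun y => exIn x fun z => y ∈' z
/-- `x = ω` -/
def isOmega (x : N) : Fml N := isOrdinal x ∧' isLimit x ∧' allIn x fun n => not (isLimit n)
/-- `X` is finite -/
def isFinite (X : N) : Fml N :=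
  ex fun w => isOmega w ∧' exIn w fun n => ex fun f => isFunction f X n ∧' isInjective f
/-- `X` is finite or countably infinite -/
def isCountable (X : N) : Fml N :=
  ex fun w => isOmega w ∧' ex fun f => isFunction f X w ∧' isInjective f
/-- `x = ω₁` -/
def isOmega1 (x : N) : Fml N := isOrdinal x ∧' not (isCountable x) ∧' allIn x isCountable

/-! ### Trees -/

/-- `(A, R)` is a tree: `R` is a strict partial order on `A` whose sets of predecessors are
well-ordered. -/
def isTree (A R : N) : Fml N :=
  (allIn R fun z => exIn A fun x => exIn A fun y => isOPair z x y) ∧'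
  (all fun x => not (pairMem x x R)) ∧'
  (all fun x => all fun y => all fun z => pairMem x y R →' pairMem y z R →' pairMem x z R) ∧'
  (all fun x => all fun y => all fun z => pairMem x z R →' pairMem y z R →'
    (pairMem x y R ∨' x =' y ∨' pairMem y x R)) ∧'
  (all fun B => subset B A →' (ex fun x => x ∈' B) →'
    exIn B fun m => allIn B fun y => not (pairMem y m R))

/-- `h` is the height function of the tree `(A, R)`: `h(x) = {h(y) : y R x}`, which is the von
Neumann ordinal isomorphic to the set of predecessors of `x`. -/
def isHeightFn (A R h : N) : Fml N :=
  (ex fun Y => isFunction h A Y) ∧'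
  (all fun x => all fun α => pairMem x α h →'
    all fun β => iff (β ∈' α) (ex fun y => pairMem y x R ∧' pairMem y β h))

/-- `y` is an immediate successor of `x`. -/
def isImmSucc (R x y : N) : Fml N :=
  pairMem x y R ∧' not (ex fun z => pairMem x z R ∧' pairMem z y R)

/-- `(A, R)` is a normal tree (of some height): it has a root, its levels are countable, a
non-maximal node has infinitely many immediate successors, each node has successors at all higher
levels of the tree, and nodes of a limit level are determined by their predecessors. -/
def isNormalTree (A R : N) : Fml N :=
  isTree A R ∧' ex fun h => isHeightFn A R h ∧'
  (exIn A fun r => allIn A fun x => x =' r ∨' pairMem r x R) ∧'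
  (all fun α => all fun L => (all fun x => iff (x ∈' L) (pairMem x α h)) →' isCountable L) ∧'
  (allIn A fun x => (ex fun y => pairMem x y R) →'
    all fun I => (all fun y => iff (y ∈' I) (isImmSucc R x y)) →' not (isFinite I)) ∧'
  (all fun x => all fun α => all fun z => all fun β =>
    pairMem x α h →' pairMem z β h →' α ∈' β →'
      ex fun y => pairMem x y R ∧' pairMem y β h) ∧'
  (all fun α => isLimit α →' all fun x => all fun y => pairMem x α h →' pairMem y α h →'
    (all fun z => iff (pairMem z x R) (pairMem z y R)) →' x =' y)

/-- The tree `(A, R)` has height `ω₁`. -/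
def hasHeightOmega1 (A R : N) : Fml N :=
  ex fun h => isHeightFn A R h ∧' ex fun w => isOmega1 w ∧'
    all fun α => iff (α ∈' w) (ex fun x => pairMem x α h)

/-- `B` is an antichain of the tree `(A, R)`. -/
def isAntichain (A R B : N) : Fml N :=
  subset B A ∧' allIn B fun x => allIn B fun y => not (pairMem x y R)

/-- `T = (A, R)` is a Suslin tree: a normal tree of height `ω₁` without uncountable antichains. -/
def isSuslin (T : N) : Fml N :=
  ex fun A => ex fun R => isOPair T A R ∧' isNormalTree A R ∧' hasHeightOmega1 A R ∧'
    all fun B => isAntichain A R B →' isCountable B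

/-- `x <_T y` -/
def treeLt (T x y : N) : Fml N :=
  ex fun A => ex fun R => isOPair T A R ∧' pairMem x y R

/-- `x` is a node of the tree `T`, of height `α`. -/
def nodeHeight (T x α : N) : Fml N :=
  ex fun A => ex fun R => isOPair T A R ∧' ex fun h => isHeightFn A R h ∧' pairMem x α h

/-- `z` is a node of the tree product `S × ∏_{i ∈ e} T(i)`: a pair `(s, f)` with `s ∈ S` and `f` a
function on `e` with `f(i) ∈ T(i)`, all of them of the same height. -/
def isProdNode (S T e z : N) : Fml N :=
  ex fun s => ex fun f => isOPair z s f ∧' (ex fun Y => isFunction f e Y) ∧'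
    ex fun α => nodeHeight S s α ∧'
      allIn e fun i => ex fun Ti => ex fun x =>
        pairMem i Ti T ∧' pairMem i x f ∧' nodeHeight Ti x α

/-- The coordinatewise strict order between nodes of the tree product. -/
def isProdLt (S T e z z' : N) : Fml N :=
  ex fun s => ex fun f => ex fun s' => ex fun f' => isOPair z s f ∧' isOPair z' s' f' ∧'
    treeLt S s s' ∧'
      allIn e fun i => ex fun Ti => ex fun x => ex fun x' =>
        pairMem i Ti T ∧' pairMem i x f ∧' pairMem i x' f' ∧' treeLt Ti x x'

/-- `X` is the tree product `S × ∏_{i ∈ e} T(i)`. -/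
def isTreeProduct (X S T e : N) : Fml N :=
  ex fun A => ex fun R => isOPair X A R ∧'
    (all fun z => iff (z ∈' A) (isProdNode S T e z)) ∧'
    (all fun w => iff (w ∈' R)
      (exIn A fun z => exIn A fun z' => isOPair w z z' ∧' isProdLt S T e z z'))

/-! ### The conditions of Jech's forcing -/

/-- `R` is the strict inclusion relation on `A`. -/
def isStrictIncl (A R : N) : Fml N :=
  all fun w => iff (w ∈' R)
    (exIn A fun x => exIn A fun y => isOPair w x y ∧' subset x y ∧' not (x =' y))

/-- `t` is a function from the ordinal `α` to `ω`. -/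
def isSeq (t α : N) : Fml N := isOrdinal α ∧' ex fun w => isOmega w ∧' isFunction t α w

/-- `q` is a countable normal tree, consisting of functions from ordinals to `ω`, closed under
restriction to smaller ordinals and ordered by inclusion. -/
def isJechCondition (q : N) : Fml N :=
  (allIn q fun t => ex fun α => isSeq t α) ∧'
  (allIn q fun t => all fun s => all fun α => subset s t →' isSeq s α →' s ∈' q) ∧'
  isCountable q ∧'
  (ex fun R => isStrictIncl q R ∧' isNormalTree q R)

/-- `q` is an end-extension of `q'`: every node of `q` that is not in `q' ⊆ q` is longer than all
nodes of `q'`. Equivalently, `q' = {t ∈ q : height t < α}` for some ordinal `α`. -/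
def endExtends (q q' : N) : Fml N :=
  subset q' q ∧'
  allIn q fun t => not (t ∈' q') →' allIn q' fun s => all fun α => all fun β =>
    isSeq s α →' isSeq t β →' α ∈' β

/-- `T = (⋃ H, ⊂)` -/
def isUnionTree (T H : N) : Fml N :=
  ex fun A => ex fun R => isOPair T A R ∧'
    (all fun t => iff (t ∈' A) (exIn H fun q => t ∈' q)) ∧' isStrictIncl A R

/-! ### The assertions about a sequence of trees -/

/-- `T` is a function with domain `ω`. -/
def isOmegaSequence (T : N) : Fml N :=
  ex fun w => isOmega w ∧' ex fun Y => isFunction T w Y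

/-- All members of the sequence `T` are Suslin trees. -/
def allSuslin (T : N) : Fml N := all fun i => all fun Ti => pairMem i Ti T →' isSuslin Ti

/-- For every finite `e ⊆ ω` the tree product `S × ∏_{i ∈ e} T(i)` is a Suslin tree. -/
def finiteProductsSuslin (S T : N) : Fml N :=
  ex fun w => isOmega w ∧' all fun e => subset e w →' isFinite e →'
    ex fun X => isTreeProduct X S T e ∧' isSuslin X

end Fml

open Fml

/-- Truth of a formula in the universe `V` of sets. -/
def Holds : Fml ZFSet.{u} → Prop
  | .mem x y => x ∈ y
  | .eq x y => x = y
  | .bot => False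
  | .imp φ ψ => Holds φ → Holds ψ
  | .and φ ψ => Holds φ ∧ Holds ψ
  | .or φ ψ => Holds φ ∨ Holds ψ
  | .all φ => ∀ x, Holds (φ x)
  | .ex φ => ∃ x, Holds (φ x)

/-! ## Names and the forcing relation -/

/-- The `P`-names: `mk ι a c` is the name `{(a i, c i) : i ∈ ι}`. -/
inductive Name (P : Type u) : Type (u + 1)
  | mk (ι : Type u) (a : ι → Name P) (c : ι → P) : Name P

section Forcing

variable {P : Type u} [Preorder P]

/-- `p ⊩ x = y`: for each element `(a i, c i)` of `x`, below `p` and `c i` it is dense to force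
`a i` to be equal to some `b j` with `(b j, d j) ∈ y` in the generic filter, and vice versa. -/
def ForcesEq : Name P → Name P → P → Prop
  | .mk ι a c, .mk κ b d => fun p =>
    (∀ i : ι, ∀ q ≤ p, q ≤ c i → ∃ r ≤ q, ∃ j : κ, r ≤ d j ∧ ForcesEq (a i) (b j) r) ∧
    (∀ j : κ, ∀ q ≤ p, q ≤ d j → ∃ r ≤ q, ∃ i : ι, r ≤ c i ∧ ForcesEq (a i) (b j) r)

/-- `p ⊩ x ∈ y` -/
def ForcesMem (x : Name P) : Name P → P → Prop
  | .mk κ b d => fun p => ∀ q ≤ p, ∃ r ≤ q, ∃ j : κ, r ≤ d j ∧ ForcesEq x (b j) r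

/-- The forcing relation `p ⊩ φ` (smaller conditions are stronger). -/
def Forces (p : P) : Fml (Name P) → Prop
  | .mem x y => ForcesMem x y p
  | .eq x y => ForcesEq x y p
  | .bot => False
  | .imp φ ψ => ∀ q ≤ p, Forces q φ → Forces q ψ
  | .and φ ψ => Forces p φ ∧ Forces p ψ
  | .or φ ψ => ∀ q ≤ p, ∃ r ≤ q, Forces r φ ∨ Forces r ψ
  | .all φ => ∀ x, Forces p (φ x)
  | .ex φ => ∀ q ≤ p, ∃ r ≤ q, ∃ x, Forces r (φ x)

/-- `φ` is forced by every condition, that is, `φ` holds in every generic extension by `P`. -/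
def Forced (φ : Fml (Name P)) : Prop := ∀ p : P, Forces p φ

theorem ForcesEq.mono {x y : Name P} {p q : P} (h : ForcesEq x y p) (hq : q ≤ p) :
    ForcesEq x y q := by
  cases x; cases y
  exact ⟨fun i r hr => h.1 i r (hr.trans hq), fun j r hr => h.2 j r (hr.trans hq)⟩

theorem ForcesMem.mono {x y : Name P} {p q : P} (h : ForcesMem x y p) (hq : q ≤ p) :
    ForcesMem x y q := by
  cases y
  exact fun r hr => h r (hr.trans hq)

theorem ForcesMem.of_dense {x y : Name P} {p : P} (h : ∀ q ≤ p, ∃ r ≤ q, ForcesMem x y r) :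
    ForcesMem x y p := by
  cases y
  intro q hq
  obtain ⟨r, hr, h'⟩ := h q hq
  obtain ⟨s, hs, j, h''⟩ := h' r le_rfl
  exact ⟨s, hs.trans hr, j, h''⟩

theorem Forces.mono {φ : Fml (Name P)} : ∀ {p q : P}, Forces p φ → q ≤ p → Forces q φ := by
  induction φ with
  | mem x y => exact fun h hq => ForcesMem.mono h hq
  | eq x y => exact fun h hq => ForcesEq.mono h hq
  | bot => exact fun h _ => h
  | imp φ ψ _ _ => exact fun h hq r hr => h r (hr.trans hq)
  | and φ ψ h₁ h₂ => exact fun h hq => ⟨h₁ h.1 hq, h₂ h.2 hq⟩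
  | or φ ψ _ _ => exact fun h hq r hr => h r (hr.trans hq)
  | all φ ih => exact fun h hq x => ih x (h x) hq
  | ex φ _ => exact fun h hq r hr => h r (hr.trans hq)

theorem forces_endExtends_refl (p : P) (x : Name P) : Forces p (endExtends x x) :=
  ⟨fun _ _ _ h => h, fun _ _ _ h r hr h' => (h' r le_rfl (ForcesMem.mono h hr)).elim⟩

theorem forces_endExtends_trans {p : P} {x y z : Name P} (h₁ : Forces p (endExtends x y))
    (h₂ : Forces p (endExtends y z)) : Forces p (endExtends x z) := by
  refine ⟨fun t q hq h => h₁.1 t q hq (h₂.1 t q hq h), ?_⟩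
  intro t q hq htx q₁ hq₁ htz s q₂ hq₂ hs α β q₃ hq₃ hα q₄ hq₄ hβ
  refine ForcesMem.of_dense fun q₅ hq₅ => ?_
  have h53 : q₅ ≤ q₃ := hq₅.trans hq₄
  have h52 : q₅ ≤ q₂ := h53.trans hq₃
  have h51 : q₅ ≤ q₁ := h52.trans hq₂
  have h50 : q₅ ≤ q := h51.trans hq₁
  by_cases hy : ∃ r ≤ q₅, ForcesMem t y r
  · obtain ⟨r, hr, hy⟩ := hy
    exact ⟨r, hr, h₂.2 t r (hr.trans (h50.trans hq)) hy r le_rfl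
      (Forces.mono htz (hr.trans h51)) s r le_rfl (ForcesMem.mono hs (hr.trans h52)) α β r le_rfl
      (Forces.mono hα (hr.trans h53)) r le_rfl (Forces.mono hβ (hr.trans hq₅))⟩
  · refine ⟨q₅, le_rfl, h₁.2 t q₅ (h50.trans hq) (ForcesMem.mono htx h50) q₅ le_rfl
      (fun r hr h => hy ⟨r, hr, h⟩) s q₅ le_rfl ?_ α β q₅ le_rfl
      (Forces.mono hα h53) q₅ le_rfl (Forces.mono hβ hq₅)⟩
    exact h₂.1 s q₅ (h50.trans hq) (ForcesMem.mono hs h52)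

end Forcing

namespace Name

variable {P : Type u}

/-- The name `{(x̌, p) : x ∈ X, p ∈ P}` for the ground model set `X`. -/
def ofPSet : PSet.{u} → Name P
  | .mk ι a => .mk (ι × P) (fun i => ofPSet (a i.1)) (fun i => i.2)

/-- The canonical name `X̌` of the ground model set `X`. -/
noncomputable def check (X : ZFSet.{u}) : Name P := ofPSet X.out

/-- The canonical name for `{x, y}`. -/
def pair (x y : Name P) : Name P :=
  .mk (Bool × P) (fun i => if i.1 then x else y) (fun i => i.2)

/-- The canonical name for the ordered pair `(x, y)`. -/
def opair (x y : Name P) : Name P := pair (pair x x) (pair x y)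

/-- For `f : Q → P`, reinterprets a `P`-name as a `Q`-name: if `G` is a generic filter on `Q` that
`f` projects to a filter on `P` generating the filter `G'`, then `lift f x` is interpreted by `G`
as `x` is by `G'`. -/
def lift {Q : Type u} [Preorder P] (f : Q → P) : Name P → Name Q
  | .mk ι a c => .mk {i : ι × Q // f i.2 ≤ c i.1} (fun i => lift f (a i.1.1)) (fun i => i.1.2)

end Name

/-! ## Iterating Jech's forcing -/

section Successor

variable (P : Type u)

/-- An ordinal that is too large to become countable in a generic extension by `P`. -/
noncomputable def ordinalBound : Ordinal.{u} := (Order.succ (max (Cardinal.mk P) Cardinal.aleph0)).ord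

/-- Codes of canonical `P`-names for functions from a countable ordinal to `ω`: sets of triples
`(p, α, n)`, to be read as "if `p` is in the generic filter, then the function maps `α` to `n`". -/
abbrev SeqCode : Type u := Set (P × (ordinalBound P).ToType × ℕ)

/-- Codes of canonical `P`-names for conditions of Jech's forcing: sets of pairs `(p, s)`, to be
read as "if `p` is in the generic filter, then the function coded by `s` is a node". -/
abbrev TreeCode : Type u := Set (P × SeqCode P)

variable {P}

noncomputable def seqName (s : SeqCode P) : Name P :=
  .mk s
    (fun i => .opair (.check (i.1.2.1 : Ordinal.{u}).toZFSet) (.check (i.1.2.2 : Ordinal.{u}).toZFSet))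
    (fun i => i.1.1)

noncomputable def treeName (t : TreeCode P) : Name P :=
  .mk t (fun i => seqName i.1.2) (fun i => i.1.1)

variable (P)

/-- The two-step iteration of `P` and Jech's forcing `ℙ_J` as computed in the extension by `P`:
pairs `(p, q)` where `q` is a `P`-name that is forced to be a condition of `ℙ_J`. To have a set of
them, `q` ranges over canonical names: each name forced to be in `ℙ_J` is forced to be equal to a
canonical one. -/
def JechSucc [Preorder P] : Type u :=
  P × {t : TreeCode P // Forced (isJechCondition (treeName t))}

variable {P} [Preorder P]

/-- `(p, q) ≤ (p', q')` iff `p ≤ p'` and `p` forces that `q` end-extends `q'`. -/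
instance : Preorder (JechSucc P) where
  le x y := x.1 ≤ y.1 ∧ Forces x.1 (endExtends (treeName x.2.1) (treeName y.2.1))
  le_refl x := ⟨le_rfl, forces_endExtends_refl _ _⟩
  le_trans _ _ _ hxy hyz :=
    ⟨hxy.1.trans hyz.1, forces_endExtends_trans hxy.2 (Forces.mono hyz.2 hxy.1)⟩

end Successor

structure ForcingNotion : Type (u + 1) where
  carrier : Type u
  preorder : Preorder carrier

instance : CoeSort ForcingNotion.{u} (Type u) := ⟨ForcingNotion.carrier⟩

instance (P : ForcingNotion.{u}) : Preorder P := P.preorder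

/-- The iteration of length `n` of Jech's forcing. -/
def jechStage : ℕ → ForcingNotion.{u}
  | 0 => ⟨PUnit, inferInstance⟩
  | n + 1 => ⟨JechSucc (jechStage n), inferInstance⟩

/-- The initial part of length `n` of a condition of length `n + 1`. -/
def jechInit {n : ℕ} (p : jechStage.{u} (n + 1)) : jechStage.{u} n := Prod.fst p

/-- The last coordinate of a condition of length `n + 1`: a name for a condition of Jech's forcing
in the extension by the iteration of length `n`. -/
noncomputable def jechLast {n : ℕ} (p : jechStage.{u} (n + 1)) : Name (jechStage.{u} n) :=
  treeName (Prod.snd p).1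

/-- The fully supported iteration of length `ω` of Jech's forcing: the inverse limit of the
iterations of finite length. A condition is given by its restrictions to the `n < ω`. -/
def JechIteration : Type u := {p : ∀ n, jechStage.{u} n // ∀ n, jechInit (p (n + 1)) = p n}

instance : Preorder JechIteration.{u} where
  le p q := ∀ n, p.1 n ≤ q.1 n
  le_refl _ _ := le_rfl
  le_trans _ _ _ h h' n := (h n).trans (h' n)

/-- The name for the set of all conditions of Jech's forcing that the generic filter `G` chooses
in coordinate `n`: `{p(n) : p ∈ G}`, each `p(n)` being evaluated by the restriction of `G` to the
iteration of length `n`. -/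
noncomputable def genericFilterName (n : ℕ) : Name JechIteration.{u} :=
  .mk JechIteration
    (fun p => .lift (fun r : JechIteration.{u} => r.1 n) (jechLast (p.1 (n + 1)))) id

/-- `T` is the sequence of the generic trees: the function with domain `ω` such that `T(n)` is the
union of the conditions that the generic filter chooses in coordinate `n`. -/
def IsGenericTreeSequence (T : Name JechIteration.{u}) : Prop :=
  Forced (isOmegaSequence T) ∧
  ∀ n : ℕ, Forced (ex fun Tn =>
    pairMem (.check (n : Ordinal.{u}).toZFSet) Tn T ∧' isUnionTree Tn (genericFilterName n))

end JechForcing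

-- A σ-closed forcing adds no new countable sequences of ground-model objects. Hence every condition
-- of Jech's forcing in an intermediate extension is densely equal to a tree of the ground model
-- (`SigmaClosed.dn_jt`), and the iteration has a dense subset that is a copy of the full product
-- `JSeq` of countably many ground-model versions of the forcing (`exists_iterProj_le`). By means of
-- `Proj`, every forcing statement about a stage or about the whole iteration is evaluated with
-- conditions from `JSeq`. Since `JSeq` is σ-closed, `ω₁` is preserved, and the nodes of the generic
-- trees and of their products are coded by ground-model sets. Apart from the antichain condition,
-- the clauses of being a Suslin tree reduce to the fact that conditions extend to conditions whose
-- trees all have a top level of one prescribed or greater height (`JSeq.exists_top`).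
--
-- The heart is `AntichainName.exists_bound`: if `B` is forced to be an antichain of `S × ∏ T_i`,
-- then densely a condition bounds the heights of the members of `B`. A node `x` is called decided
-- if it is above a member of `B`, or if no node above it can be forced into `B`. Given a condition
-- `q` with a top level and a tuple `t` of top nodes, consider the `S`-coordinates of the nodes
-- above `t` that extensions of `q` can decide. They are dense in `S` above that level. Because `S`
-- is Suslin in the ground model, one countable level `γ(q, t)` of `S` has below each of its nodes
-- such a coordinate (`exists_level_of_dense`, `AntichainName.exists_level`).
--
-- Fix `δ < ω₁` closed under these bounds and build a descending sequence of conditions whose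
-- heights converge to `δ`, prolonging a chosen branch through every node that appears. Each pair of
-- a node `s` of height `δ` in `S` and a tuple of nodes is treated at some stage: the branches
-- through the tuple are steered above a decided `x` whose `S`-coordinate is below `s`. The limit
-- condition receives on level `δ` only the chosen branches. A member `y` of `B` above level `δ`
-- would then lie above a decided `x`, hence strictly above another member of `B`, or above a node
-- with no member of `B` above it. Both are absurd.
--
-- So an antichain lives on countably many levels, each countable, and is countable. An antichain of
-- a single `T_n` is handled by pulling it back to `S × T_n`.

universe w w'

namespace JechForcing
open Fml

/-! ### Equality, membership and density for the forcing relation -/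

section Base

variable {P : Type u} [Preorder P]

theorem ForcesEq.refl (x : Name P) (p : P) : ForcesEq x x p := by
  induction x generalizing p with
  | mk ι a c ih =>
    exact ⟨fun i q _ hc => ⟨q, le_rfl, i, hc, ih i q⟩, fun i q _ hc => ⟨q, le_rfl, i, hc, ih i q⟩⟩

theorem ForcesEq.symm {x y : Name P} {p : P} (h : ForcesEq x y p) : ForcesEq y x p := by
  induction x generalizing y p with
  | mk ι a c ih =>
    cases y
    exact ⟨fun j q hq hd => let ⟨r, hr, i, hc, h⟩ := h.2 j q hq hd; ⟨r, hr, i, hc, ih i h⟩,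
      fun i q hq hc => let ⟨r, hr, j, hd, h⟩ := h.1 i q hq hc; ⟨r, hr, j, hd, ih i h⟩⟩

theorem ForcesEq.trans {x y z : Name P} {p : P} (h : ForcesEq x y p) (h' : ForcesEq y z p) :
    ForcesEq x z p := by
  induction x generalizing y z p with
  | mk ι a c ih =>
    cases y; cases z
    refine ⟨fun i q hq hc => ?_, fun k q hq hc => ?_⟩
    · obtain ⟨r, hr, j, hd, h₁⟩ := h.1 i q hq hc
      obtain ⟨s, hs, k, he, h₂⟩ := h'.1 j r (hr.trans hq) hd
      exact ⟨s, hs.trans hr, k, he, ih i (h₁.mono hs) h₂⟩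
    · obtain ⟨r, hr, j, hd, h₁⟩ := h'.2 k q hq hc
      obtain ⟨s, hs, i, he, h₂⟩ := h.2 j r (hr.trans hq) hd
      exact ⟨s, hs.trans hr, i, he, ih i h₂ (h₁.mono hs)⟩

theorem ForcesEq.of_dense {x y : Name P} {p : P} (h : ∀ q ≤ p, ∃ r ≤ q, ForcesEq x y r) :
    ForcesEq x y p := by
  cases x; cases y
  refine ⟨fun i q hq hc => ?_, fun j q hq hd => ?_⟩
  · obtain ⟨r, hr, h'⟩ := h q hq
    obtain ⟨s, hs, t⟩ := h'.1 i r le_rfl (hr.trans hc)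
    exact ⟨s, hs.trans hr, t⟩
  · obtain ⟨r, hr, h'⟩ := h q hq
    obtain ⟨s, hs, t⟩ := h'.2 j r le_rfl (hr.trans hd)
    exact ⟨s, hs.trans hr, t⟩

theorem ForcesMem.congr_left {x x' y : Name P} {p : P} (e : ForcesEq x x' p)
    (h : ForcesMem x y p) : ForcesMem x' y p := by
  cases y
  intro q hq
  obtain ⟨r, hr, j, hd, h⟩ := h q hq
  exact ⟨r, hr, j, hd, (e.symm.mono (hr.trans hq)).trans h⟩

theorem ForcesMem.congr_right {x y y' : Name P} {p : P} (e : ForcesEq y y' p)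
    (h : ForcesMem x y p) : ForcesMem x y' p := by
  cases y; cases y'
  intro q hq
  obtain ⟨r, hr, j, hd, h⟩ := h q hq
  obtain ⟨s, hs, i, hc, h'⟩ := e.1 j r (hr.trans hq) hd
  exact ⟨s, hs.trans hr, i, hc, (h.mono hs).trans h'⟩

/-- Density is built into the clauses for atomic formulas, `or` and `ex`, and the other clauses
inherit it. So a statement may always be verified after passing to a stronger condition. -/
theorem Forces.of_dense {φ : Fml (Name P)} :
    ∀ {p : P}, (∀ q ≤ p, ∃ r ≤ q, Forces r φ) → Forces p φ := by
  induction φ with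
  | mem x y => exact ForcesMem.of_dense
  | eq x y => exact ForcesEq.of_dense
  | bot => exact fun h => let ⟨_, _, h'⟩ := h _ le_rfl; h'
  | imp φ ψ _ ih =>
    intro p h q hq hφ
    refine ih fun s hs => ?_
    obtain ⟨r, hr, h'⟩ := h s (hs.trans hq)
    exact ⟨r, hr, h' r le_rfl (hφ.mono (hr.trans hs))⟩
  | and φ ψ h₁ h₂ =>
    exact fun h => ⟨h₁ fun q hq => let ⟨r, hr, h'⟩ := h q hq; ⟨r, hr, h'.1⟩,
      h₂ fun q hq => let ⟨r, hr, h'⟩ := h q hq; ⟨r, hr, h'.2⟩⟩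
  | or φ ψ _ _ =>
    intro p h q hq
    obtain ⟨r, hr, h'⟩ := h q hq
    obtain ⟨s, hs, t⟩ := h' r le_rfl
    exact ⟨s, hs.trans hr, t⟩
  | all φ ih => exact fun h x => ih x fun q hq => let ⟨r, hr, h'⟩ := h q hq; ⟨r, hr, h' x⟩
  | ex φ _ =>
    intro p h q hq
    obtain ⟨r, hr, h'⟩ := h q hq
    obtain ⟨s, hs, t⟩ := h' r le_rfl
    exact ⟨s, hs.trans hr, t⟩

end Base

/-- A projection of `Q` to `P`. The forcing relation of `P` can be computed with conditions
in `Q`. -/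
class Proj (Q : Type w) (P : Type u) [Preorder Q] [Preorder P] where
  π : Q → P
  mono : ∀ {q r : Q}, q ≤ r → π q ≤ π r
  lift : ∀ (q : Q) (p : P), p ≤ π q → ∃ r ≤ q, π r ≤ p

/-- `Φ` holds densely below `q`. -/
def Dn {Q : Type w} [Preorder Q] (q : Q) (Φ : Q → Prop) : Prop := ∀ r ≤ q, ∃ s ≤ r, Φ s

section Dn

variable {Q : Type w} [Preorder Q] {q r : Q} {Φ Ψ : Q → Prop}

theorem Dn.mono (h : Dn q Φ) (hr : r ≤ q) : Dn r Φ := fun s hs => h s (hs.trans hr)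

theorem Dn.bind (h : Dn q Φ) (h' : ∀ r ≤ q, Φ r → Dn r Ψ) : Dn q Ψ := fun r hr =>
  let ⟨s, hs, hΦ⟩ := h r hr
  let ⟨t, ht, hΨ⟩ := h' s (hs.trans hr) hΦ s le_rfl
  ⟨t, ht.trans hs, hΨ⟩

theorem Dn.imp (h : Dn q Φ) (h' : ∀ r ≤ q, Φ r → Ψ r) : Dn q Ψ := fun r hr =>
  let ⟨s, hs, hΦ⟩ := h r hr
  ⟨s, hs, h' s (hs.trans hr) hΦ⟩

theorem Dn.of_forall (h : ∀ r ≤ q, Φ r) : Dn q Φ := fun r hr => ⟨r, le_rfl, h r hr⟩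

theorem Dn.exists (h : Dn q Φ) : ∃ r ≤ q, Φ r := h q le_rfl

end Dn

/-- `q ⊩ φ`: the condition to which `q` is projected forces `φ`. -/
def Frc {Q : Type w} {P : Type u} [Preorder Q] [Preorder P] [Proj Q P] (q : Q)
    (φ : Fml (Name P)) : Prop := Forces (Proj.π q : P) φ

infix:25 " ⊩ " => Frc

section Frc

variable {Q : Type w} {P : Type u} [Preorder Q] [Preorder P] [Proj Q P]
variable {q r : Q} {φ ψ : Fml (Name P)} {x y z x' y' z' : Name P}

theorem Frc.mono (h : q ⊩ φ) (hr : r ≤ q) : r ⊩ φ := Forces.mono h (Proj.mono hr)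

theorem exists_lift {p : P} (h : p ≤ Proj.π q) : ∃ r ≤ q, (Proj.π r : P) ≤ p := Proj.lift q p h

/-- A condition of `P` below `π q` need not be a projection, but the lifting property puts a
projection below it. This is how quantifiers over `P` are replaced by quantifiers over `Q` in all
clauses of the forcing relation. -/
theorem Frc.of_dense (h : Dn q fun r => r ⊩ φ) : q ⊩ φ := by
  refine Forces.of_dense fun p hp => ?_
  obtain ⟨r, hr, hrp⟩ := exists_lift hp
  obtain ⟨s, hs, h⟩ := h r hr
  exact ⟨_, (Proj.mono hs).trans hrp, h⟩

theorem Dn.frc {Φ : Q → Prop} (h : Dn q Φ) (h' : ∀ r ≤ q, Φ r → r ⊩ φ) : q ⊩ φ :=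
  Frc.of_dense (h.imp h')

theorem frc_and : (q ⊩ φ ∧' ψ) ↔ (q ⊩ φ) ∧ (q ⊩ ψ) := Iff.rfl

theorem frc_all {φ : Name P → Fml (Name P)} : (q ⊩ all φ) ↔ ∀ x, q ⊩ φ x := Iff.rfl

theorem frc_imp : (q ⊩ φ →' ψ) ↔ ∀ r ≤ q, (r ⊩ φ) → (r ⊩ ψ) := by
  refine ⟨fun h r hr => h _ (Proj.mono hr), fun h p hp hφ => ?_⟩
  refine Forces.of_dense fun p' hp' => ?_
  obtain ⟨r, hr, hrp⟩ := exists_lift (hp'.trans hp)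
  exact ⟨_, hrp, h r hr (Forces.mono hφ (hrp.trans hp'))⟩

theorem frc_not : (q ⊩ not φ) ↔ ∀ r ≤ q, ¬ (r ⊩ φ) := frc_imp

theorem frc_iff : (q ⊩ iff φ ψ) ↔ ∀ r ≤ q, ((r ⊩ φ) ↔ (r ⊩ ψ)) := by
  refine (and_congr frc_imp frc_imp).trans ?_
  exact ⟨fun h r hr => ⟨h.1 r hr, h.2 r hr⟩, fun h => ⟨fun r hr => (h r hr).1,
    fun r hr => (h r hr).2⟩⟩

theorem frc_or : (q ⊩ φ ∨' ψ) ↔ Dn q fun r => (r ⊩ φ) ∨ (r ⊩ ψ) := by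
  constructor
  · intro h r hr
    obtain ⟨p, hp, h⟩ := h _ (Proj.mono hr)
    obtain ⟨s, hs, hsp⟩ := exists_lift hp
    exact ⟨s, hs, h.imp (Forces.mono · hsp) (Forces.mono · hsp)⟩
  · exact fun h => h.frc fun r _ h p hp => ⟨p, le_rfl, h.imp (Forces.mono · hp) (Forces.mono · hp)⟩

theorem frc_ex {φ : Name P → Fml (Name P)} : (q ⊩ ex φ) ↔ Dn q fun r => ∃ x, r ⊩ φ x := by
  constructor
  · intro h r hr
    obtain ⟨p, hp, x, h⟩ := h _ (Proj.mono hr)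
    obtain ⟨s, hs, hsp⟩ := exists_lift hp
    exact ⟨s, hs, x, Forces.mono h hsp⟩
  · exact fun h => h.frc fun r _ ⟨x, h⟩ p hp => ⟨p, le_rfl, x, Forces.mono h hp⟩

theorem frc_ex_of {φ : Name P → Fml (Name P)} (x : Name P) (h : q ⊩ φ x) : q ⊩ ex φ :=
  frc_ex.2 (Dn.of_forall fun _ hr => ⟨x, h.mono hr⟩)

theorem frc_allIn {φ : Name P → Fml (Name P)} :
    (q ⊩ allIn y φ) ↔ ∀ x, ∀ r ≤ q, (r ⊩ x ∈' y) → (r ⊩ φ x) :=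
  frc_all.trans (forall_congr' fun _ => frc_imp)

theorem frc_exIn {φ : Name P → Fml (Name P)} :
    (q ⊩ exIn y φ) ↔ Dn q fun r => ∃ x, (r ⊩ x ∈' y) ∧ (r ⊩ φ x) := frc_ex

theorem frc_exIn_of {φ : Name P → Fml (Name P)} (x : Name P) (h : q ⊩ x ∈' y) (h' : q ⊩ φ x) :
    q ⊩ exIn y φ := frc_ex_of x ⟨h, h'⟩

/-- Densely, every statement is decided. -/
theorem dn_em (q : Q) (φ : Fml (Name P)) : Dn q fun r => (r ⊩ φ) ∨ ∀ s ≤ r, ¬ (s ⊩ φ) := by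
  intro r _
  by_cases h : ∃ s ≤ r, s ⊩ φ
  · exact h.imp fun s h => ⟨h.1, .inl h.2⟩
  · exact ⟨r, le_rfl, .inr fun s hs h' => h ⟨s, hs, h'⟩⟩

/-! ### Equality and membership -/

theorem frc_refl (q : Q) (x : Name P) : q ⊩ x =' x := ForcesEq.refl x _

theorem Frc.symm (h : q ⊩ x =' y) : q ⊩ y =' x := ForcesEq.symm h

theorem Frc.trans (h : q ⊩ x =' y) (h' : q ⊩ y =' z) : q ⊩ x =' z := ForcesEq.trans h h'

theorem Frc.mem_left (h : q ⊩ x ∈' y) (e : q ⊩ x =' x') : q ⊩ x' ∈' y :=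
  ForcesMem.congr_left e h

theorem Frc.mem_right (h : q ⊩ x ∈' y) (e : q ⊩ y =' y') : q ⊩ x ∈' y' :=
  ForcesMem.congr_right e h

theorem frc_eq_right (e : q ⊩ y =' y') : (q ⊩ x =' y) ↔ (q ⊩ x =' y') :=
  ⟨fun h => h.trans e, fun h => h.trans e.symm⟩

theorem frc_mem_right (e : q ⊩ y =' y') : (q ⊩ x ∈' y) ↔ (q ⊩ x ∈' y') :=
  ⟨fun h => h.mem_right e, fun h => h.mem_right e.symm⟩

theorem frc_mem_mk {ι : Type u} {a : ι → Name P} {c : ι → P} :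
    (q ⊩ x ∈' .mk ι a c) ↔ Dn q fun r => ∃ i, (Proj.π r : P) ≤ c i ∧ (r ⊩ x =' a i) := by
  constructor
  · intro h r hr
    obtain ⟨p, hp, i, hi, h⟩ := h _ (Proj.mono hr)
    obtain ⟨s, hs, hsp⟩ := exists_lift hp
    exact ⟨s, hs, i, hsp.trans hi, ForcesEq.mono h hsp⟩
  · exact fun h => h.frc fun r _ ⟨i, hi, h⟩ p hp => ⟨p, le_rfl, i, hp.trans hi, ForcesEq.mono h hp⟩

theorem frc_eq_mk {ι κ : Type u} {a : ι → Name P} {c : ι → P} {b : κ → Name P} {d : κ → P} :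
    (q ⊩ .mk ι a c =' .mk κ b d) ↔
      (∀ i, ∀ r ≤ q, (Proj.π r : P) ≤ c i → (r ⊩ a i ∈' .mk κ b d)) ∧
      (∀ j, ∀ r ≤ q, (Proj.π r : P) ≤ d j → (r ⊩ b j ∈' .mk ι a c)) := by
  constructor
  · intro h
    refine ⟨fun i r hr hc => ?_, fun j r hr hd => ?_⟩
    · exact Frc.mem_right (frc_mem_mk.2 (Dn.of_forall fun s hs =>
        ⟨i, (Proj.mono hs).trans hc, frc_refl _ _⟩)) (h.mono hr)
    · exact Frc.mem_right (frc_mem_mk.2 (Dn.of_forall fun s hs =>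
        ⟨j, (Proj.mono hs).trans hd, frc_refl _ _⟩)) (h.mono hr).symm
  · rintro ⟨h₁, h₂⟩
    refine ⟨fun i p hp hc => ?_, fun j p hp hd => ?_⟩
    · obtain ⟨r, hr, hrp⟩ := exists_lift hp
      obtain ⟨s, hs, j, hj, h⟩ := frc_mem_mk.1 (h₁ i r hr (hrp.trans hc)) r le_rfl
      exact ⟨_, (Proj.mono hs).trans hrp, j, hj, h⟩
    · obtain ⟨r, hr, hrp⟩ := exists_lift hp
      obtain ⟨s, hs, j, hj, h⟩ := frc_mem_mk.1 (h₂ j r hr (hrp.trans hd)) r le_rfl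
      exact ⟨_, (Proj.mono hs).trans hrp, j, hj, ForcesEq.symm h⟩

theorem frc_ext (h : ∀ z, ∀ r ≤ q, ((r ⊩ z ∈' x) ↔ (r ⊩ z ∈' y))) : q ⊩ x =' y := by
  cases x; cases y
  refine frc_eq_mk.2 ⟨fun i r hr hc => (h _ r hr).1 ?_, fun i r hr hc => (h _ r hr).2 ?_⟩ <;>
  exact frc_mem_mk.2 (Dn.of_forall fun s hs => ⟨i, (Proj.mono hs).trans hc, frc_refl _ _⟩)

/-! ### Pairs -/

theorem frc_mem_pair : (q ⊩ z ∈' .pair x y) ↔ Dn q fun r => (r ⊩ z =' x) ∨ (r ⊩ z =' y) := by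
  refine frc_mem_mk.trans ⟨fun h => h.imp fun r _ => ?_, fun h => h.imp fun r _ => ?_⟩
  · rintro ⟨⟨b, p⟩, -, h⟩
    cases b
    · exact .inr h
    · exact .inl h
  · rintro (h | h)
    · exact ⟨(true, Proj.π r), le_rfl, h⟩
    · exact ⟨(false, Proj.π r), le_rfl, h⟩

theorem frc_mem_pair_left : q ⊩ x ∈' .pair x y :=
  frc_mem_pair.2 (Dn.of_forall fun _ _ => .inl (frc_refl _ _))

theorem frc_mem_pair_right : q ⊩ y ∈' .pair x y :=
  frc_mem_pair.2 (Dn.of_forall fun _ _ => .inr (frc_refl _ _))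

theorem frc_isPair : (q ⊩ isPair z x y) ↔ (q ⊩ z =' .pair x y) := by
  refine (forall_congr' fun w => frc_iff).trans ⟨fun h => frc_ext fun w r hr => ?_,
    fun h w r hr => ?_⟩
  · exact (h w r hr).trans (frc_or.trans frc_mem_pair.symm)
  · exact (frc_mem_right (h.mono hr)).trans (frc_mem_pair.trans frc_or.symm)

theorem frc_isOPair : (q ⊩ isOPair z x y) ↔ (q ⊩ z =' .opair x y) := by
  refine (forall_congr' fun w => frc_iff).trans ⟨fun h => frc_ext fun w r hr => ?_,
    fun h w r hr => ?_⟩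
  · refine (h w r hr).trans (frc_or.trans (Iff.trans ?_ frc_mem_pair.symm))
    simp only [frc_isPair]
  · refine (frc_mem_right (h.mono hr)).trans (frc_mem_pair.trans (Iff.trans ?_ frc_or.symm))
    simp only [frc_isPair]

theorem frc_pair_congr (h : q ⊩ x =' x') (h' : q ⊩ y =' y') : q ⊩ .pair x y =' .pair x' y' := by
  refine frc_ext fun z r hr => ?_
  rw [frc_mem_pair, frc_mem_pair]
  refine ⟨fun k => k.imp fun s hs => Or.imp ?_ ?_, fun k => k.imp fun s hs => Or.imp ?_ ?_⟩
  · exact (frc_eq_right (h.mono (hs.trans hr))).1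
  · exact (frc_eq_right (h'.mono (hs.trans hr))).1
  · exact (frc_eq_right (h.mono (hs.trans hr))).2
  · exact (frc_eq_right (h'.mono (hs.trans hr))).2

theorem frc_opair_congr (h : q ⊩ x =' x') (h' : q ⊩ y =' y') : q ⊩ .opair x y =' .opair x' y' :=
  frc_pair_congr (frc_pair_congr h h) (frc_pair_congr h h')

theorem frc_eq_of_mem_pair_self (h : q ⊩ x ∈' .pair y y) : q ⊩ x =' y :=
  (frc_mem_pair.1 h).frc fun _ _ h => h.elim id id

theorem frc_pair_self_inj (h : q ⊩ .pair x y =' .pair z z) : (q ⊩ x =' z) ∧ (q ⊩ y =' z) :=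
  ⟨frc_eq_of_mem_pair_self (frc_mem_pair_left.mem_right h),
    frc_eq_of_mem_pair_self (frc_mem_pair_right.mem_right h)⟩

theorem frc_opair_inj :
    (q ⊩ .opair x y =' .opair x' y') ↔ (q ⊩ x =' x') ∧ (q ⊩ y =' y') := by
  refine ⟨fun h => ?_, fun h => frc_opair_congr h.1 h.2⟩
  have e : q ⊩ x =' x' := by
    refine (frc_mem_pair.1 ((frc_mem_pair_left (x := Name.pair x x)).mem_right h)).frc
      fun r _ h => ?_
    rcases h with h | h
    · exact (frc_pair_self_inj h).1
    · exact (frc_pair_self_inj h.symm).1.symm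
  refine ⟨e, ?_⟩
  refine (frc_mem_pair.1 ((frc_mem_pair_right (x := Name.pair x x)).mem_right h)).frc
    fun r hr h₁ => ?_
  have k := frc_mem_pair.1 ((frc_mem_pair_right (x := Name.pair x' x')).mem_right (h.mono hr).symm)
  rcases h₁ with h₁ | h₁
  -- The degenerate case `y = x'`: only the reverse comparison, of `{x', y'}` with the members of
  -- `(x, y)`, determines `y'`.
  · have yx := (frc_pair_self_inj h₁).2
    refine k.frc fun s hs h₂ => ?_
    rcases h₂ with h₂ | h₂
    · exact (yx.mono hs).trans
        ((e.mono (hs.trans hr)).symm.trans ((frc_pair_self_inj h₂).2).symm)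
    · have := frc_mem_pair.1 ((frc_mem_pair_right (x := x')).mem_right h₂)
      refine this.frc fun t ht h₃ => ?_
      rcases h₃ with h₃ | h₃
      · exact ((yx.mono (ht.trans hs)).trans (e.symm.mono ((ht.trans hs).trans hr))).trans h₃.symm
      · exact h₃.symm
  · refine (frc_mem_pair.1 ((frc_mem_pair_right (x := x)).mem_right h₁)).frc fun s hs h₂ => ?_
    rcases h₂ with h₂ | h₂
    · refine (frc_mem_pair.1 ((frc_mem_pair_right (x := x') (y := y')).mem_right
        (h₁.mono hs).symm)).frc fun t ht h₃ => ?_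
      rcases h₃ with h₃ | h₃
      · have hq := (ht.trans hs).trans hr
        exact ((h₂.mono ht).trans (e.mono hq).symm).trans h₃.symm
      · exact h₃.symm
    · exact h₂

theorem frc_pairMem : (q ⊩ pairMem x y z) ↔ (q ⊩ .opair x y ∈' z) := by
  refine frc_exIn.trans ⟨fun h => h.frc fun r _ ⟨w, hw, h'⟩ => hw.mem_left (frc_isOPair.1 h'),
    fun h => Dn.of_forall fun r hr => ⟨_, h.mono hr, frc_isOPair.2 (frc_refl _ _)⟩⟩

/-! ### Names for ground model sets -/

theorem forcesEq_ofPSet {x y : PSet.{u}} (h : PSet.Equiv x y) (p : P) :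
    ForcesEq (Name.ofPSet x) (Name.ofPSet y) p := by
  induction x generalizing y p with
  | mk α a ih =>
    cases y with
    | mk β b =>
    refine ⟨fun i r _ hc => ?_, fun j r _ hd => ?_⟩
    · obtain ⟨j, hj⟩ := h.1 i.1
      exact ⟨r, le_rfl, (j, r), le_rfl, ih _ hj _⟩
    · obtain ⟨i, hi⟩ := h.2 j.1
      exact ⟨r, le_rfl, (i, r), le_rfl, ih _ hi _⟩

theorem frc_mem_ofPSet {X : PSet.{u}} :
    (q ⊩ x ∈' .ofPSet X) ↔ Dn q fun r => ∃ a ∈ ZFSet.mk X, r ⊩ x =' .check a := by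
  cases X with
  | mk ι f =>
  refine frc_mem_mk.trans ⟨fun h => h.imp fun r _ => ?_, fun h => h.imp fun r _ => ?_⟩
  · rintro ⟨i, -, h⟩
    refine ⟨ZFSet.mk (f i.1), ZFSet.mk_mem_iff.2 ⟨i.1, PSet.Equiv.refl _⟩, h.trans ?_⟩
    exact forcesEq_ofPSet (ZFSet.exact (ZFSet.mk_out _)).symm _
  · rintro ⟨a, ha, h⟩
    rw [← ZFSet.mk_out a, ZFSet.mk_mem_iff] at ha
    obtain ⟨i, hi⟩ := ha
    exact ⟨(i, Proj.π r), le_rfl, h.trans (forcesEq_ofPSet hi _)⟩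

theorem frc_mem_check {X : ZFSet.{u}} :
    (q ⊩ x ∈' .check X) ↔ Dn q fun r => ∃ a ∈ X, r ⊩ x =' .check a := by
  rw [Name.check, frc_mem_ofPSet, ZFSet.mk_out]

theorem frc_check_mem_of_mem {a X : ZFSet.{u}} (h : a ∈ X) :
    q ⊩ (.check a : Name P) ∈' .check X :=
  frc_mem_check.2 (Dn.of_forall fun _ _ => ⟨a, h, frc_refl _ _⟩)

/-- By `∈`-induction: below `q`, an element of one set is forced equal to an element of the other,
and a single condition forcing this already makes the two ground-model elements equal. -/
theorem frc_check_eq {a b : ZFSet.{u}} : (q ⊩ (.check a : Name P) =' .check b) ↔ a = b := by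
  refine ⟨fun h => ?_, fun h => by rw [h]; exact frc_refl _ _⟩
  induction a using ZFSet.inductionOn generalizing b q with
  | h a ih =>
    ext z
    constructor
    · intro hz
      obtain ⟨r, hr, c, hc, hzc⟩ :=
        (frc_mem_check.1 ((frc_check_mem_of_mem (P := P) hz).mem_right h)).exists
      exact (ih z hz hzc) ▸ hc
    · intro hz
      obtain ⟨r, hr, c, hc, hzc⟩ :=
        (frc_mem_check.1 ((frc_check_mem_of_mem (P := P) hz).mem_right h.symm)).exists
      exact ih c hc hzc.symm ▸ hc

theorem frc_check_mem {a X : ZFSet.{u}} : (q ⊩ (.check a : Name P) ∈' .check X) ↔ a ∈ X := by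
  refine ⟨fun h => ?_, frc_check_mem_of_mem⟩
  obtain ⟨r, hr, c, hc, h⟩ := (frc_mem_check.1 h).exists
  rwa [frc_check_eq.1 h]

theorem frc_check_insert_pair (a b : ZFSet.{u}) :
    q ⊩ (.check {a, b} : Name P) =' .pair (.check a) (.check b) := by
  refine frc_ext fun z r hr => ?_
  rw [frc_mem_check, frc_mem_pair]
  simp

theorem frc_check_pair (a b : ZFSet.{u}) :
    q ⊩ (.check (ZFSet.pair a b) : Name P) =' .opair (.check a) (.check b) := by
  have h := frc_check_insert_pair (P := P) (q := q) a a
  rw [ZFSet.pair_eq_singleton] at h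
  exact (frc_check_insert_pair _ _).trans (frc_pair_congr h (frc_check_insert_pair _ _))

/-- The name of the set of all `nm k` such that `In p k` for a condition `p` in the generic
filter. -/
noncomputable def Name.of {K : Type v} [Small.{u} K] (nm : K → Name P) (In : P → K → Prop) :
    Name P :=
  .mk {x : Shrink.{u} K × P // In x.2 ((equivShrink K).symm x.1)}
    (fun x => nm ((equivShrink K).symm x.1.1)) (fun x => x.1.2)

/-- Monotonicity of `In` makes the condition recorded with each element irrelevant. Names for
functions, trees and heights are built in this way. The index type is only required to be small,
since nodes and ordinals live one universe higher. -/
theorem frc_mem_of {K : Type v} [Small.{u} K] {nm : K → Name P} {In : P → K → Prop}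
    (hIn : ∀ p p' k, p ≤ p' → In p' k → In p k) :
    (q ⊩ x ∈' .of nm In) ↔ Dn q fun r => ∃ k, In (Proj.π r) k ∧ (r ⊩ x =' nm k) := by
  refine frc_mem_mk.trans ⟨fun h => h.imp fun r _ => ?_, fun h => h.imp fun r _ => ?_⟩
  · rintro ⟨⟨⟨k, p⟩, hk⟩, h, h'⟩
    exact ⟨_, hIn _ _ _ h hk, h'⟩
  · rintro ⟨k, hk, h'⟩
    exact ⟨⟨⟨equivShrink K k, Proj.π r⟩, by simpa using hk⟩, le_rfl, by simpa using h'⟩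

end Frc

end JechForcing

namespace JechForcing
open Fml Ordinal

/-! ### Countable ordinals -/

theorem lt_omega_one_iff_countable_Iio {o : Ordinal.{u}} : o < ω₁ ↔ (Set.Iio o).Countable := by
  rw [← Set.countable_coe_iff, ← Cardinal.mk_le_aleph0_iff, Cardinal.mk_Iio_ordinal]
  rw [← Cardinal.lift_aleph0.{u + 1, u}, Cardinal.lift_le, ← Order.lt_succ_iff,
    Cardinal.succ_aleph0, ← Cardinal.ord_aleph, Cardinal.lt_ord]

theorem exists_lt_omega_one_bound {α : Type v} [Countable α] (f : α → Ordinal.{u})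
    (h : ∀ i, f i < ω₁) : ∃ γ < (ω₁ : Ordinal.{u}), ∀ i, f i < γ :=
  ⟨_, (Cardinal.isSuccLimit_omega 1).succ_lt (Ordinal.iSup_lt_omega_one h),
    fun i => Order.lt_succ_iff.2 (Ordinal.le_iSup f i)⟩

theorem add_one_lt_omega_one {o : Ordinal.{u}} (h : o < ω₁) : o + 1 < ω₁ :=
  (Cardinal.isSuccLimit_omega 1).add_one_lt h

/-- Nonzero limit ordinals. -/
def LimOrd (o : Ordinal.{u}) : Prop := 0 < o ∧ ∀ a < o, a + 1 < o

theorem limOrd_omega0 : LimOrd ω :=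
  ⟨omega0_pos, fun _ h => isSuccLimit_omega0.add_one_lt h⟩

theorem not_limOrd_nat (n : ℕ) : ¬ LimOrd (n : Ordinal.{u}) := by
  rintro ⟨h, h'⟩
  cases n with
  | zero => simp at h
  | succ n => simpa using h' n (by simp)

theorem LimOrd.omega0_le {o : Ordinal.{u}} (h : LimOrd o) : ω ≤ o := by
  by_contra! hlt
  obtain ⟨n, rfl⟩ := lt_omega0.1 hlt
  exact not_limOrd_nat n h

/-! ### Density arguments -/

section Dn

variable {Q : Type w} [Preorder Q]

theorem Dn.and {Φ Ψ : Q → Prop} {q : Q} (h : Dn q Φ) (h' : Dn q Ψ)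
    (hΦ : ∀ r s, s ≤ r → Φ r → Φ s) : Dn q fun r => Φ r ∧ Ψ r :=
  h.bind fun _ hr h₁ => (h'.mono hr).imp fun _ hs h₂ => ⟨hΦ _ _ hs h₁, h₂⟩

theorem dn_finset {K : Type v} (F : Finset K) {Φ : K → Q → Prop} {q : Q}
    (h : ∀ k ∈ F, Dn q (Φ k)) (mono : ∀ k r s, s ≤ r → Φ k r → Φ k s) :
    Dn q fun r => ∀ k ∈ F, Φ k r := by
  classical
  induction F using Finset.induction_on with
  | empty => exact Dn.of_forall fun _ _ => by simp
  | insert a F _ ih =>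
    refine ((h a (by simp)).and (ih fun k hk => h k (by simp [hk])) (mono a)).imp fun r _ h => ?_
    simpa using h

/-- Countable descending sequences have lower bounds. -/
def SigmaClosed (Q : Type w) [Preorder Q] : Prop := ∀ s : ℕ → Q, Antitone s → ∃ r, ∀ n, r ≤ s n

/-- The `n`-th requirement is met at step `n + 1` of a descending sequence, and by monotonicity a
lower bound meets all of them. This is the only way in which σ-closure is exploited, so every
decision of countably many facts passes through it. -/
theorem SigmaClosed.dn_nat (hQ : SigmaClosed Q) {Φ : ℕ → Q → Prop} {q : Q}
    (h : ∀ n, Dn q (Φ n)) (mono : ∀ n r s, s ≤ r → Φ n r → Φ n s) :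
    Dn q fun r => ∀ n, Φ n r := by
  intro q' hq'
  choose f hf hΦ using h
  let s : ℕ → {r // r ≤ q} := fun n => Nat.rec ⟨q', hq'⟩
    (fun n r => ⟨f n r.1 r.2, (hf n _ _).trans r.2⟩) n
  have hs : Antitone fun n => (s n).1 := antitone_nat_of_succ_le fun n => hf n _ _
  obtain ⟨r, hr⟩ := hQ _ hs
  exact ⟨r, hr 0, fun n => mono n _ _ (hr (n + 1)) (hΦ n _ (s n).2)⟩

theorem SigmaClosed.dn_countable (hQ : SigmaClosed Q) {K : Type v} [Countable K]
    {Φ : K → Q → Prop} {q : Q} (h : ∀ n, Dn q (Φ n)) (mono : ∀ n r s, s ≤ r → Φ n r → Φ n s) :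
    Dn q fun r => ∀ n, Φ n r := by
  rcases isEmpty_or_nonempty K with hK | hK
  · exact Dn.of_forall fun _ _ k => hK.elim k
  · obtain ⟨e, he⟩ := exists_surjective_nat K
    refine (hQ.dn_nat (fun n => h (e n)) fun n => mono (e n)).imp fun r _ hr k => ?_
    obtain ⟨n, rfl⟩ := he k
    exact hr n

end Dn

/-- The canonical name of an ordinal. -/
noncomputable abbrev Name.ord {P : Type u} (o : Ordinal.{u}) : Name P := .check o.toZFSet

section Formulas

variable {Q : Type w} {P : Type u} [Preorder Q] [Preorder P] [Proj Q P]
variable {q r : Q} {x y z x' y' z' f X Y X' Y' : Name P}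

theorem frc_subset : (q ⊩ subset x y) ↔ ∀ z, ∀ r ≤ q, (r ⊩ z ∈' x) → (r ⊩ z ∈' y) := frc_allIn

theorem Frc.antisymm (h : q ⊩ subset x y) (h' : q ⊩ subset y x) : q ⊩ x =' y :=
  frc_ext fun z r hr => ⟨frc_subset.1 h z r hr, frc_subset.1 h' z r hr⟩

theorem frc_subset_congr (h : q ⊩ x =' x') (h' : q ⊩ y =' y') :
    (q ⊩ subset x y) ↔ (q ⊩ subset x' y') := by
  rw [frc_subset, frc_subset]
  refine forall_congr' fun z => forall_congr' fun r => forall_congr' fun hr => ?_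
  rw [frc_mem_right (h.mono hr), frc_mem_right (h'.mono hr)]

theorem frc_subset_check {a b : ZFSet.{u}} :
    (q ⊩ subset (.check a : Name P) (.check b)) ↔ a ⊆ b := by
  rw [frc_subset]
  refine ⟨fun h z hz => ?_, fun h z r hr hz => ?_⟩
  · exact frc_check_mem.1 (h _ q le_rfl (frc_check_mem_of_mem hz))
  · exact frc_mem_check.2 ((frc_mem_check.1 hz).imp fun s _ ⟨a, ha, h'⟩ => ⟨a, h ha, h'⟩)

/-! ### Ordinals -/

theorem frc_mem_ord {o : Ordinal.{u}} :
    (q ⊩ x ∈' .ord o) ↔ Dn q fun r => ∃ a < o, r ⊩ x =' .ord a := by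
  rw [Name.ord, frc_mem_check]
  simp [Ordinal.mem_toZFSet_iff]

theorem frc_ord_mem {a b : Ordinal.{u}} : (q ⊩ (.ord a : Name P) ∈' .ord b) ↔ a < b := by
  rw [frc_check_mem, toZFSet_mem_toZFSet_iff]

theorem frc_ord_eq {a b : Ordinal.{u}} : (q ⊩ (.ord a : Name P) =' .ord b) ↔ a = b := by
  rw [frc_check_eq, toZFSet_injective.eq_iff]

theorem frc_isTransitive :
    (q ⊩ isTransitive x) ↔ ∀ y z, ∀ r ≤ q, (r ⊩ y ∈' x) → (r ⊩ z ∈' y) → (r ⊩ z ∈' x) := by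
  refine frc_allIn.trans ⟨fun h y z r hr hy hz => frc_subset.1 (h y r hr hy) z r le_rfl hz,
    fun h y r hr hy => frc_subset.2 fun z s hs hz => h y z s (hs.trans hr) (hy.mono hs) hz⟩

theorem frc_isTransitive_of_eq_ord {o : Ordinal.{u}} (h : q ⊩ x =' .ord o) :
    q ⊩ isTransitive x := by
  refine frc_isTransitive.2 fun y z r hr hy hz => ?_
  refine (frc_mem_ord.1 (hy.mem_right (h.mono hr))).frc fun s hs ⟨a, ha, ha'⟩ => ?_
  refine Frc.mem_right (frc_mem_ord.2 ?_) (h.mono (hs.trans hr)).symm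
  exact (frc_mem_ord.1 ((hz.mono hs).mem_right ha')).imp fun t _ ⟨b, hb, hb'⟩ =>
    ⟨b, hb.trans ha, hb'⟩

theorem frc_isOrdinal_of_eq_ord {o : Ordinal.{u}} (h : q ⊩ x =' .ord o) : q ⊩ isOrdinal x :=
  ⟨frc_isTransitive_of_eq_ord h, frc_allIn.2 fun _ _ hr hy =>
    (frc_mem_ord.1 (hy.mem_right (h.mono hr))).frc fun _ _ ⟨_, _, h⟩ =>
      frc_isTransitive_of_eq_ord h⟩

theorem frc_isOrdinal_mem (h : q ⊩ isOrdinal x) (hy : q ⊩ y ∈' x) : q ⊩ isOrdinal y :=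
  ⟨frc_allIn.1 h.2 y q le_rfl hy, frc_allIn.2 fun z r hr hz => frc_allIn.1 h.2 z r hr
    (frc_isTransitive.1 h.1 y z r hr (hy.mono hr) hz)⟩

/-- Ordinals of a generic extension are ordinals of the ground model. -/
theorem dn_eq_ord (h : q ⊩ isOrdinal x) : Dn q fun r => ∃ o, r ⊩ x =' .ord o := by
  induction x generalizing q with
  | mk ι a c ih =>
  have hmem : ∀ z, ∀ r ≤ q, (r ⊩ z ∈' .mk ι a c) → Dn r fun s => ∃ o, s ⊩ z =' .ord o := by
    intro z r hr hz
    refine (frc_mem_mk.1 hz).bind fun s hs ⟨i, hi, hzi⟩ => ?_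
    have := ih i (q := s) (frc_isOrdinal_mem (h.mono (hs.trans hr))
      (frc_mem_mk.2 (Dn.of_forall fun t ht => ⟨i, (Proj.mono ht).trans hi, frc_refl _ _⟩)))
    exact this.imp fun t ht ⟨o, ho⟩ => ⟨o, (hzi.mono ht).trans ho⟩
  -- An ordinal that can be forced into the name is determined by an index of the name and a
  -- condition, so there are only set many; therefore some ordinal is never forced into it.
  have hsmall : Small.{u} {o : Ordinal.{u} // ∃ r : Q, r ⊩ (.ord o : Name P) ∈' .mk ι a c} := by
    have : ∀ o : {o : Ordinal.{u} // ∃ r : Q, r ⊩ (.ord o : Name P) ∈' .mk ι a c},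
        ∃ ip : ι × P, ∃ s : Q, ip.2 = Proj.π s ∧ ForcesEq (.ord o.1) (a ip.1) ip.2 := by
      rintro ⟨o, r, hr⟩
      obtain ⟨s, _, i, -, h⟩ := (frc_mem_mk.1 hr).exists
      exact ⟨(i, Proj.π s), s, rfl, h⟩
    choose g s hs hg using this
    refine small_of_injective (f := g) fun o o' h => ?_
    have h₁ := hg o
    have h₂ := hg o'
    rw [← h, hs o] at h₂
    rw [hs o] at h₁
    exact Subtype.ext (frc_ord_eq (q := s o).1 (h₁.trans h₂.symm))
  have hex : ∃ o : Ordinal.{u}, ∀ r : Q, ¬ (r ⊩ (.ord o : Name P) ∈' .mk ι a c) := by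
    by_contra! hall
    have : Small.{u} Ordinal.{u} := by
      refine small_of_injective (β := {o : Ordinal.{u} // ∃ r : Q,
        r ⊩ (.ord o : Name P) ∈' .mk ι a c}) (f := fun o => ⟨o, hall o⟩) fun o o' h => ?_
      simpa using h
    exact not_small_ordinal.{u, u} this
  intro r hr
  obtain ⟨o₀, ho₀⟩ := hex
  -- The least ordinal that `r` does not force into the name. Some `s` below `r` has no extension
  -- forcing it in, and `s` forces the name to equal this ordinal.
  obtain ⟨o, ho, hmin⟩ := WellFounded.has_min (wellFounded_lt (α := Ordinal.{u}))
    {o | ¬ (r ⊩ (.ord o : Name P) ∈' .mk ι a c)} ⟨o₀, ho₀ r⟩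
  obtain ⟨s, hs, hs'⟩ : ∃ s ≤ r, ∀ t ≤ s, ¬ (t ⊩ (.ord o : Name P) ∈' .mk ι a c) := by
    by_contra! hcon
    exact ho (Frc.of_dense hcon)
  refine ⟨s, hs, o, frc_ext fun z t ht => ⟨fun hz => ?_, fun hz => ?_⟩⟩
  · refine (hmem z t (ht.trans (hs.trans hr)) hz).frc fun t' ht' ⟨b, hb⟩ => ?_
    refine (frc_mem_ord.2 (Dn.of_forall fun t'' ht'' => ⟨b, ?_, hb.mono ht''⟩))
    by_contra! hle
    refine hs' t' (ht'.trans ht) ?_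
    have hz' := (hz.mono ht').mem_left hb
    rcases hle.eq_or_lt with rfl | hlt
    · exact hz'
    · exact frc_isTransitive.1 h.1 _ _ t' (ht'.trans (ht.trans (hs.trans hr))) hz'
        (frc_ord_mem.2 hlt)
  · refine (frc_mem_ord.1 hz).frc fun t' ht' ⟨b, hb, hb'⟩ => ?_
    have : r ⊩ (.ord b : Name P) ∈' .mk ι a c := by
      by_contra hcon
      exact hmin b hcon hb
    exact (this.mono (ht'.trans (ht.trans hs))).mem_left hb'.symm

theorem frc_isLimit {o : Ordinal.{u}} (h : q ⊩ x =' .ord o) : (q ⊩ isLimit x) ↔ LimOrd o := by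
  constructor
  · rintro ⟨h₁, h₂⟩
    constructor
    · obtain ⟨r, hr, y, hy⟩ := (frc_ex.1 h₁).exists
      obtain ⟨s, hs, a, ha, -⟩ := (frc_mem_ord.1 (hy.mem_right (h.mono hr))).exists
      exact (zero_le).trans_lt ha
    · intro a ha
      obtain ⟨r, hr, z, hz, haz⟩ := (frc_exIn.1 (frc_allIn.1 h₂ _ q le_rfl
        ((frc_ord_mem.2 ha).mem_right h.symm))).exists
      obtain ⟨s, hs, b, hb, hzb⟩ := (frc_mem_ord.1 (hz.mem_right (h.mono hr))).exists
      have := frc_ord_mem.1 ((haz.mono hs).mem_right hzb)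
      exact (Order.add_one_le_iff.2 this).trans_lt hb
  · rintro ⟨h₁, h₂⟩
    refine ⟨frc_ex_of (.ord 0) ((frc_ord_mem.2 h₁).mem_right h.symm), ?_⟩
    refine frc_allIn.2 fun y r hr hy => ?_
    refine (frc_mem_ord.1 (hy.mem_right (h.mono hr))).frc fun s hs ⟨a, ha, hya⟩ => ?_
    refine frc_exIn_of (.ord (a + 1)) ((frc_ord_mem.2 (h₂ a ha)).mem_right
      (h.mono (hs.trans hr)).symm) ?_
    exact (frc_ord_mem.2 (lt_add_one a)).mem_left hya.symm

theorem frc_isOmega : (q ⊩ isOmega x) ↔ (q ⊩ x =' .ord ω) := by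
  constructor
  · rintro ⟨h₁, h₂, h₃⟩
    refine (dn_eq_ord h₁).frc fun r hr ⟨o, ho⟩ => ?_
    have hl := (frc_isLimit ho).1 (Frc.mono (q := q) h₂ hr)
    rcases hl.omega0_le.eq_or_lt with rfl | hlt
    · exact ho
    · have := frc_allIn.1 h₃ (.ord ω) r hr ((frc_ord_mem.2 hlt).mem_right ho.symm)
      exact (frc_not.1 this r le_rfl ((frc_isLimit (frc_refl _ _)).2 limOrd_omega0)).elim
  · intro h
    refine ⟨frc_isOrdinal_of_eq_ord h, (frc_isLimit h).2 limOrd_omega0, frc_allIn.2 ?_⟩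
    intro y r hr hy
    refine (frc_mem_ord.1 (hy.mem_right (h.mono hr))).frc fun s hs ⟨a, ha, hya⟩ => ?_
    refine frc_not.2 fun t ht hl => ?_
    obtain ⟨n, rfl⟩ := lt_omega0.1 ha
    exact not_limOrd_nat n ((frc_isLimit (hya.mono ht)).1 hl)

theorem frc_mem_omega : (q ⊩ x ∈' .ord ω) ↔ Dn q fun r => ∃ n : ℕ, r ⊩ x =' .ord n := by
  refine frc_mem_ord.trans ⟨fun h => h.imp fun r _ ⟨a, ha, h⟩ => ?_,
    fun h => h.imp fun r _ ⟨n, h⟩ => ⟨n, natCast_lt_omega0 n, h⟩⟩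
  obtain ⟨n, rfl⟩ := lt_omega0.1 ha
  exact ⟨n, h⟩

theorem frc_mem_nat {n : ℕ} : (q ⊩ x ∈' .ord n) ↔ Dn q fun r => ∃ m < n, r ⊩ x =' .ord (m : ℕ) := by
  refine frc_mem_ord.trans ⟨fun h => h.imp fun r _ ⟨a, ha, h⟩ => ?_,
    fun h => h.imp fun r _ ⟨m, hm, h⟩ => ⟨m, by simpa using hm, h⟩⟩
  obtain ⟨m, rfl⟩ := lt_omega0.1 (ha.trans (natCast_lt_omega0 n))
  exact ⟨m, by simpa using ha, h⟩

/-! ### Functions -/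

theorem frc_isFunction :
    (q ⊩ isFunction f X Y) ↔
    (∀ z, ∀ r ≤ q, (r ⊩ z ∈' f) → Dn r fun s => ∃ x y, (s ⊩ x ∈' X) ∧ (s ⊩ y ∈' Y) ∧
      (s ⊩ z =' .opair x y)) ∧
    (∀ x, ∀ r ≤ q, (r ⊩ x ∈' X) → Dn r fun s => ∃ y, (s ⊩ .opair x y ∈' f) ∧
      ∀ y', ∀ t ≤ s, (t ⊩ .opair x y' ∈' f) → (t ⊩ y' =' y)) := by
  refine and_congr (frc_allIn.trans ?_) (frc_allIn.trans ?_)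
  · refine forall_congr' fun z => forall_congr' fun r => forall_congr' fun hr =>
      forall_congr' fun hz => ?_
    refine frc_exIn.trans ⟨fun h => h.bind fun s _ ⟨x, hx, h⟩ => (frc_exIn.1 h).imp
      fun t ht ⟨y, hy, h⟩ => ⟨x, y, hx.mono ht, hy, frc_isOPair.1 h⟩, fun h => h.imp
      fun s _ ⟨x, y, hx, hy, h⟩ => ⟨x, hx, frc_exIn_of y hy (frc_isOPair.2 h)⟩⟩
  · refine forall_congr' fun z => forall_congr' fun r => forall_congr' fun hr =>
      forall_congr' fun hz => ?_
    refine frc_ex.trans ⟨fun h => h.imp fun s _ ⟨y, hy, h⟩ => ⟨y, frc_pairMem.1 hy,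
      fun y' t ht h' => frc_imp.1 (h y') t ht (frc_pairMem.2 h')⟩, fun h => h.imp fun s _ ⟨y, hy, h⟩ =>
      ⟨y, frc_pairMem.2 hy, fun y' => frc_imp.2 fun t ht h' => h y' t ht (frc_pairMem.1 h')⟩⟩

theorem Frc.isFunction_congr (h : q ⊩ isFunction f X Y) (hX : q ⊩ X =' X') (hY : q ⊩ Y =' Y') :
    q ⊩ isFunction f X' Y' := by
  rw [frc_isFunction] at h ⊢
  refine ⟨fun z r hr hz => (h.1 z r hr hz).imp fun s hs ⟨x, y, hx, hy, h⟩ => ⟨x, y,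
    hx.mem_right (hX.mono (hs.trans hr)), hy.mem_right (hY.mono (hs.trans hr)), h⟩,
    fun x r hr hx => h.2 x r hr (hx.mem_right (hX.mono hr).symm)⟩

theorem Frc.isFunction_mem (h : q ⊩ isFunction f X Y) (hm : q ⊩ .opair x y ∈' f) :
    (q ⊩ x ∈' X) ∧ (q ⊩ y ∈' Y) := by
  have := (frc_isFunction.1 h).1 _ q le_rfl hm
  exact ⟨this.frc fun r _ ⟨x', y', hx, _, e⟩ => hx.mem_left (frc_opair_inj.1 e).1.symm,
    this.frc fun r _ ⟨x', y', _, hy, e⟩ => hy.mem_left (frc_opair_inj.1 e).2.symm⟩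

theorem Frc.isFunction_unique (h : q ⊩ isFunction f X Y) (hm : q ⊩ .opair x y ∈' f)
    (hm' : q ⊩ .opair x y' ∈' f) : q ⊩ y =' y' :=
  ((frc_isFunction.1 h).2 x q le_rfl (h.isFunction_mem hm).1).frc fun r hr ⟨_, _, hu⟩ =>
    (hu _ r le_rfl (hm.mono hr)).trans (hu _ r le_rfl (hm'.mono hr)).symm

theorem Frc.isFunction_total (h : q ⊩ isFunction f X Y) (hx : q ⊩ x ∈' X) :
    Dn q fun r => ∃ y, (r ⊩ y ∈' Y) ∧ (r ⊩ .opair x y ∈' f) :=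
  ((frc_isFunction.1 h).2 x q le_rfl hx).imp fun _ hr ⟨y, hy, _⟩ =>
    ⟨y, ((h.mono hr).isFunction_mem hy).2, hy⟩

theorem frc_isInjective : (q ⊩ isInjective f) ↔ ∀ x x' y, ∀ r ≤ q, (r ⊩ .opair x y ∈' f) →
    (r ⊩ .opair x' y ∈' f) → (r ⊩ x =' x') := by
  refine forall_congr' fun x => forall_congr' fun x' => forall_congr' fun y => frc_imp.trans ?_
  simp only [frc_imp, frc_pairMem]
  exact ⟨fun h r hr k k' => h r hr k r le_rfl k',
    fun h r hr k s hs k' => h s (hs.trans hr) (k.mono hs) k'⟩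

/-! ### Countable and finite sets -/

theorem frc_isCountable :
    (q ⊩ isCountable x) ↔ Dn q fun r => ∃ f, (r ⊩ isFunction f x (.ord ω)) ∧
      (r ⊩ isInjective f) := by
  refine frc_ex.trans ⟨fun h => h.bind fun r hr ⟨w, hw, h⟩ => (frc_ex.1 h).imp
    fun s hs ⟨f, hf, h⟩ => ⟨f, ?_, h⟩, fun h => h.imp fun r hr ⟨f, hf, h⟩ =>
      ⟨.ord ω, frc_isOmega.2 (frc_refl _ _), frc_ex_of f ⟨hf, h⟩⟩⟩
  exact Frc.isFunction_congr hf (frc_refl _ _) (Frc.mono (q := r) (frc_isOmega.1 hw) hs)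

theorem frc_isFinite :
    (q ⊩ isFinite x) ↔ Dn q fun r => ∃ n : ℕ, ∃ f, (r ⊩ isFunction f x (.ord n)) ∧
      (r ⊩ isInjective f) := by
  refine frc_ex.trans ⟨fun h => h.bind fun r hr ⟨w, hw, h⟩ => (frc_exIn.1 h).bind
    fun s hs ⟨n, hn, h⟩ => ?_, fun h => h.imp fun r hr ⟨n, f, hf, h⟩ =>
      ⟨.ord ω, frc_isOmega.2 (frc_refl _ _), frc_exIn_of (.ord n)
        (frc_ord_mem.2 (natCast_lt_omega0 n)) (frc_ex_of f ⟨hf, h⟩)⟩⟩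
  have hn' := hn.mem_right (Frc.mono (q := r) (frc_isOmega.1 hw) hs)
  refine (frc_mem_omega.1 hn').bind fun t ht ⟨m, hm⟩ => ((frc_ex.1 h).mono ht).imp
    fun t' ht' ⟨f, hf, h⟩ => ⟨m, f, ?_, h⟩
  exact Frc.isFunction_congr hf (frc_refl _ _) (hm.mono ht')

/-- A name for the function `c ↦ g c` on the set `x` of ground model elements. -/
theorem exists_function_of_ground (C : Set ZFSet.{u}) [Small.{u} C] (g : C → Ordinal.{u})
    (hg : Function.Injective g) (o : Ordinal.{u}) (ho : ∀ c, g c < o)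
    (h : ∀ z, ∀ r ≤ q, (r ⊩ z ∈' x) → Dn r fun s => ∃ c ∈ C, s ⊩ z =' .check c) :
    ∃ f, (q ⊩ isFunction f x (.ord o)) ∧ (q ⊩ isInjective f) := by
  let f : Name P := .of (fun c : C => .opair (.check c.1) (.ord (g c)))
    (fun p c => Forces p (.check c.1 ∈' x))
  have hf : ∀ {z : Name P} {r : Q}, (r ⊩ z ∈' f) ↔ Dn r fun s => ∃ c : C,
      (s ⊩ .check c.1 ∈' x) ∧ (s ⊩ z =' .opair (.check c.1) (.ord (g c))) :=
    frc_mem_of fun _ _ _ hp h => Forces.mono h hp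
  refine ⟨f, frc_isFunction.2 ⟨fun z r hr hz => ?_, fun z r hr hz => ?_⟩,
    frc_isInjective.2 fun z z' y r hr hz hz' => ?_⟩
  · exact (hf.1 hz).imp fun s hs ⟨c, hc, h⟩ => ⟨_, _, hc, frc_ord_mem.2 (ho c), h⟩
  · refine (h z r hr hz).imp fun s hs ⟨c, hc, h⟩ => ⟨.ord (g ⟨c, hc⟩), hf.2 ?_, ?_⟩
    · exact Dn.of_forall fun t ht => ⟨⟨c, hc⟩, ((hz.mono hs).mem_left h).mono ht,
        frc_opair_congr (h.mono ht) (frc_refl _ _)⟩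
    · intro y' t ht hy'
      refine (hf.1 hy').frc fun t' ht' ⟨c', hc', h'⟩ => ?_
      rw [frc_opair_inj] at h'
      have : c = c' := frc_check_eq.1 ((h.mono (ht'.trans ht)).symm.trans h'.1)
      subst this
      exact h'.2
  · refine ((hf.1 hz).and (hf.1 hz') ?_).frc fun s hs => ?_
    · rintro r s hs ⟨c, hc, h⟩
      exact ⟨c, hc.mono hs, h.mono hs⟩
    · rintro ⟨⟨c, hc, h⟩, c', hc', h'⟩
      rw [frc_opair_inj] at h h'
      have : c = c' := hg (frc_ord_eq.1 (h.2.symm.trans h'.2))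
      subst this
      exact h.1.trans h'.1.symm

theorem frc_isCountable_of {C : Set ZFSet.{u}} (hC : C.Countable)
    (h : ∀ z, ∀ r ≤ q, (r ⊩ z ∈' x) → Dn r fun s => ∃ c ∈ C, s ⊩ z =' .check c) :
    q ⊩ isCountable x := by
  have := hC.to_subtype
  obtain ⟨g, hg⟩ := exists_injective_nat C
  exact frc_isCountable.2 (Dn.of_forall fun r hr => exists_function_of_ground C
    (fun c => (g c : Ordinal.{u})) (fun c c' h => hg (by simpa using h)) ω
    (fun c => natCast_lt_omega0 _) fun z s hs => h z s (hs.trans hr))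

theorem frc_isFinite_of {C : Set ZFSet.{u}} (hC : C.Finite)
    (h : ∀ z, ∀ r ≤ q, (r ⊩ z ∈' x) → Dn r fun s => ∃ c ∈ C, s ⊩ z =' .check c) :
    q ⊩ isFinite x := by
  have := hC.to_subtype
  obtain ⟨n, ⟨g⟩⟩ := Finite.exists_equiv_fin C
  exact frc_isFinite.2 (Dn.of_forall fun r hr => ⟨n, exists_function_of_ground C
    (fun c => ((g c : ℕ) : Ordinal.{u})) (fun c c' h => g.injective (Fin.ext (by simpa using h))) n
    (fun c => by simp) fun z s hs => h z s (hs.trans hr)⟩)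

/-- Pigeonhole: one condition decides the values of an injection into `n` at `n + 1` ground-model
elements. These are finitely many decisions, so no closure of the forcing is needed. -/
theorem not_frc_isFinite_of {C : Set ZFSet.{u}} (hC : C.Infinite)
    (h : ∀ c ∈ C, q ⊩ .check c ∈' x) : ¬ (q ⊩ isFinite x) := by
  intro hfin
  obtain ⟨r, hr, n, f, hf, hinj⟩ := (frc_isFinite.1 hfin).exists
  obtain ⟨F, hFC, hF⟩ := hC.exists_subset_card_eq (n + 1)
  have := dn_finset (q := r) (Φ := fun c s => ∃ m < n, s ⊩ .opair (.check c) (.ord (m : ℕ)) ∈' f) F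
    (fun c hc => ?_) fun c s t ht ⟨m, hm, h⟩ => ⟨m, hm, h.mono ht⟩
  · obtain ⟨s, hs, hsF⟩ := this.exists
    choose! m hm hmf using hsF
    obtain ⟨c, hc, c', hc', hne, heq⟩ := Finset.exists_ne_map_eq_of_card_lt_of_maps_to
      (s := F) (t := Finset.range n) (f := m) (by simp [hF]) fun c hc => by simpa using hm c hc
    have h' := hmf c' hc'
    rw [← heq] at h'
    exact hne (frc_check_eq.1 (frc_isInjective.1 hinj _ _ _ s hs (hmf c hc) h'))
  · refine (hf.isFunction_total ((h c (hFC hc)).mono hr)).bind fun s hs ⟨y, hy, hyf⟩ => ?_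
    refine (frc_mem_nat.1 hy).imp fun t ht ⟨m, hm, h⟩ => ⟨m, hm, ?_⟩
    exact (hyf.mono ht).mem_left (frc_opair_congr (frc_refl _ _) h)

/-- Below some condition, an injection to `ω` in the extension is enumerated by a sequence of
names in the ground model. -/
theorem SigmaClosed.dn_enum (hQ : SigmaClosed Q) (h : q ⊩ isCountable x) :
    Dn q fun r => ∃ nm : ℕ → Name P, ∀ z, ∀ s ≤ r, (s ⊩ z ∈' x) →
      Dn s fun t => ∃ n, (t ⊩ nm n ∈' x) ∧ (t ⊩ z =' nm n) := by
  refine (frc_isCountable.1 h).bind fun r hr ⟨f, hf, hinj⟩ => ?_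
  -- For every `n`, either a name for the preimage of `n` is fixed or `n` is excluded from the range
  -- for good. In the second case the chosen name is a dummy.
  have := hQ.dn_nat (q := r) (Φ := fun n s => ∃ z, (s ⊩ .opair z (.ord (n : ℕ)) ∈' f) ∨
    ∀ z, ∀ t ≤ s, ¬ (t ⊩ .opair z (.ord (n : ℕ)) ∈' f)) (fun n s hs => ?_) ?_
  · refine this.imp fun s hs hn => ?_
    choose nm hnm using hn
    refine ⟨nm, fun z t ht hz => ?_⟩
    refine ((hf.mono (ht.trans hs)).isFunction_total hz).bind fun t' ht' ⟨y, hy, hyf⟩ => ?_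
    refine (frc_mem_omega.1 hy).imp fun t'' ht'' ⟨n, hn⟩ => ⟨n, ?_⟩
    have h₁ := (hyf.mono ht'').mem_left (frc_opair_congr (frc_refl _ _) hn)
    have hs' := ht''.trans (ht'.trans ht)
    rcases hnm n with h₂ | h₂
    · have h₂ := h₂.mono hs'
      exact ⟨((hf.mono (hs'.trans hs)).isFunction_mem h₂).1,
        frc_isInjective.1 hinj _ _ _ t'' (hs'.trans hs) h₁ h₂⟩
    · exact (h₂ z t'' hs' h₁).elim
  · by_cases hc : ∃ z, ∃ t ≤ s, t ⊩ .opair z (.ord (n : ℕ)) ∈' f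
    · obtain ⟨z, t, ht, h⟩ := hc
      exact ⟨t, ht, z, .inl h⟩
    · push Not at hc
      exact ⟨s, le_rfl, x, .inr hc⟩
  · rintro n s t ht ⟨z, h⟩
    exact ⟨z, h.imp (·.mono ht) fun h z t' ht' => h z t' (ht'.trans ht)⟩

/-- One condition decides all terms of an enumeration by names. The countably many ordinals obtained
have a bound below `ω₁`, which the enumeration misses. -/
theorem SigmaClosed.not_isCountable_omega_one (hQ : SigmaClosed Q) :
    ¬ (q ⊩ isCountable (.ord ω₁ : Name P)) := by
  intro h
  obtain ⟨r, hr, nm, hnm⟩ := (hQ.dn_enum h).exists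
  have := hQ.dn_nat (q := r) (Φ := fun n s => ∃ o < (ω₁ : Ordinal.{u}), (s ⊩ nm n =' .ord o) ∨
    ∀ t ≤ s, ¬ (t ⊩ nm n ∈' .ord ω₁)) (fun n s hs => ?_) ?_
  · obtain ⟨s, hs, hn⟩ := this.exists
    choose g hg hgn using hn
    obtain ⟨γ, hγ, hγ'⟩ := exists_lt_omega_one_bound g hg
    obtain ⟨t, ht, n, hn, he⟩ := (hnm (.ord γ) s hs (frc_ord_mem.2 hγ)).exists
    rcases hgn n with h | h
    · exact (hγ' n).ne (frc_ord_eq.1 (he.trans (h.mono ht))).symm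
    · exact h t ht hn
  · rcases em (∃ t ≤ s, t ⊩ nm n ∈' .ord ω₁) with ⟨t, ht, h⟩ | hc
    · obtain ⟨t', ht', o, ho, h⟩ := (frc_mem_ord.1 h).exists
      exact ⟨t', ht'.trans ht, o, ho, .inl h⟩
    · push Not at hc
      exact ⟨s, le_rfl, 0, omega_pos 1, .inr hc⟩
  · rintro n s t ht ⟨o, ho, h⟩
    exact ⟨o, ho, h.imp (·.mono ht) fun h t' ht' => h t' (ht'.trans ht)⟩

theorem SigmaClosed.frc_isOmega1 (hQ : SigmaClosed Q) : q ⊩ isOmega1 (.ord ω₁ : Name P) := by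
  refine ⟨frc_isOrdinal_of_eq_ord (frc_refl q _), frc_not.2 fun r hr =>
    hQ.not_isCountable_omega_one, frc_allIn.2 fun y r hr hy => ?_⟩
  refine (frc_mem_ord.1 hy).frc fun s hs ⟨o, ho, h⟩ => ?_
  refine frc_isCountable_of ((lt_omega_one_iff_countable_Iio.1 ho).image toZFSet)
    fun z t ht hz => ?_
  refine (frc_mem_ord.1 (hz.mem_right (h.mono ht))).imp fun t' ht' ⟨a, ha, h⟩ =>
    ⟨_, ⟨a, ha, rfl⟩, h⟩

end Formulas
end JechForcing

/-! ### Trees of a generic extension whose nodes are coded in the ground model -/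

namespace JechForcing
open Fml Ordinal

/-- A tree with a root, given with its height function, such that nodes of limit height are
determined by their predecessors. -/
structure LTree (ι : Type w) where
  lt : ι → ι → Prop
  ht : ι → Ordinal.{u}
  trans : ∀ {x y z}, lt x y → lt y z → lt x z
  ht_lt : ∀ {x y}, lt x y → ht x < ht y
  res : ∀ {y β}, β < ht y → ∃ x, lt x y ∧ ht x = β
  cmp : ∀ {x y z}, lt x z → lt y z → ht x < ht y → lt x y
  uniq : ∀ {x y z}, lt x z → lt y z → ht x = ht y → x = y
  lim : ∀ {x y}, LimOrd (ht x) → ht x = ht y → (∀ z, lt z x ↔ lt z y) → x = y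

/-- A family of trees, one for each filter on `P`: the nodes are those `i` with `In p i` for some
`p` in the filter. They are coded by sets in the ground model. -/
structure NTree (P : Type u) [Preorder P] (ι : Type w) extends LTree.{u} ι where
  code : ι → ZFSet.{u}
  inj : Function.Injective code
  In : P → ι → Prop
  mono : ∀ {p p' i}, p ≤ p' → In p' i → In p i
  down : ∀ {p i j}, lt i j → In p j → In p i

section

variable {Q : Type w} {P : Type u} [Preorder Q] [Preorder P] [Proj Q P] {ι : Type w'}

namespace NTree

/-- The name `A` is interpreted by the set of nodes of the tree. -/
def Nodes (T : NTree P ι) (q : Q) (A : Name P) : Prop :=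
  ∀ r ≤ q, ∀ z, (r ⊩ z ∈' A) ↔ Dn r fun s => ∃ i, T.In (Proj.π s) i ∧ (s ⊩ z =' .check (T.code i))

/-- The name `R` is interpreted by the order of the tree. -/
def Order (T : NTree P ι) (q : Q) (R : Name P) : Prop :=
  ∀ r ≤ q, ∀ z, (r ⊩ z ∈' R) ↔ Dn r fun s => ∃ i j, T.lt i j ∧ T.In (Proj.π s) i ∧
    T.In (Proj.π s) j ∧ (s ⊩ z =' .opair (.check (T.code i)) (.check (T.code j)))

/-- The name `h` is interpreted by the height function of the tree. -/
def Height (T : NTree P ι) (q : Q) (h : Name P) : Prop :=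
  ∀ r ≤ q, ∀ z, (r ⊩ z ∈' h) ↔ Dn r fun s => ∃ i, T.In (Proj.π s) i ∧
    (s ⊩ z =' .opair (.check (T.code i)) (.ord (T.ht i)))

variable {T : NTree P ι} {q r s : Q} {A R h x y z α B : Name P} {i j : ι}

theorem Nodes.le (hA : T.Nodes q A) (h : r ≤ q) : T.Nodes r A := fun s hs => hA s (hs.trans h)
theorem Order.le (hA : T.Order q A) (h : r ≤ q) : T.Order r A := fun s hs => hA s (hs.trans h)
theorem Height.le (hA : T.Height q A) (h : r ≤ q) : T.Height r A := fun s hs => hA s (hs.trans h)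

theorem in_mono (h : T.In (Proj.π r) i) (hs : s ≤ r) : T.In (Proj.π s) i := T.mono (Proj.mono hs) h

theorem exists_nodes (T : NTree P ι) [Small.{u} ι] : ∃ A : Name P, ∀ q : Q, T.Nodes q A :=
  ⟨.of (fun i => .check (T.code i)) T.In, fun _ _ _ _ => frc_mem_of fun _ _ _ => T.mono⟩

theorem exists_order (T : NTree P ι) [Small.{u} ι] : ∃ R : Name P, ∀ q : Q, T.Order q R := by
  refine ⟨.of (K := ι × ι) (fun i => .opair (.check (T.code i.1)) (.check (T.code i.2)))
    fun p i => T.lt i.1 i.2 ∧ T.In p i.1 ∧ T.In p i.2, fun _ _ _ _ => (frc_mem_of ?_).trans ?_⟩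
  · exact fun _ _ _ hp h => ⟨h.1, T.mono hp h.2.1, T.mono hp h.2.2⟩
  · simp only [Prod.exists, and_assoc]

theorem exists_height (T : NTree P ι) [Small.{u} ι] : ∃ h : Name P, ∀ q : Q, T.Height q h :=
  ⟨.of (fun i => .opair (.check (T.code i)) (.ord (T.ht i))) T.In,
    fun _ _ _ _ => frc_mem_of fun _ _ _ => T.mono⟩

theorem Nodes.eq {A' : Name P} (hA : T.Nodes q A) (hA' : T.Nodes q A') : q ⊩ A =' A' :=
  frc_ext fun z r hr => (hA r hr z).trans (hA' r hr z).symm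

theorem Nodes.mem (hA : T.Nodes q A) (hi : T.In (Proj.π q) i) : q ⊩ .check (T.code i) ∈' A :=
  (hA q le_rfl _).2 (Dn.of_forall fun _ hr => ⟨i, in_mono hi hr, frc_refl _ _⟩)

theorem Nodes.dn (hA : T.Nodes q A) (hz : q ⊩ z ∈' A) :
    Dn q fun s => ∃ i, T.In (Proj.π s) i ∧ (s ⊩ z =' .check (T.code i)) := (hA q le_rfl _).1 hz

theorem Nodes.dn_code (hA : T.Nodes q A) (hz : q ⊩ .check (T.code i) ∈' A) :
    Dn q fun s => T.In (Proj.π s) i :=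
  (hA.dn hz).imp fun s _ ⟨j, hj, h⟩ => by rwa [T.inj (frc_check_eq.1 h)]

theorem Order.mem (hR : T.Order q R) (hij : T.lt i j) (hj : T.In (Proj.π q) j)
    (hx : q ⊩ x =' .check (T.code i)) (hy : q ⊩ y =' .check (T.code j)) : q ⊩ .opair x y ∈' R :=
  (hR q le_rfl _).2 (Dn.of_forall fun _ hr => ⟨i, j, hij, in_mono (T.down hij hj) hr,
    in_mono hj hr, frc_opair_congr (hx.mono hr) (hy.mono hr)⟩)

theorem Order.dn (hR : T.Order q R) (hz : q ⊩ .opair x y ∈' R) :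
    Dn q fun s => ∃ i j, T.lt i j ∧ T.In (Proj.π s) i ∧ T.In (Proj.π s) j ∧
      (s ⊩ x =' .check (T.code i)) ∧ (s ⊩ y =' .check (T.code j)) :=
  ((hR q le_rfl _).1 hz).imp fun _ _ ⟨i, j, h₁, h₂, h₃, h₄⟩ =>
    ⟨i, j, h₁, h₂, h₃, frc_opair_inj.1 h₄⟩

/-- Version of `Order.dn` where the upper node is known. -/
theorem Order.dn_right (hR : T.Order q R) (hz : q ⊩ .opair x y ∈' R)
    (hy : q ⊩ y =' .check (T.code j)) :
    Dn q fun s => ∃ i, T.lt i j ∧ T.In (Proj.π s) i ∧ (s ⊩ x =' .check (T.code i)) :=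
  (hR.dn hz).imp fun _ hs ⟨i, j', h₁, h₂, _, h₄, h₅⟩ => ⟨i, by
    rwa [T.inj (frc_check_eq.1 ((hy.mono hs).symm.trans h₅))], h₂, h₄⟩

theorem Order.dn_left (hR : T.Order q R) (hz : q ⊩ .opair x y ∈' R)
    (hx : q ⊩ x =' .check (T.code i)) :
    Dn q fun s => ∃ j, T.lt i j ∧ T.In (Proj.π s) j ∧ (s ⊩ y =' .check (T.code j)) :=
  (hR.dn hz).imp fun _ hs ⟨i', j, h₁, _, h₃, h₄, h₅⟩ => ⟨j, by
    rwa [T.inj (frc_check_eq.1 ((hx.mono hs).symm.trans h₄))], h₃, h₅⟩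

theorem Order.lt_of (hR : T.Order q R) (hz : q ⊩ .opair x y ∈' R)
    (hx : q ⊩ x =' .check (T.code i)) (hy : q ⊩ y =' .check (T.code j)) : T.lt i j := by
  obtain ⟨s, hs, i', h, _, h'⟩ := (hR.dn_right hz hy).exists
  rwa [T.inj (frc_check_eq.1 ((hx.mono hs).symm.trans h'))]

theorem Height.mem (hh : T.Height q h) (hi : T.In (Proj.π q) i)
    (hx : q ⊩ x =' .check (T.code i)) (hα : q ⊩ α =' .ord (T.ht i)) : q ⊩ .opair x α ∈' h :=
  (hh q le_rfl _).2 (Dn.of_forall fun _ hr => ⟨i, in_mono hi hr,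
    frc_opair_congr (hx.mono hr) (hα.mono hr)⟩)

theorem Height.dn (hh : T.Height q h) (hz : q ⊩ .opair x α ∈' h) :
    Dn q fun s => ∃ i, T.In (Proj.π s) i ∧ (s ⊩ x =' .check (T.code i)) ∧
      (s ⊩ α =' .ord (T.ht i)) :=
  ((hh q le_rfl _).1 hz).imp fun _ _ ⟨i, h₁, h₂⟩ => ⟨i, h₁, frc_opair_inj.1 h₂⟩

theorem Height.dn_code (hh : T.Height q h) (hz : q ⊩ .opair x α ∈' h)
    (hx : q ⊩ x =' .check (T.code i)) :
    (q ⊩ α =' .ord (T.ht i)) ∧ Dn q fun s => T.In (Proj.π s) i := by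
  have : Dn q fun s => (s ⊩ α =' .ord (T.ht i)) ∧ T.In (Proj.π s) i :=
    (hh.dn hz).imp fun s hs ⟨j, h₁, h₂, h₃⟩ => by
      rw [T.inj (frc_check_eq.1 ((hx.mono hs).symm.trans h₂))]
      exact ⟨h₃, h₁⟩
  exact ⟨this.frc fun s _ h => h.1, this.imp fun s _ h => h.2⟩

/-- A name for the function on the tree `A` is interpreted by the height function if and only if
it satisfies the recursive equation for the height. -/
theorem frc_isHeightFn [Small.{u} ι] (hA : T.Nodes q A) (hR : T.Order q R) :
    (q ⊩ isHeightFn A R h) ↔ T.Height q h := by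
  constructor
  · intro hh
    obtain ⟨h₁, h₂⟩ := frc_and.1 hh
    have hfun : ∀ r ≤ q, ∀ z, (r ⊩ z ∈' A) → Dn r fun s => ∃ y, s ⊩ .opair z y ∈' h := by
      intro r hr z hz
      exact ((frc_ex.1 h₁).mono hr).bind fun s hs ⟨Y, hY⟩ =>
        (hY.isFunction_total (hz.mono hs)).imp fun t _ ⟨y, _, hy⟩ => ⟨y, hy⟩
    have hdom : ∀ r ≤ q, ∀ z, (r ⊩ z ∈' h) → Dn r fun s => ∃ x y, (s ⊩ x ∈' A) ∧
        (s ⊩ z =' .opair x y) := by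
      intro r hr z hz
      exact ((frc_ex.1 h₁).mono hr).bind fun s hs ⟨Y, hY⟩ =>
        ((frc_isFunction.1 hY).1 z s le_rfl (hz.mono hs)).imp fun t _ ⟨x, y, hx, _, hz⟩ =>
          ⟨x, y, hx, hz⟩
    have hrec : ∀ r ≤ q, ∀ x α, (r ⊩ .opair x α ∈' h) → ∀ β, ∀ s ≤ r, (s ⊩ β ∈' α) ↔
        Dn s fun t => ∃ y, (t ⊩ .opair y x ∈' R) ∧ (t ⊩ .opair y β ∈' h) := by
      intro r hr x α hx β s hs
      refine (frc_iff.1 (frc_all.1 (frc_imp.1 (frc_all.1 (frc_all.1 h₂ x) α) r hr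
        (frc_pairMem.2 hx)) β) s hs).trans (frc_ex.trans ?_)
      simp only [frc_and, frc_pairMem]
    -- Uniqueness of the height function by induction on the height of the node: `T.res` supplies a
    -- predecessor of each smaller height, and the recursive equation allows no other values.
    have key : ∀ o : Ordinal.{u}, ∀ i, T.ht i = o → ∀ r ≤ q, T.In (Proj.π r) i → ∀ α,
        (r ⊩ .opair (.check (T.code i)) α ∈' h) → (r ⊩ α =' .ord o) := by
      intro o
      induction o using WellFoundedLT.induction with
      | ind o ih =>
      rintro i rfl r hr hi α hα
      refine frc_ext fun β s hs => ((hrec r hr _ _ hα β s hs).trans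
        (Iff.trans ?_ frc_mem_ord.symm))
      have hsq := hs.trans hr
      constructor
      · refine fun h => h.bind fun t ht ⟨y, hyR, hyh⟩ => ?_
        have htq := ht.trans hsq
        refine ((hR.le htq).dn_right hyR (frc_refl _ _)).imp fun t' ht' ⟨j, hji, hj, hyj⟩ => ?_
        have := (hyh.mono ht').mem_left (frc_opair_congr hyj (frc_refl _ _))
        exact ⟨T.ht j, T.ht_lt hji, ih _ (T.ht_lt hji) j rfl t' (ht'.trans htq) hj _ this⟩
      · refine fun h => h.bind fun t ht ⟨a, ha, hβ⟩ => ?_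
        have htq := ht.trans hsq
        obtain ⟨j, hji, rfl⟩ := T.res ha
        have hit := in_mono (in_mono hi hs) ht
        have hj := T.down hji hit
        refine (hfun t htq _ ((hA.le htq).mem hj)).imp fun t' ht' ⟨y, hy⟩ => ?_
        refine ⟨_, (hR.le (ht'.trans htq)).mem hji (in_mono hit ht') (frc_refl _ _)
          (frc_refl _ _), ?_⟩
        have hy' := ih _ ha j rfl t' (ht'.trans htq) (in_mono hj ht') _ hy
        exact hy.mem_left (frc_opair_congr (frc_refl _ _) (hy'.trans (hβ.mono ht').symm))
    intro r hr z
    constructor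
    · intro hz
      refine (hdom r hr z hz).bind fun s hs ⟨x, y, hx, hz'⟩ => ?_
      refine ((hA.le (hs.trans hr)).dn hx).imp fun t ht ⟨i, hi, hxi⟩ => ⟨i, hi, ?_⟩
      have hz'' := (hz'.mono ht).trans (frc_opair_congr hxi (frc_refl _ _))
      have := key _ i rfl t (ht.trans (hs.trans hr)) hi y ((hz.mono (ht.trans hs)).mem_left hz'')
      exact hz''.trans (frc_opair_congr (frc_refl _ _) this)
    · refine fun hz => hz.frc fun s hs ⟨i, hi, hz⟩ => ?_
      have hsq := hs.trans hr
      refine (hfun s hsq _ ((hA.le hsq).mem hi)).frc fun t ht ⟨y, hy⟩ => ?_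
      have := key _ i rfl t (ht.trans hsq) (in_mono hi ht) y hy
      exact hy.mem_left ((frc_opair_congr (frc_refl _ _) this).trans (hz.mono ht).symm)
  · intro hh
    refine frc_and.2 ⟨?_, frc_all.2 fun x => frc_all.2 fun α => frc_imp.2 fun r hr hx =>
      frc_all.2 fun β => frc_iff.2 fun s hs => ?_⟩
    -- Smallness of the index type bounds the heights, which gives the function a codomain that is a
    -- set.
    · obtain ⟨o, ho⟩ : BddAbove (Set.range T.ht) := Ordinal.bddAbove_of_small
      refine frc_ex_of (.ord (o + 1)) (frc_isFunction.2 ⟨fun z r hr hz => ?_, fun z r hr hz => ?_⟩)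
      · refine ((hh r hr z).1 hz).imp fun s hs ⟨i, hi, hz⟩ => ⟨_, _, (hA.le (hs.trans hr)).mem hi,
          frc_ord_mem.2 (Order.lt_add_one_iff.2 (ho ⟨i, rfl⟩)), hz⟩
      · refine ((hA.le hr).dn hz).imp fun s hs ⟨i, hi, hz⟩ => ⟨.ord (T.ht i),
          (hh.le (hs.trans hr)).mem hi hz (frc_refl _ _), fun y' t ht hy' => ?_⟩
        exact ((hh.le (ht.trans (hs.trans hr))).dn_code hy' (hz.mono ht)).1
    · rw [frc_pairMem] at hx
      have hx' := ((hh.le hr).dn hx).mono hs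
      constructor
      · refine fun hβ => hx'.frc fun t ht ⟨i, hi, hxi, hα⟩ => ?_
        refine (frc_mem_ord.1 ((hβ.mono ht).mem_right hα)).frc fun t' ht' ⟨a, ha, hβa⟩ => ?_
        obtain ⟨j, hji, rfl⟩ := T.res ha
        have hq := ht'.trans (ht.trans (hs.trans hr))
        exact frc_ex_of (.check (T.code j)) (frc_and.2 ⟨frc_pairMem.2 ((hR.le hq).mem hji
          (in_mono hi ht') (frc_refl _ _) (hxi.mono ht')), frc_pairMem.2 ((hh.le hq).mem
            (in_mono (T.down hji hi) ht') (frc_refl _ _) hβa)⟩)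
      · refine fun hy => hx'.frc fun t ht ⟨i, hi, hxi, hα⟩ => ?_
        refine ((frc_ex.1 hy).mono ht).frc fun t' ht' ⟨y, hy⟩ => ?_
        simp only [frc_and, frc_pairMem] at hy
        have hq := ht'.trans (ht.trans (hs.trans hr))
        refine ((hR.le hq).dn_right hy.1 (hxi.mono ht')).frc fun t'' ht'' ⟨j, hj, _, hyj⟩ => ?_
        have := ((hh.le (ht''.trans hq)).dn_code (hy.2.mono ht'') hyj).1
        exact ((frc_ord_mem.2 (T.ht_lt hj)).mem_left this.symm).mem_right
          (hα.mono (ht''.trans ht')).symm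

theorem frc_isTree (hA : T.Nodes q A) (hR : T.Order q R) : q ⊩ isTree A R := by
  refine ⟨?_, ?_, ?_, ?_, ?_⟩
  · refine frc_allIn.2 fun z r hr hz => ((hR r hr z).1 hz).frc fun s hs ⟨i, j, _, hi, hj, hz⟩ => ?_
    exact frc_exIn_of _ ((hA.le (hs.trans hr)).mem hi) (frc_exIn_of _
      ((hA.le (hs.trans hr)).mem hj) (frc_isOPair.2 hz))
  · refine frc_all.2 fun x => frc_not.2 fun r hr hx => ?_
    obtain ⟨s, _, i, j, hij, _, _, h₁, h₂⟩ := ((hR.le hr).dn (frc_pairMem.1 hx)).exists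
    rw [T.inj (frc_check_eq.1 (h₁.symm.trans h₂))] at hij
    exact (T.ht_lt hij).false
  · refine frc_all.2 fun x => frc_all.2 fun y => frc_all.2 fun z => frc_imp.2 fun r hr hx =>
      frc_imp.2 fun s hs hy => ?_
    rw [frc_pairMem] at *
    have hsq := hs.trans hr
    refine ((hR.le hsq).dn hy).frc fun t ht ⟨j, k, hjk, _, hk, hyj, hzk⟩ => ?_
    refine ((hR.le (ht.trans hsq)).dn_right (hx.mono (ht.trans hs)) hyj).frc
      fun t' ht' ⟨i, hij, _, hxi⟩ => ?_
    exact ((hR.le (ht'.trans (ht.trans hsq))).mem (T.trans hij hjk) (in_mono hk ht') hxi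
      (hzk.mono ht'))
  · refine frc_all.2 fun x => frc_all.2 fun y => frc_all.2 fun z => frc_imp.2 fun r hr hx =>
      frc_imp.2 fun s hs hy => ?_
    rw [frc_pairMem] at *
    have hsq := hs.trans hr
    refine ((hR.le hsq).dn hy).frc fun t ht ⟨j, k, hjk, hj, hk, hyj, hzk⟩ => ?_
    have htq := ht.trans hsq
    refine ((hR.le htq).dn_right (hx.mono (ht.trans hs)) hzk).frc fun t' ht' ⟨i, hik, hi, hxi⟩ => ?_
    have ht'q := ht'.trans htq
    rcases lt_trichotomy (T.ht i) (T.ht j) with hlt | heq | hlt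
    · exact frc_or.2 (Dn.of_forall fun u hu => .inl (Frc.mono (frc_pairMem.2 ((hR.le ht'q).mem
        (T.cmp hik hjk hlt) (in_mono hj ht') hxi (hyj.mono ht'))) hu))
    · rw [T.uniq hik hjk heq] at hxi
      exact frc_or.2 (Dn.of_forall fun u hu => .inr (frc_or.2 (Dn.of_forall fun v hv => .inl
        ((hxi.trans (hyj.mono ht').symm).mono (hv.trans hu)))))
    · exact frc_or.2 (Dn.of_forall fun u hu => .inr (frc_or.2 (Dn.of_forall fun v hv => .inr
        (Frc.mono (frc_pairMem.2 ((hR.le ht'q).mem (T.cmp hjk hik hlt) hi (hyj.mono ht') hxi))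
          (hv.trans hu)))))
  · refine frc_all.2 fun B => frc_imp.2 fun r hr hBA => frc_imp.2 fun s hs hne => ?_
    refine Frc.of_dense fun t ht => ?_
    have hBA' := frc_subset.1 hBA
    -- A minimal element of `B` is found in the ground model: take the least height of a node that
    -- some extension of `t` forces into `B`.
    have hM : ∃ o, ∃ t' ≤ t, ∃ i, T.ht i = o ∧ (t' ⊩ .check (T.code i) ∈' B) := by
      obtain ⟨t₁, ht₁, x, hx⟩ := frc_ex.1 hne t ht
      have hAt := hA.le (ht₁.trans (ht.trans (hs.trans hr)))
      obtain ⟨t₂, ht₂, i, _, hi⟩ := (hAt.dn (hBA' x t₁ (ht₁.trans (ht.trans hs)) hx)).exists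
      exact ⟨_, t₂, ht₂.trans ht₁, i, rfl, (hx.mono ht₂).mem_left hi⟩
    obtain ⟨o, ⟨t', ht', i, rfl, hi⟩, hmin⟩ := WellFounded.has_min
      (wellFounded_lt (α := Ordinal.{u})) _ hM
    refine ⟨t', ht', frc_exIn_of _ hi (frc_allIn.2 fun y u hu hy => frc_not.2 fun v hv hyi => ?_)⟩
    have hRv := hR.le (hv.trans (hu.trans (ht'.trans (ht.trans (hs.trans hr)))))
    obtain ⟨w, hw, j, hji, _, hyj⟩ := (hRv.dn_right (frc_pairMem.1 hyi) (frc_refl _ _)).exists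
    exact hmin _ ⟨w, hw.trans (hv.trans (hu.trans ht')), j, rfl,
      (hy.mono (hw.trans hv)).mem_left hyj⟩ (T.ht_lt hji)

theorem frc_isImmSucc (hR : T.Order q R) (hij : T.lt i j) (hj : T.In (Proj.π q) j)
    (h : T.ht j = T.ht i + 1) :
    q ⊩ isImmSucc R (.check (T.code i)) (.check (T.code j)) := by
  refine frc_and.2 ⟨frc_pairMem.2 (hR.mem hij hj (frc_refl _ _) (frc_refl _ _)),
    frc_not.2 fun r hr hz => ?_⟩
  obtain ⟨s, hs, z, hz⟩ := (frc_ex.1 hz).exists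
  simp only [frc_and, frc_pairMem] at hz
  have hRs := hR.le (hs.trans hr)
  obtain ⟨t, ht, k, hik, _, hk⟩ := (hRs.dn_left hz.1 (frc_refl _ _)).exists
  have hkj := (hRs.le ht).lt_of (hz.2.mono ht) hk (frc_refl _ _)
  have h₁ := T.ht_lt hkj
  rw [h, Order.lt_add_one_iff] at h₁
  exact (T.ht_lt hik).not_ge h₁

/-- Order, heights and limit levels are governed by the ground-model structure `LTree`; only the
root and the density properties `level`, `succ` and `ext` remain to be supplied. The countable set
in `level` has to capture also the nodes that stronger conditions may add. -/
theorem frc_isNormalTree [Small.{u} ι] (hA : T.Nodes q A) (hR : T.Order q R) (ρ : ι)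
    (hρ : T.In (Proj.π q) ρ) (hρ' : ∀ i, i = ρ ∨ T.lt ρ i)
    (level : ∀ α, ∀ r ≤ q, Dn r fun s => ∃ C : Set ι, C.Countable ∧
      ∀ t ≤ s, ∀ i, T.In (Proj.π t) i → T.ht i = α → i ∈ C)
    (succ : ∀ r ≤ q, ∀ i j, T.lt i j → T.In (Proj.π r) j →
      Dn r fun s => {j | T.lt i j ∧ T.ht j = T.ht i + 1 ∧ T.In (Proj.π s) j}.Infinite)
    (ext : ∀ r ≤ q, ∀ i j, T.In (Proj.π r) i → T.In (Proj.π r) j → T.ht i < T.ht j →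
      Dn r fun s => ∃ k, T.lt i k ∧ T.ht k = T.ht j ∧ T.In (Proj.π s) k) :
    q ⊩ isNormalTree A R := by
  obtain ⟨h, hh⟩ := exists_height (Q := Q) T
  have hh := hh q
  refine frc_and.2 ⟨frc_isTree hA hR, frc_ex_of h (frc_and.2 ⟨(frc_isHeightFn hA hR).2 hh,
    frc_and.2 ⟨?_, frc_and.2 ⟨?_, frc_and.2 ⟨?_, frc_and.2 ⟨?_, ?_⟩⟩⟩⟩⟩)⟩
  · refine frc_exIn_of _ (hA.mem hρ) (frc_allIn.2 fun x r hr hx => ?_)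
    refine frc_or.2 (((hA.le hr).dn hx).imp fun s hs ⟨i, hi, hxi⟩ => ?_)
    rcases hρ' i with rfl | hi'
    · exact .inl hxi
    · exact .inr (frc_pairMem.2 ((hR.le (hs.trans hr)).mem hi' hi (frc_refl _ _) hxi))
  · refine frc_all.2 fun α => frc_all.2 fun L => frc_imp.2 fun r hr hL => ?_
    have hL' : ∀ x, ∀ s ≤ r, (s ⊩ x ∈' L) → (s ⊩ .opair x α ∈' h) := fun x s hs hx =>
      frc_pairMem.1 ((frc_iff.1 (frc_all.1 hL x) s hs).1 hx)
    refine Frc.of_dense fun s hs => ?_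
    -- The level is indexed by a mere name `α`. A node forced into `L` identifies `α` with a
    -- ground-model ordinal, and without any such node `L` is forced to be empty.
    by_cases hne : ∃ t ≤ s, ∃ x, t ⊩ x ∈' L
    · obtain ⟨t, ht, x, hx⟩ := hne
      obtain ⟨t', ht', i, _, _, hα⟩ := ((hh.le (ht.trans (hs.trans hr))).dn
        (hL' x t (ht.trans hs) hx)).exists
      have ht'r := ht'.trans (ht.trans hs)
      obtain ⟨v, hv, C, hC, hC'⟩ := (level (T.ht i) t' (ht'r.trans hr)).exists
      refine ⟨v, hv.trans (ht'.trans ht), frc_isCountable_of (hC.image T.code)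
        fun z v' hv' hz => ?_⟩
      have hv'r := hv'.trans (hv.trans ht'r)
      refine ((hh.le (hv'r.trans hr)).dn (hL' z v' hv'r hz)).imp
        fun v'' hv'' ⟨j, hj, hzj, hαj⟩ => ⟨_, ⟨j, hC' v'' (hv''.trans hv') j hj ?_, rfl⟩, hzj⟩
      exact frc_ord_eq.1 (hαj.symm.trans (hα.mono (hv''.trans (hv'.trans hv))))
    · push Not at hne
      exact ⟨s, le_rfl, frc_isCountable_of Set.countable_empty fun z t ht hz =>
        (hne t ht z hz).elim⟩
  · refine frc_allIn.2 fun x r hr hx => frc_imp.2 fun s hs hy => frc_all.2 fun I =>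
      frc_imp.2 fun t ht hI => frc_not.2 fun t' ht' hfin => ?_
    have ht's := ht'.trans ht
    obtain ⟨v, hv, y, hy⟩ := (frc_ex.1 (hy.mono ht's)).exists
    have hvq := hv.trans (ht's.trans (hs.trans hr))
    obtain ⟨v', hv', i, j, hij, hi, hj, hxi, -⟩ := ((hR.le hvq).dn (frc_pairMem.1 hy)).exists
    obtain ⟨v'', hv'', hinf⟩ := (succ v' (hv'.trans hvq) i j hij hj).exists
    refine not_frc_isFinite_of (hinf.image T.inj.injOn) ?_ (hfin.mono (hv''.trans (hv'.trans hv)))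
    rintro _ ⟨k, ⟨hik, hk, hk'⟩, rfl⟩
    have hRv := hR.le (hv''.trans (hv'.trans hvq))
    have := frc_isImmSucc hRv hik hk' hk
    refine (frc_iff.1 (frc_all.1 hI _) _ (hv''.trans (hv'.trans (hv.trans ht')))).2 ?_
    have e := hxi.mono hv''
    obtain ⟨h₁, h₂⟩ := frc_and.1 this
    refine frc_and.2 ⟨frc_pairMem.2 ((frc_pairMem.1 h₁).mem_left
      (frc_opair_congr e.symm (frc_refl _ _))), frc_not.2 fun w hw hz => frc_not.1 h₂ w hw ?_⟩
    refine frc_ex.2 ((frc_ex.1 hz).imp fun w' hw' ⟨z, hz⟩ => ⟨z, ?_⟩)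
    simp only [frc_and, frc_pairMem] at hz ⊢
    exact ⟨hz.1.mem_left (frc_opair_congr (e.mono (hw'.trans hw)) (frc_refl _ _)), hz.2⟩
  · refine frc_all.2 fun x => frc_all.2 fun α => frc_all.2 fun z => frc_all.2 fun β => ?_
    refine frc_imp.2 fun s hs hxα => ?_
    refine frc_imp.2 fun t ht hzβ => ?_
    refine frc_imp.2 fun v hv hαβ => ?_
    rw [frc_pairMem] at hxα hzβ
    have hvq := hv.trans (ht.trans hs)
    have hhv := hh.le hvq
    refine (hhv.dn (hxα.mono (hv.trans ht))).frc fun v₁ hv₁ ⟨i, hi, hxi, hαi⟩ => ?_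
    refine ((hhv.le hv₁).dn (hzβ.mono (hv₁.trans hv))).frc fun v₂ hv₂ ⟨j, hj, hzj, hβj⟩ => ?_
    have hlt : T.ht i < T.ht j := frc_ord_mem.1 (((hαβ.mono (hv₂.trans hv₁)).mem_left
      (hαi.mono hv₂)).mem_right hβj)
    refine (ext v₂ (hv₂.trans (hv₁.trans hvq)) i j (in_mono hi hv₂) hj hlt).frc
      fun v₃ hv₃ ⟨k, hik, hk, hk'⟩ => ?_
    have hv₃q := hv₃.trans (hv₂.trans (hv₁.trans hvq))
    refine frc_ex_of (.check (T.code k)) (frc_and.2 ⟨frc_pairMem.2 ((hR.le hv₃q).mem hik hk'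
      (hxi.mono (hv₃.trans hv₂)) (frc_refl _ _)), frc_pairMem.2 ((hh.le hv₃q).mem hk'
      (frc_refl _ _) ?_)⟩)
    rw [hk]
    exact hβj.mono hv₃
  · refine frc_all.2 fun α => frc_imp.2 fun r hr hα => frc_all.2 fun x => frc_all.2 fun y =>
      frc_imp.2 fun s hs hx => ?_
    refine frc_imp.2 fun t ht hy => ?_
    refine frc_imp.2 fun v hv hz => ?_
    rw [frc_pairMem] at hx hy
    have hvq := hv.trans (ht.trans (hs.trans hr))
    have hhv := hh.le hvq
    refine (hhv.dn (hx.mono (hv.trans ht))).frc fun v₁ hv₁ ⟨i, hi, hxi, hαi⟩ => ?_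
    refine ((hhv.le hv₁).dn (hy.mono (hv₁.trans hv))).frc fun v₂ hv₂ ⟨j, hj, hyj, hαj⟩ => ?_
    have hvr := hv₁.trans (hv.trans (ht.trans hs))
    have hlim : LimOrd (T.ht i) := (frc_isLimit hαi).1 (hα.mono hvr)
    have hRv := hR.le (hv₂.trans (hv₁.trans hvq))
    have hi := in_mono hi hv₂
    have hxi := hxi.mono hv₂
    have hz' : ∀ k, (v₂ ⊩ .opair (.check (T.code k)) x ∈' R) ↔
        (v₂ ⊩ .opair (.check (T.code k)) y ∈' R) := fun k => by
      simpa only [frc_pairMem] using frc_iff.1 (frc_all.1 hz (.check (T.code k))) v₂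
        (hv₂.trans hv₁)
    have : i = j := T.lim hlim (frc_ord_eq.1 ((hαi.mono hv₂).symm.trans hαj)) fun k =>
      ⟨fun hk => hRv.lt_of ((hz' k).1 (hRv.mem hk hi (frc_refl _ _) hxi)) (frc_refl _ _) hyj,
       fun hk => hRv.lt_of ((hz' k).2 (hRv.mem hk hj (frc_refl _ _) hyj)) (frc_refl _ _) hxi⟩
    subst this
    exact hxi.trans hyj.symm

/-- For antichains only a bound `γ < ω₁` on the heights is demanded. By σ-closure one condition
captures every level below `γ` in a countable set of the ground model, and the union of these sets
covers the antichain. -/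
theorem frc_isSuslin [Small.{u} ι] (hQ : SigmaClosed Q) (hA : T.Nodes q A) (hR : T.Order q R)
    (ρ : ι) (hρ : T.In (Proj.π q) ρ) (hρ' : ∀ i, i = ρ ∨ T.lt ρ i)
    (hω : ∀ i, T.ht i < ω₁)
    (level : ∀ α, ∀ r ≤ q, Dn r fun s => ∃ C : Set ι, C.Countable ∧
      ∀ t ≤ s, ∀ i, T.In (Proj.π t) i → T.ht i = α → i ∈ C)
    (succ : ∀ r ≤ q, ∀ i, T.In (Proj.π r) i →
      Dn r fun s => {j | T.lt i j ∧ T.ht j = T.ht i + 1 ∧ T.In (Proj.π s) j}.Infinite)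
    (ext : ∀ r ≤ q, ∀ i, ∀ α < (ω₁ : Ordinal.{u}), T.In (Proj.π r) i → T.ht i < α →
      Dn r fun s => ∃ k, T.lt i k ∧ T.ht k = α ∧ T.In (Proj.π s) k)
    (anti : ∀ B : Name P, ∀ r ≤ q, (∀ s ≤ r, ∀ i j, (s ⊩ .check (T.code i) ∈' B) →
      (s ⊩ .check (T.code j) ∈' B) → ¬ T.lt i j) → (∀ s ≤ r, ∀ i, (s ⊩ .check (T.code i) ∈' B) →
        Dn s fun t => T.In (Proj.π t) i) → Dn r fun s => ∃ γ < (ω₁ : Ordinal.{u}), ∀ t ≤ s, ∀ i,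
      (t ⊩ .check (T.code i) ∈' B) → T.ht i < γ)
    (hx : q ⊩ x =' .opair A R) :
    q ⊩ isSuslin x := by
  obtain ⟨h, hh⟩ := exists_height (Q := Q) T
  have hh := hh q
  have root0 : T.ht ρ = 0 := by
    by_contra hne
    obtain ⟨z, hz, -⟩ := T.res (pos_iff_ne_zero.2 hne)
    rcases hρ' z with rfl | h
    · exact (T.ht_lt hz).false
    · exact ((T.ht_lt hz).trans (T.ht_lt h)).false
  refine frc_ex_of A (frc_ex_of R (frc_and.2 ⟨frc_isOPair.2 hx, frc_and.2
    ⟨frc_isNormalTree hA hR ρ hρ hρ' level (fun r hr i j hij hj => succ r hr i (T.down hij hj))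
      (fun r hr i j hi hj hij => ext r hr i _ (hω j) hi hij), frc_and.2 ⟨?_, ?_⟩⟩⟩))
  · refine frc_ex_of h (frc_and.2 ⟨(frc_isHeightFn hA hR).2 hh, frc_ex_of (.ord ω₁)
      (frc_and.2 ⟨hQ.frc_isOmega1, frc_all.2 fun α => frc_iff.2 fun r hr => ⟨fun hα => ?_,
        fun hα => ?_⟩⟩)⟩)
    · refine (frc_mem_ord.1 hα).frc fun s hs ⟨a, ha, hαa⟩ => ?_
      have hsq := hs.trans hr
      by_cases h0 : a = 0
      · refine frc_ex_of _ (frc_pairMem.2 ((hh.le hsq).mem (in_mono hρ hsq) (frc_refl _ _) ?_))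
        rwa [root0, ← h0]
      · refine (ext s hsq ρ a ha (in_mono hρ hsq) ?_).frc fun t ht ⟨k, _, hk, hk'⟩ => ?_
        · rw [root0]; exact pos_iff_ne_zero.2 h0
        · refine frc_ex_of _ (frc_pairMem.2 ((hh.le (ht.trans hsq)).mem hk' (frc_refl _ _) ?_))
          rw [hk]
          exact hαa.mono ht
    · refine (frc_ex.1 hα).frc fun s hs ⟨x, hx⟩ => ?_
      refine ((hh.le (hs.trans hr)).dn (frc_pairMem.1 hx)).frc fun t ht ⟨i, _, _, hα⟩ => ?_
      exact (frc_ord_mem.2 (hω i)).mem_left hα.symm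
  · refine frc_all.2 fun B => frc_imp.2 fun r hr hB => ?_
    obtain ⟨hB₁, hB₂⟩ := frc_and.1 hB
    have hB₁ := frc_subset.1 hB₁
    refine (anti B r hr (fun s hs i j hi hj hij => ?_) fun s hs i hi =>
      (hA.le (hs.trans hr)).dn_code (hB₁ _ s hs hi)).frc fun s hs ⟨γ, hγ, hγB⟩ => ?_
    · obtain ⟨t, ht, hj'⟩ := ((hA.le (hs.trans hr)).dn_code (hB₁ _ s hs hj)).exists
      have := frc_allIn.1 (frc_allIn.1 hB₂ _ s hs hi) _ t ht (hj.mono ht)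
      exact frc_not.1 this t le_rfl (frc_pairMem.2 ((hR.le (ht.trans (hs.trans hr))).mem hij hj'
        (frc_refl _ _) (frc_refl _ _)))
    · have hsq := hs.trans hr
      have : Countable (Set.Iio γ) := (lt_omega_one_iff_countable_Iio.1 hγ).to_subtype
      refine (hQ.dn_countable (K := Set.Iio γ) (fun α => level α.1 s hsq)
        fun α r s hs ⟨C, hC, h⟩ => ⟨C, hC, fun t ht => h t (ht.trans hs)⟩).frc fun t ht hC => ?_
      choose C hC hC' using hC
      refine frc_isCountable_of ((Set.countable_iUnion hC).image T.code) fun z v hv hz => ?_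
      have hvs := hv.trans ht
      refine ((hA.le (hvs.trans hsq)).dn (hB₁ z v (hvs.trans hs) hz)).imp
        fun v' hv' ⟨i, hi, hzi⟩ => ?_
      have hlt : T.ht i < γ := hγB v' (hv'.trans hvs) i ((hz.mono hv').mem_left hzi)
      exact ⟨_, ⟨i, Set.mem_iUnion.2 ⟨⟨_, hlt⟩, hC' ⟨_, hlt⟩ v' (hv'.trans hv) i hi rfl⟩, rfl⟩, hzi⟩

end NTree
end
end JechForcing

/-! ### The reflexive order of a tree -/

namespace JechForcing
open Ordinal

namespace LTree

variable {ι : Type w} (T : LTree.{u} ι)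

/-- The reflexive order of the tree. -/
def le (x y : ι) : Prop := x = y ∨ T.lt x y

variable {T} {x y z : ι}

theorem le_refl (x : ι) : T.le x x := .inl rfl

theorem lt_of_le_of_lt (h : T.le x y) (h' : T.lt y z) : T.lt x z := by
  rcases h with rfl | h
  · exact h'
  · exact T.trans h h'

theorem le_trans (h : T.le x y) (h' : T.le y z) : T.le x z := by
  rcases h' with rfl | h'
  · exact h
  · exact .inr (lt_of_le_of_lt h h')

theorem ht_le (h : T.le x y) : T.ht x ≤ T.ht y := by
  rcases h with rfl | h
  · exact le_rfl
  · exact (T.ht_lt h).le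

theorem irrefl (x : ι) : ¬ T.lt x x := fun h => (T.ht_lt h).false

theorem le_of_le_of_le (hx : T.le x z) (hy : T.le y z) (h : T.ht x ≤ T.ht y) : T.le x y := by
  rcases hx with rfl | hx
  · rcases hy with rfl | hy
    · exact le_refl _
    · exact absurd (T.ht_lt hy) h.not_gt
  · rcases hy with rfl | hy
    · exact .inr hx
    · rcases h.eq_or_lt with h | h
      · exact .inl (T.uniq hx hy h)
      · exact .inr (T.cmp hx hy h)

theorem exists_le {β : Ordinal.{u}} (h : β ≤ T.ht y) : ∃ x, T.le x y ∧ T.ht x = β := by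
  rcases h.eq_or_lt with rfl | h
  · exact ⟨y, le_refl _, rfl⟩
  · obtain ⟨x, hx, rfl⟩ := T.res h
    exact ⟨x, .inr hx, rfl⟩

end LTree

/-! ### Countable sequences of natural numbers -/

/-- A function from a countable ordinal to `ω`, extended by `0`. -/
@[ext]
structure Node : Type (u + 1) where
  len : Ordinal.{u}
  val : Ordinal.{u} → ℕ
  len_lt : len < ω₁
  zero : ∀ β, len ≤ β → val β = 0

namespace Node

variable {s t x y : Node.{u}} {α β : Ordinal.{u}}

theorem ext' (h : s.len = t.len) (h' : ∀ β < s.len, s.val β = t.val β) : s = t := by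
  refine Node.ext h (funext fun β => ?_)
  rcases lt_or_ge β s.len with hβ | hβ
  · exact h' β hβ
  · rw [s.zero β hβ, t.zero β (h ▸ hβ)]

open Classical in
/-- The restriction of a sequence to a smaller ordinal. -/
noncomputable def restrict (t : Node.{u}) (β : Ordinal.{u}) : Node.{u} where
  len := min β t.len
  val γ := if γ < β then t.val γ else 0
  len_lt := (min_le_right _ _).trans_lt t.len_lt
  zero γ h := by
    split_ifs with hγ
    · exact t.zero _ ((min_le_iff.1 h).resolve_left hγ.not_ge)
    · rfl

theorem restrict_len (h : β ≤ t.len) : (t.restrict β).len = β := min_eq_left h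

theorem restrict_val (h : α < β) : (t.restrict β).val α = t.val α := if_pos h

/-- The tree of all countable sequences of natural numbers. -/
def tree : LTree.{u} Node.{u} where
  lt s t := s.len < t.len ∧ ∀ β < s.len, s.val β = t.val β
  ht := len
  trans h h' := ⟨h.1.trans h'.1, fun β hβ => (h.2 β hβ).trans (h'.2 β (hβ.trans h.1))⟩
  ht_lt h := h.1
  res {t β} h := ⟨t.restrict β, by
    rw [restrict_len h.le]; exact ⟨h, fun γ hγ => restrict_val hγ⟩, restrict_len h.le⟩
  cmp h h' hlt := ⟨hlt, fun β hβ => (h.2 β hβ).trans (h'.2 β (hβ.trans hlt)).symm⟩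
  uniq h h' he := ext' he fun β hβ => (h.2 β hβ).trans (h'.2 β (he ▸ hβ)).symm
  lim {s t} hl he h := by
    refine ext' he fun β hβ => ?_
    have hβ' := hl.2 β hβ
    have h₁ := (h (s.restrict (β + 1))).1 (by
      rw [restrict_len hβ'.le]; exact ⟨hβ', fun γ hγ => restrict_val hγ⟩)
    have h₂ := h₁.2 β (by rw [restrict_len hβ'.le]; exact lt_add_one β)
    rwa [restrict_val (lt_add_one β)] at h₂

theorem tree_ht : tree.ht t = t.len := rfl

theorem le_iff : tree.le s t ↔ s.len ≤ t.len ∧ ∀ β < s.len, s.val β = t.val β := by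
  constructor
  · rintro (rfl | h)
    · exact ⟨le_rfl, fun _ _ => rfl⟩
    · exact ⟨h.1.le, h.2⟩
  · rintro ⟨h, h'⟩
    rcases h.eq_or_lt with h | h
    · exact .inl (ext' h h')
    · exact .inr ⟨h, h'⟩

theorem restrict_le (t : Node.{u}) (β : Ordinal.{u}) : tree.le (t.restrict β) t :=
  le_iff.2 ⟨min_le_right _ _, fun _ hγ => restrict_val (hγ.trans_le (min_le_left _ _))⟩

/-- The empty sequence. -/
def nil : Node.{u} := ⟨0, fun _ => 0, omega_pos 1, fun _ _ => rfl⟩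

theorem eq_nil_or_lt (t : Node.{u}) : t = nil ∨ tree.lt nil t := by
  rcases eq_or_ne t.len 0 with h | h
  · exact .inl (ext' h fun β hβ => by rw [h] at hβ; exact absurd hβ not_lt_zero)
  · exact .inr ⟨pos_iff_ne_zero.2 h, fun β hβ => absurd hβ not_lt_zero⟩

open Classical in
/-- A sequence of length `α` that continues `t` by the values `n` and `0`. -/
noncomputable def pad (t : Node.{u}) (n : ℕ) (α : Ordinal.{u}) (hα : α < ω₁) : Node.{u} where
  len := α
  val γ := if γ < α then (if γ < t.len then t.val γ else if γ = t.len then n else 0) else 0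
  len_lt := hα
  zero _ h := if_neg h.not_gt

theorem lt_pad (t : Node.{u}) (n : ℕ) {hα : α < ω₁} (h : t.len < α) : tree.lt t (t.pad n α hα) :=
  ⟨h, fun β hβ => by simp [pad, hβ.trans h, hβ]⟩

theorem pad_val_len (t : Node.{u}) (n : ℕ) {hα : α < ω₁} (h : t.len < α) :
    (t.pad n α hα).val t.len = n := by simp [pad, h]

theorem pad_val_of_gt (t : Node.{u}) (n : ℕ) {hα : α < ω₁} (h : t.len < β) :
    (t.pad n α hα).val β = 0 := by simp [pad, h.not_gt, h.ne']

/-- The union of an increasing sequence of nodes. -/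
theorem exists_iSup (s : ℕ → Node.{u}) (hs : ∀ n, tree.le (s n) (s (n + 1))) :
    ∃ b : Node.{u}, b.len = ⨆ n, (s n).len ∧ ∀ n, tree.le (s n) b := by
  classical
  have hs' : ∀ m n, m ≤ n → tree.le (s m) (s n) := fun m n h => by
    induction n, h using Nat.le_induction with
    | base => exact LTree.le_refl _
    | succ n _ ih => exact LTree.le_trans ih (hs n)
  have hval : ∀ m n β, β < (s m).len → β < (s n).len → (s m).val β = (s n).val β := by
    intro m n β hm hn
    rcases le_total m n with h | h
    · exact (le_iff.1 (hs' m n h)).2 β hm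
    · exact ((le_iff.1 (hs' n m h)).2 β hn).symm
  refine ⟨⟨⨆ n, (s n).len, fun β => if h : ∃ n, β < (s n).len then (s h.choose).val β else 0,
    Ordinal.iSup_lt_omega_one fun n => (s n).len_lt, fun β hβ => dif_neg ?_⟩, rfl, fun n => ?_⟩
  · rintro ⟨n, hn⟩
    exact (hn.trans_le (Ordinal.le_iSup (fun n => (s n).len) n)).not_ge hβ
  · refine le_iff.2 ⟨Ordinal.le_iSup (fun n => (s n).len) n, fun β hβ => ?_⟩
    have h : ∃ n, β < (s n).len := ⟨n, hβ⟩
    simp only [dif_pos h]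
    exact hval _ _ _ hβ h.choose_spec

/-- Such a node is determined by its length, its initial segment in `C`, and the finite set of its
nonzero values beyond that segment. There are countably many data of this kind. -/
theorem countable_finsupp (C : Set Node.{u}) (hC : C.Countable) (hα : α < ω₁) :
    {t : Node.{u} | t.len ≤ α ∧ ∃ s ∈ C, tree.le s t ∧
      {β | s.len ≤ β ∧ t.val β ≠ 0}.Finite}.Countable := by
  classical
  have hI : Countable (Set.Iio α) := (lt_omega_one_iff_countable_Iio.1 hα).to_subtype
  have hI' : Countable (Set.Iio (α + 1)) :=
    (lt_omega_one_iff_countable_Iio.1 (add_one_lt_omega_one hα)).to_subtype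
  have := hC.to_subtype
  -- The decoding of the finite data into a node; data that describe no node are sent to `nil`.
  let f : Set.Iio (α + 1) × C × Finset (Set.Iio α × ℕ) → Node.{u} := fun x =>
    if h : ∃ t : Node.{u}, t.len = x.1 ∧ tree.le x.2.1 t ∧ ∀ (β : Set.Iio α) n,
      (β, n) ∈ x.2.2 ↔ (x.2.1 : Node.{u}).len ≤ β ∧ t.val β ≠ 0 ∧ n = t.val β then h.choose else nil
  refine (Set.countable_range f).mono ?_
  · rintro t ⟨ht, s, hs, hst, hfin⟩
    have hfin' : {x : Set.Iio α × ℕ | s.len ≤ x.1 ∧ t.val x.1 ≠ 0 ∧ x.2 = t.val x.1}.Finite := by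
      refine Set.Finite.of_finite_image (f := fun x => (x.1 : Ordinal.{u}))
        (hfin.subset ?_) ?_
      · rintro _ ⟨x, hx, rfl⟩
        exact ⟨hx.1, hx.2.1⟩
      · rintro ⟨x, n⟩ hx ⟨y, m⟩ hy h
        have h : x = y := Subtype.ext h
        subst h
        exact Prod.ext rfl (hx.2.2.trans hy.2.2.symm)
    refine ⟨(⟨t.len, Order.lt_add_one_iff.2 ht⟩, ⟨s, hs⟩, hfin'.toFinset), ?_⟩
    have h : ∃ t' : Node.{u}, t'.len = t.len ∧ tree.le s t' ∧ ∀ (β : Set.Iio α) n,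
        (β, n) ∈ hfin'.toFinset ↔ s.len ≤ β ∧ t'.val β ≠ 0 ∧ n = t'.val β :=
      ⟨t, rfl, hst, fun β n => by simp⟩
    simp only [f, dif_pos h]
    suffices ∀ t' : Node.{u}, (t'.len = t.len ∧ tree.le s t' ∧ ∀ (β : Set.Iio α) n,
        (β, n) ∈ hfin'.toFinset ↔ s.len ≤ β ∧ t'.val β ≠ 0 ∧ n = t'.val β) → t' = t from
      this _ h.choose_spec
    rintro t' ⟨h₁, h₂, h₃⟩
    refine ext' h₁ fun β hβ => ?_
    rcases lt_or_ge β s.len with hlt | hge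
    · rw [← (le_iff.1 h₂).2 β hlt, (le_iff.1 hst).2 β hlt]
    · have hβα : β < α := (hβ.trans_eq h₁).trans_le ht
      have h₄ := h₃ ⟨β, hβα⟩
      simp only [Set.Finite.mem_toFinset, Set.mem_ofPred_eq] at h₄
      by_cases h0 : t.val β = 0
      · by_contra hne
        have := (h₄ (t'.val β)).2 ⟨hge, by rwa [h0] at hne, rfl⟩
        exact this.2.1 h0
      · exact ((h₄ (t.val β)).1 ⟨hge, h0, rfl⟩).2.2.symm

instance : Small.{u} Node.{u} := by
  have : Small.{u} (Set.Iio (ω₁ : Ordinal.{u})) := inferInstance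
  refine small_of_injective (β := Set.Iio (ω₁ : Ordinal.{u}) × (Set.Iio (ω₁ : Ordinal.{u}) → ℕ))
    (f := fun t => (⟨t.len, t.len_lt⟩, fun β => t.val β)) fun s t h => ?_
  simp only [Prod.mk.injEq] at h
  exact ext' (congrArg Subtype.val h.1) fun β hβ => congrFun h.2 ⟨β, hβ.trans s.len_lt⟩

end Node

end JechForcing

namespace JechForcing
open Ordinal

/-! ### Countable normal trees -/

/-- Countable normal trees of countable sequences of natural numbers. -/
structure JT : Type (u + 1) where
  nodes : Set Node.{u}
  countable : nodes.Countable
  nil_mem : Node.nil ∈ nodes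
  down : ∀ {s t}, Node.tree.lt s t → t ∈ nodes → s ∈ nodes
  succ : ∀ {s t}, Node.tree.lt s t → t ∈ nodes →
    {j | Node.tree.lt s j ∧ j.len = s.len + 1 ∧ j ∈ nodes}.Infinite
  ext : ∀ {s t}, s ∈ nodes → t ∈ nodes → s.len < t.len →
    ∃ y, Node.tree.lt s y ∧ y.len = t.len ∧ y ∈ nodes

namespace JT

/-- End-extension. -/
instance : Preorder JT.{u} where
  le u v := v.nodes ⊆ u.nodes ∧ ∀ t ∈ u.nodes, t ∉ v.nodes → ∀ s ∈ v.nodes, s.len < t.len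
  le_refl u := ⟨subset_rfl, fun t h h' => absurd h h'⟩
  le_trans u v w h h' := ⟨h'.1.trans h.1, fun t ht htw s hs => by
    by_cases htv : t ∈ v.nodes
    · exact h'.2 t htv htw s hs
    · exact h.2 t ht htv s (h'.1 hs)⟩

variable {u v : JT.{u}} {s t : Node.{u}} {α β : Ordinal.{u}}

theorem mem_of_le (h : u ≤ v) (ht : t ∈ u.nodes) (hs : s ∈ v.nodes) (hts : t.len ≤ s.len) :
    t ∈ v.nodes := by
  by_contra hn
  exact (h.2 t ht hn s hs).not_ge hts

theorem down_le (h : Node.tree.le s t) (ht : t ∈ u.nodes) : s ∈ u.nodes := by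
  rcases h with rfl | h
  · exact ht
  · exact u.down h ht

theorem ext_le (hs : s ∈ u.nodes) (ht : t ∈ u.nodes) (h : s.len ≤ t.len) :
    ∃ y, Node.tree.le s y ∧ y.len = t.len ∧ y ∈ u.nodes := by
  rcases h.eq_or_lt with h | h
  · exact ⟨s, .inl rfl, h, hs⟩
  · obtain ⟨y, h₁, h₂⟩ := u.ext hs ht h
    exact ⟨y, .inr h₁, h₂⟩

/-- The union of an increasing sequence of conditions. -/
theorem exists_iUnion (s : ℕ → JT.{u}) (hs : Antitone s) :
    ∃ u : JT.{u}, u.nodes = ⋃ n, (s n).nodes ∧ ∀ n, u ≤ s n := by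
  have h2 : ∀ {x y}, x ∈ ⋃ n, (s n).nodes → y ∈ ⋃ n, (s n).nodes → ∃ n, x ∈ (s n).nodes ∧
      y ∈ (s n).nodes := fun {x y} hx hy => by
    obtain ⟨m, hm⟩ := Set.mem_iUnion.1 hx
    obtain ⟨n, hn⟩ := Set.mem_iUnion.1 hy
    exact ⟨max m n, (hs (le_max_left _ _)).1 hm, (hs (le_max_right _ _)).1 hn⟩
  refine ⟨⟨⋃ n, (s n).nodes, Set.countable_iUnion fun n => (s n).countable,
    Set.mem_iUnion.2 ⟨0, (s 0).nil_mem⟩, fun {x y} h hy => ?_, fun {x y} h hy => ?_,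
    fun {x y} hx hy h => ?_⟩, rfl, fun n => ⟨Set.subset_iUnion (fun n => (s n).nodes) n, ?_⟩⟩
  · obtain ⟨n, hn⟩ := Set.mem_iUnion.1 hy
    exact Set.mem_iUnion.2 ⟨n, (s n).down h hn⟩
  · obtain ⟨n, hn⟩ := Set.mem_iUnion.1 hy
    exact ((s n).succ h hn).mono fun j hj => ⟨hj.1, hj.2.1, Set.mem_iUnion.2 ⟨n, hj.2.2⟩⟩
  · obtain ⟨n, hxn, hyn⟩ := h2 hx hy
    obtain ⟨z, h₁, h₂, h₃⟩ := (s n).ext hxn hyn h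
    exact ⟨z, h₁, h₂, Set.mem_iUnion.2 ⟨n, h₃⟩⟩
  · intro t ht htn y hy
    obtain ⟨m, hm⟩ := Set.mem_iUnion.1 ht
    rcases le_total m n with h | h
    · exact absurd ((hs h).1 hm) htn
    · exact (hs h).2 t hm htn y hy

/-- `α` is the height of the top level of `u`. -/
def Top (u : JT.{u}) (α : Ordinal.{u}) : Prop :=
  (∃ t ∈ u.nodes, t.len = α) ∧ ∀ t ∈ u.nodes, t.len ≤ α

theorem Top.lt (h : u.Top α) : α < ω₁ := by
  obtain ⟨t, _, rfl⟩ := h.1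
  exact t.len_lt

theorem Top.ext (h : u.Top α) (hs : s ∈ u.nodes) :
    ∃ y ∈ u.nodes, Node.tree.le s y ∧ y.len = α := by
  obtain ⟨⟨t, ht, rfl⟩, h⟩ := h
  obtain ⟨y, h₁, h₂, h₃⟩ := ext_le hs ht (h s hs)
  exact ⟨y, h₃, h₁, h₂⟩

/-- A new top level can be added to a tree of limit height. -/
theorem exists_addLevel (u : JT.{u}) (N : Set Node.{u}) (hN : N.Countable) (α : Ordinal.{u})
    (hlen : ∀ b ∈ N, b.len = α) (hu : ∀ t ∈ u.nodes, t.len < α)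
    (hlim : ∀ s ∈ u.nodes, ∃ t ∈ u.nodes, s.len < t.len)
    (hcov : ∀ s ∈ u.nodes, ∃ b ∈ N, Node.tree.lt s b)
    (hdown : ∀ b ∈ N, ∀ s, Node.tree.lt s b → s ∈ u.nodes) :
    ∃ v ≤ u, v.nodes = u.nodes ∪ N ∧ v.Top α := by
  have hsucc : ∀ s ∈ u.nodes, {j | Node.tree.lt s j ∧ j.len = s.len + 1 ∧ j ∈ u.nodes}.Infinite := by
    intro s hs
    obtain ⟨t, ht, hst⟩ := hlim s hs
    obtain ⟨y, hy, _, hy'⟩ := u.ext hs ht hst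
    exact u.succ hy hy'
  have hdown' : ∀ s t, Node.tree.lt s t → t ∈ u.nodes ∪ N → s ∈ u.nodes := by
    rintro s t h (ht | ht)
    · exact u.down h ht
    · exact hdown t ht s h
  obtain ⟨b₀, hb₀, -⟩ := hcov _ u.nil_mem
  refine ⟨⟨u.nodes ∪ N, u.countable.union hN, .inl u.nil_mem, fun h ht => .inl (hdown' _ _ h ht),
    fun h ht => ?_, ?_⟩,
    ⟨Set.subset_union_left, ?_⟩, rfl, ⟨b₀, .inr hb₀, hlen _ hb₀⟩, ?_⟩
  · exact (hsucc _ (hdown' _ _ h ht)).mono fun j hj => ⟨hj.1, hj.2.1, .inl hj.2.2⟩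
  · intro s t hs ht hst
    rcases hs with hs | hs
    · rcases ht with ht | ht
      · obtain ⟨y, h₁, h₂, h₃⟩ := u.ext hs ht hst
        exact ⟨y, h₁, h₂, .inl h₃⟩
      · obtain ⟨b, hb, hsb⟩ := hcov s hs
        exact ⟨b, hsb, (hlen b hb).trans (hlen t ht).symm, .inr hb⟩
    · rw [hlen s hs] at hst
      rcases ht with ht | ht
      · exact absurd hst (hu t ht).le.not_gt
      · exact absurd hst (hlen t ht).le.not_gt
  · rintro t (ht | ht) htu s hs
    · exact absurd ht htu
    · rw [hlen t ht]
      exact hu s hs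
  · rintro t (ht | ht)
    · exact (hu t ht).le
    · exact (hlen t ht).le

/-- A tree with a top level extends to trees of arbitrary countable heights. -/
theorem Top.exists_le (h : u.Top β) (hβ : β ≤ α) (hα : α < ω₁) : ∃ v ≤ u, v.Top α := by
  rcases hβ.eq_or_lt with rfl | hβ
  · exact ⟨u, le_rfl, h⟩
  -- Top nodes are prolonged by sequences with finitely many nonzero values. Finite support keeps
  -- the tree countable and survives both restriction and padding, at limit levels as well.
  let N : Set Node.{u} := {t | t.len ≤ α ∧ β ≤ t.len ∧ ∃ s ∈ u.nodes, s.len = β ∧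
    Node.tree.le s t ∧ {γ | s.len ≤ γ ∧ t.val γ ≠ 0}.Finite}
  have hN : N.Countable := (Node.countable_finsupp u.nodes u.countable hα).mono <| by
    rintro t ⟨h₁, _, s, hs, _, h₂⟩
    exact ⟨h₁, s, hs, h₂⟩
  have hdown : ∀ s t, Node.tree.lt s t → t ∈ u.nodes ∪ N → s ∈ u.nodes ∪ N := by
    rintro s t hst (ht | ⟨h₁, h₂, x, hx, hxβ, hxt, hfin⟩)
    · exact .inl (u.down hst ht)
    · rcases le_or_gt β s.len with hs | hs
      · refine .inr ⟨(Node.tree.ht_lt hst).le.trans h₁, hs, x, hx, hxβ,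
          LTree.le_of_le_of_le hxt (.inr hst) (hxβ.trans_le hs), hfin.subset ?_⟩
        rintro γ ⟨hγ, hγ'⟩
        refine ⟨hγ, ?_⟩
        rcases lt_or_ge γ s.len with hlt | hge
        · rwa [← hst.2 γ hlt]
        · exact absurd (s.zero γ hge) hγ'
      · exact .inl (down_le (LTree.le_of_le_of_le (.inr hst) hxt (hs.le.trans_eq hxβ.symm)) hx)
  have hpad : ∀ s ∈ u.nodes ∪ N, β ≤ s.len → ∀ n γ (hγ : γ < ω₁), s.len < γ → γ ≤ α →
      s.pad n γ hγ ∈ N := by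
    intro s hs hβs n γ hγ hsγ hγα
    have hs' : s ∈ N := by
      rcases hs with hs | hs
      · have := h.2 s hs
        exact ⟨this.trans hβ.le, hβs, s, hs, this.antisymm hβs, .inl rfl, Set.Finite.subset
          Set.finite_empty fun γ hγ => hγ.2 (s.zero γ hγ.1)⟩
      · exact hs
    obtain ⟨h₁, h₂, x, hx, hxβ, hxt, hfin⟩ := hs'
    refine ⟨hγα, hβs.trans hsγ.le, x, hx, hxβ, LTree.le_trans hxt (.inr (s.lt_pad n hsγ)),
      (hfin.union (Set.finite_singleton s.len)).subset ?_⟩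
    rintro δ ⟨hδ, hδ'⟩
    rcases lt_trichotomy δ s.len with hlt | heq | hgt
    · refine .inl ⟨hδ, ?_⟩
      rwa [(s.lt_pad n hsγ (hα := hγ)).2 δ hlt]
    · exact .inr heq
    · exact absurd (s.pad_val_of_gt n hgt) hδ'
  obtain ⟨⟨t₀, ht₀, hβt₀⟩, htop⟩ := h
  have hlen : ∀ t ∈ u.nodes ∪ N, t.len ≤ α := by
    rintro t (ht | ht)
    · exact (htop t ht).trans hβ.le
    · exact ht.1
  refine ⟨⟨u.nodes ∪ N, u.countable.union hN, .inl u.nil_mem, fun h ht => hdown _ _ h ht, ?_, ?_⟩,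
    ⟨Set.subset_union_left, ?_⟩, ⟨t₀.pad 0 α hα, .inr ?_, rfl⟩, hlen⟩
  · intro s t hst ht
    rcases le_or_gt β s.len with hs | hs
    · have hsα : s.len + 1 ≤ α := Order.add_one_le_iff.2 ((Node.tree.ht_lt hst).trans_le (hlen t ht))
      refine Set.infinite_of_injective_forall_mem (f := fun n => s.pad n (s.len + 1)
        (hsα.trans_lt hα)) (fun m n hmn => ?_) fun n => ⟨s.lt_pad n (lt_add_one _), rfl, .inr
          (hpad s (hdown _ _ hst ht) hs _ _ _ (lt_add_one _) hsα)⟩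
      have := congrArg (fun t : Node.{u} => t.val s.len) hmn
      simpa only [Node.pad_val_len _ _ (lt_add_one s.len)] using this
    · have hs' : s ∈ u.nodes := by
        rcases hdown _ _ hst ht with h | h
        · exact h
        · exact absurd h.2.1 hs.not_ge
      obtain ⟨y, hy, _, hy'⟩ := u.ext hs' ht₀ (hβt₀ ▸ hs)
      exact (u.succ hy hy').mono fun j hj => ⟨hj.1, hj.2.1, .inl hj.2.2⟩
  · intro s t hs ht hst
    -- To reach a level above `β`, a node below the old top is raised inside `u` to height `β`, from
    -- where it can be padded.
    have hw : t.len ≤ β ∨ ∃ s' ∈ u.nodes ∪ N, Node.tree.le s s' ∧ β ≤ s'.len ∧ s'.len < t.len := by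
      by_cases htβ : t.len ≤ β
      · exact .inl htβ
      right
      rcases le_or_gt β s.len with hs' | hs'
      · exact ⟨s, hs, .inl rfl, hs', hst⟩
      · have hs'' : s ∈ u.nodes := hs.resolve_right fun h => hs'.not_ge h.2.1
        obtain ⟨y, h₁, h₂, h₃⟩ := u.ext hs'' ht₀ (hβt₀ ▸ hs')
        exact ⟨y, .inl h₃, .inr h₁, (h₂.trans hβt₀).ge, (h₂.trans hβt₀).trans_lt (not_le.1 htβ)⟩
    rcases hw with hw | ⟨s', hs', hss', hβs', hlt⟩
    · have hs'' : s ∈ u.nodes := hs.resolve_right fun h => (hst.trans_le hw).not_ge h.2.1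
      obtain ⟨t', ht'₁, ht'₂⟩ := LTree.exists_le (T := Node.tree) (y := t₀) (β := t.len)
        (hw.trans_eq hβt₀.symm)
      obtain ⟨y, h₁, h₂, h₃⟩ := u.ext hs'' (down_le ht'₁ ht₀) (hst.trans_eq ht'₂.symm)
      exact ⟨y, h₁, h₂.trans ht'₂, .inl h₃⟩
    · exact ⟨s'.pad 0 t.len t.len_lt, LTree.lt_of_le_of_lt hss' (s'.lt_pad 0 hlt), rfl,
        .inr (hpad s' hs' hβs' _ _ _ hlt (hlen t ht))⟩
  · rintro t (ht | ht) htu s hs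
    · exact absurd ht htu
    · obtain ⟨h₁, h₂, x, hx, hxβ, hxt, hfin⟩ := ht
      refine (htop s hs).trans_lt (h₂.lt_of_ne fun he => htu ?_)
      rcases hxt with rfl | hxt
      · exact hx
      · exact absurd (Node.tree.ht_lt hxt) (he.symm.trans hxβ.symm).le.not_gt
  · exact hpad t₀ (.inl ht₀) hβt₀.ge _ _ _ (hβt₀.trans_lt hβ) le_rfl

/-- Every node of a tree of limit height is on a cofinal branch. -/
theorem exists_branch (u : JT.{u}) (hlim : ∀ s ∈ u.nodes, ∃ t ∈ u.nodes, s.len < t.len)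
    (s : Node.{u}) (hs : s ∈ u.nodes) : ∃ b : Node.{u}, Node.tree.lt s b ∧
      (∀ t ∈ u.nodes, t.len < b.len) ∧ ∀ x, Node.tree.lt x b → x ∈ u.nodes := by
  obtain ⟨e, he⟩ := u.countable.exists_eq_range ⟨_, u.nil_mem⟩
  -- Climbing above the height of the `n`-th node of the tree at step `n` makes the branch cofinal.
  have hstep : ∀ n (x : u.nodes), ∃ y : u.nodes, Node.tree.le x.1 y.1 ∧ (e n).len < y.1.len := by
    intro n x
    have hn : e n ∈ u.nodes := he ▸ ⟨n, rfl⟩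
    obtain ⟨t, ht, hlt⟩ := hlim (e n) hn
    rcases le_or_gt t.len x.1.len with h | h
    · exact ⟨x, .inl rfl, hlt.trans_le h⟩
    · obtain ⟨y, h₁, h₂, h₃⟩ := u.ext x.2 ht h
      exact ⟨⟨y, h₃⟩, .inr h₁, h₂ ▸ hlt⟩
  choose f hf hf' using hstep
  let c : ℕ → u.nodes := fun n => Nat.rec ⟨s, hs⟩ (fun n x => f n x) n
  obtain ⟨b, hb, hcb⟩ := Node.exists_iSup (fun n => (c n).1) fun n => hf n (c n)
  have hlen : ∀ t ∈ u.nodes, t.len < b.len := by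
    intro t ht
    rw [he] at ht
    obtain ⟨n, rfl⟩ := ht
    exact (hf' n (c n)).trans_le (LTree.ht_le (hcb (n + 1)))
  refine ⟨b, ?_, hlen, fun x hx => ?_⟩
  · rcases hcb 0 with h | h
    · exact absurd (hlen s hs) (h ▸ lt_irrefl _)
    · exact h
  · have := Node.tree.ht_lt hx
    rw [Node.tree_ht, Node.tree_ht, hb, Ordinal.lt_iSup_iff] at this
    obtain ⟨n, hn⟩ := this
    exact down_le (LTree.le_of_le_of_le (.inr hx) (hcb n) hn.le) (c n).2

/-- Every condition extends to a condition with a top level. -/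
theorem exists_top (u : JT.{u}) : ∃ v ≤ u, ∃ α, v.Top α := by
  by_cases hlim : ∀ s ∈ u.nodes, ∃ t ∈ u.nodes, s.len < t.len
  · choose! b hb hb' hb'' using exists_branch u hlim
    -- All cofinal branches have the same length, so the chosen ones form a single new level.
    have hlen : ∀ s ∈ u.nodes, ∀ t ∈ u.nodes, (b s).len ≤ (b t).len := by
      intro s hs t ht
      by_contra! hlt
      obtain ⟨x, hx, hx'⟩ := LTree.exists_le (T := Node.tree) (y := b s) (β := (b t).len) hlt.le
      have hx'' : Node.tree.lt x (b s) := by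
        rcases hx with rfl | hx
        · exact absurd hx' hlt.ne'
        · exact hx
      exact (hb' t ht x (hb'' s hs x hx'')).ne hx'
    obtain ⟨v, hv, -, hv'⟩ := u.exists_addLevel (b '' u.nodes) (u.countable.image b)
      (b Node.nil).len (by
        rintro _ ⟨s, hs, rfl⟩
        exact (hlen s hs _ u.nil_mem).antisymm (hlen _ u.nil_mem s hs))
      (hb' _ u.nil_mem) hlim (fun s hs => ⟨b s, ⟨s, hs, rfl⟩, hb s hs⟩) (by
        rintro _ ⟨s, hs, rfl⟩ x hx
        exact hb'' s hs x hx)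
    exact ⟨v, hv, _, hv'⟩
  · push Not at hlim
    obtain ⟨s, hs, h⟩ := hlim
    exact ⟨u, le_rfl, s.len, ⟨s, hs, rfl⟩, h⟩

/-- The tree with one node. -/
def single : JT.{u} where
  nodes := {Node.nil}
  countable := Set.countable_singleton _
  nil_mem := rfl
  down {s t} h ht := by
    rw [Set.mem_singleton_iff] at ht
    subst ht
    exact absurd h.1 not_lt_zero
  succ {s t} h ht := by
    rw [Set.mem_singleton_iff] at ht
    subst ht
    exact absurd h.1 not_lt_zero
  ext {s t} hs ht h := by
    rw [Set.mem_singleton_iff] at hs ht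
    subst hs ht
    exact absurd h (lt_irrefl _)

end JT

/-! ### Sequences of countable normal trees -/

/-- The fully supported product of countably many copies of the forcing with countable normal
trees. -/
abbrev JSeq : Type (u + 1) := ℕ → JT.{u}

theorem JSeq.sigmaClosed : SigmaClosed JSeq.{u} := by
  intro s hs
  choose r _ hr using fun i => JT.exists_iUnion (fun n => s n i) fun m n h => hs h i
  exact ⟨r, fun n i => hr i n⟩

/-- The countably many coordinates may acquire top levels at different heights. These have a common
bound below `ω₁`, to which all coordinates are raised. -/
theorem JSeq.exists_top (q : JSeq.{u}) (γ : Ordinal.{u}) (hγ : γ < ω₁) :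
    ∃ r ≤ q, ∃ α, γ ≤ α ∧ ∀ i, (r i).Top α := by
  choose r hr α hα using fun i => (q i).exists_top
  obtain ⟨β, hβ, hβ'⟩ := exists_lt_omega_one_bound α fun i => (hα i).lt
  have hmax : max β γ < ω₁ := max_lt hβ hγ
  choose r' hr' hα' using fun i => (hα i).exists_le ((hβ' i).le.trans (le_max_left β γ)) hmax
  exact ⟨r', fun i => (hr' i).trans (hr i), _, le_max_right _ _, hα'⟩

end JechForcing

/-! ### Suslin trees and their products with trees of sequences -/

namespace JechForcing
open Ordinal

/-- A Suslin tree, in terms of types. -/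
structure SuslinTree (σ : Type w) extends LTree.{u} σ where
  root : σ
  root_le : ∀ x, x = root ∨ lt root x
  ht_lt_omega : ∀ x, ht x < ω₁
  level : ∀ α, {x | ht x = α}.Countable
  infinite_succ : ∀ x, {y | lt x y ∧ ht y = ht x + 1}.Infinite
  ext : ∀ x α, ht x < α → α < ω₁ → ∃ y, lt x y ∧ ht y = α
  anti : ∀ B : Set σ, (∀ x ∈ B, ∀ y ∈ B, ¬ lt x y) → B.Countable

section

variable {σ : Type w} (S : SuslinTree.{u} σ) (e : Finset ℕ)

/-- The nodes of the product of `S` with the trees of all countable sequences. -/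
def ProdNode : Type (max w (u + 1)) :=
  {x : σ × (e → Node.{u}) // ∀ i, (x.2 i).len = S.ht x.1}

variable {S e}

namespace SuslinTree

theorem ext_le (x : σ) {α : Ordinal.{u}} (h : S.ht x ≤ α) (hα : α < ω₁) :
    ∃ y, S.le x y ∧ S.ht y = α := by
  rcases h.eq_or_lt with h | h
  · exact ⟨x, .inl rfl, h⟩
  · obtain ⟨y, hy, hy'⟩ := S.ext x α h hα
    exact ⟨y, .inr hy, hy'⟩

theorem ht_root : S.ht S.root = 0 := by
  by_contra hne
  obtain ⟨z, hz, -⟩ := S.res (pos_iff_ne_zero.2 hne)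
  rcases S.root_le z with rfl | h
  · exact (S.ht_lt hz).false
  · exact ((S.ht_lt hz).trans (S.ht_lt h)).false

theorem exists_ht {α : Ordinal.{u}} (hα : α < ω₁) : ∃ x, S.ht x = α := by
  obtain ⟨y, _, hy⟩ := S.ext_le S.root (α := α) (by rw [ht_root]; exact zero_le) hα
  exact ⟨y, hy⟩

/-- A dense subset of a Suslin tree meets all branches of some countable length. -/
theorem exists_level_of_dense (D : Set σ) (α : Ordinal.{u}) (hα : α < ω₁)
    (hD : ∀ x, α ≤ S.ht x → ∃ d ∈ D, S.le x d) :
    ∃ γ < (ω₁ : Ordinal.{u}), α ≤ γ ∧ ∀ x, S.ht x = γ → ∃ d ∈ D, S.le d x := by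
  -- The minimal elements of `D` form an antichain, so they are countable and their heights are
  -- bounded below `ω₁`.
  let D₀ : Set σ := {d ∈ D | ∀ d' ∈ D, ¬ S.lt d' d}
  have hD₀ : D₀.Countable := S.anti D₀ fun x hx y hy h => hy.2 x hx.1 h
  have := hD₀.to_subtype
  obtain ⟨γ, hγ, hγ'⟩ := exists_lt_omega_one_bound (fun d : D₀ => S.ht d.1)
    fun d => S.ht_lt_omega d
  refine ⟨max γ α, max_lt hγ hα, le_max_right _ _, fun x hx => ?_⟩
  obtain ⟨d, hd, hxd⟩ := hD x (hx ▸ le_max_right _ _)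
  have : ∃ o, ∃ d' ∈ D, S.le d' d ∧ S.ht d' = o := ⟨_, d, hd, .inl rfl, rfl⟩
  obtain ⟨o, ⟨d₀, hd₀, hd₀d, rfl⟩, hmin⟩ := WellFounded.has_min
    (wellFounded_lt (α := Ordinal.{u})) _ this
  -- The node `x` and the minimal element `d₀` are both below `d`, hence comparable, and `d₀` is the
  -- lower one by the choice of `γ`.
  refine ⟨d₀, hd₀, LTree.le_of_le_of_le hd₀d hxd ?_⟩
  have : d₀ ∈ D₀ := ⟨hd₀, fun d' hd' h => hmin _ ⟨d', hd', LTree.le_trans (.inr h) hd₀d, rfl⟩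
    (S.ht_lt h)⟩
  rw [hx]
  exact (hγ' ⟨d₀, this⟩).le.trans (le_max_left _ _)

end SuslinTree

namespace ProdNode

variable (S e) in
/-- The tree product of `S` with finitely many trees of countable sequences. -/
def tree : LTree.{u} (ProdNode S e) where
  lt x y := S.lt x.1.1 y.1.1 ∧ ∀ i, Node.tree.lt (x.1.2 i) (y.1.2 i)
  ht x := S.ht x.1.1
  trans h h' := ⟨S.trans h.1 h'.1, fun i => Node.tree.trans (h.2 i) (h'.2 i)⟩
  ht_lt h := S.ht_lt h.1
  res {y β} h := by
    obtain ⟨s, hs, hs'⟩ := S.res h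
    have := fun i => Node.tree.res (y := y.1.2 i) (β := β) (h.trans_eq (y.2 i).symm)
    choose t ht ht' using this
    exact ⟨⟨(s, t), fun i => (ht' i).trans hs'.symm⟩, ⟨hs, ht⟩, hs'⟩
  cmp {x y z} h h' hlt := ⟨S.cmp h.1 h'.1 hlt, fun i => Node.tree.cmp (h.2 i) (h'.2 i) (by
    rw [Node.tree_ht, Node.tree_ht, x.2, y.2]; exact hlt)⟩
  uniq {x y z} h h' heq := Subtype.ext (Prod.ext (S.uniq h.1 h'.1 heq) (funext fun i =>
    Node.tree.uniq (h.2 i) (h'.2 i) (by rw [Node.tree_ht, Node.tree_ht, x.2, y.2]; exact heq)))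
  lim {x y} hl heq h := by
    have hx : ∀ x : ProdNode S e, ∀ β < S.ht x.1.1, ∃ z : ProdNode S e, S.ht z.1.1 = β ∧
        S.lt z.1.1 x.1.1 ∧ ∀ i, Node.tree.lt (z.1.2 i) (x.1.2 i) := by
      intro x β h
      obtain ⟨s, hs, hs'⟩ := S.res h
      have := fun i => Node.tree.res (y := x.1.2 i) (β := β) (h.trans_eq (x.2 i).symm)
      choose t ht ht' using this
      exact ⟨⟨(s, t), fun i => (ht' i).trans hs'.symm⟩, hs', hs, ht⟩
    have key : ∀ x y : ProdNode S e, (∀ z : ProdNode S e,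
        S.lt z.1.1 x.1.1 ∧ (∀ i, Node.tree.lt (z.1.2 i) (x.1.2 i)) →
        S.lt z.1.1 y.1.1 ∧ (∀ i, Node.tree.lt (z.1.2 i) (y.1.2 i))) →
        (∀ s, S.lt s x.1.1 → S.lt s y.1.1) ∧
        ∀ i s, Node.tree.lt s (x.1.2 i) → Node.tree.lt s (y.1.2 i) := by
      refine fun x y h => ⟨fun s hs => ?_, fun i s hs => ?_⟩
      · obtain ⟨z, hz, hz'⟩ := hx x _ (S.ht_lt hs)
        rw [S.uniq hs hz'.1 hz.symm]
        exact (h z hz').1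
      · have := (Node.tree.ht_lt hs).trans_eq (x.2 i)
        obtain ⟨z, hz, hz'⟩ := hx x _ this
        rw [Node.tree.uniq hs (hz'.2 i) (hz.symm.trans (z.2 i).symm)]
        exact (h z hz').2 i
    have h₁ := key x y fun z => (h z).1
    have h₂ := key y x fun z => (h z).2
    refine Subtype.ext (Prod.ext (S.lim hl heq fun z => ⟨h₁.1 z, h₂.1 z⟩) (funext fun i =>
      Node.tree.lim ?_ ?_ fun z => ⟨h₁.2 i z, h₂.2 i z⟩))
    · rw [Node.tree_ht, x.2]; exact hl
    · rw [Node.tree_ht, Node.tree_ht, x.2, y.2]; exact heq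

/-- All coordinates of a node have the same height, so equality in one coordinate excludes strict
inequality in the others. -/
theorem le_iff {x y : ProdNode S e} : (tree S e).le x y ↔
    S.le x.1.1 y.1.1 ∧ ∀ i, Node.tree.le (x.1.2 i) (y.1.2 i) := by
  constructor
  · rintro (rfl | h)
    · exact ⟨.inl rfl, fun _ => .inl rfl⟩
    · exact ⟨.inr h.1, fun i => .inr (h.2 i)⟩
  · rintro ⟨h, h'⟩
    rcases (LTree.ht_le h).eq_or_lt with heq | hlt
    · refine .inl (Subtype.ext (Prod.ext ?_ (funext fun i => ?_)))
      · exact h.resolve_right fun h => (S.ht_lt h).ne heq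
      · refine (h' i).resolve_right fun h => (Node.tree.ht_lt h).ne ?_
        rw [Node.tree_ht, Node.tree_ht, x.2, y.2, heq]
    · refine .inr ⟨h.resolve_left fun h => hlt.ne (h ▸ rfl), fun i => (h' i).resolve_left
        fun h => hlt.ne ?_⟩
      rw [← x.2 i, ← y.2 i, h]

theorem lt_of_le {x y : ProdNode S e} (h : S.lt x.1.1 y.1.1)
    (h' : ∀ i, Node.tree.le (x.1.2 i) (y.1.2 i)) : (tree S e).lt x y := by
  rcases le_iff.2 ⟨.inr h, h'⟩ with rfl | h''
  · exact absurd h (LTree.irrefl _)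
  · exact h''

end ProdNode

/-! ### Sealing an antichain of the product -/

/-- The forced statements `x ∈ B` about a subset `B` of the product tree that is forced to be an
antichain. -/
structure AntichainName (S : SuslinTree.{u} σ) (e : Finset ℕ) where
  mem : JSeq.{u} → ProdNode S e → Prop
  mono : ∀ {q r x}, r ≤ q → mem q x → mem r x
  anti : ∀ {q x y}, mem q x → mem q y → ¬ (ProdNode.tree S e).lt x y
  node : ∀ {q x}, mem q x → Dn q fun r => ∀ i : e, x.1.2 i ∈ (r i).nodes

namespace AntichainName

variable (B : AntichainName S e)

/-- The condition `q` decides whether `x` is above a member of the antichain or incompatible with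
all members of the antichain. -/
def Dec (q : JSeq.{u}) (x : ProdNode S e) : Prop :=
  (∃ z, (ProdNode.tree S e).le z x ∧ B.mem q z) ∨
    ∀ r ≤ q, ∀ y, (ProdNode.tree S e).le x y → ¬ B.mem r y

variable {B} in
theorem Dec.mono {q r : JSeq.{u}} {x : ProdNode S e} (h : B.Dec q x) (hr : r ≤ q) : B.Dec r x :=
  h.imp (fun ⟨z, hz, h⟩ => ⟨z, hz, B.mono hr h⟩) fun h s hs => h s (hs.trans hr)

/-- Either some extension puts a node above `x` into the antichain, and that node is decided
positively, or `x` itself is already decided negatively by `q`. -/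
theorem exists_dec (q : JSeq.{u}) (x : ProdNode S e) (hx : ∀ i : e, x.1.2 i ∈ (q i).nodes) :
    ∃ r ≤ q, ∃ y, (ProdNode.tree S e).le x y ∧ (∀ i : e, y.1.2 i ∈ (r i).nodes) ∧ B.Dec r y := by
  by_cases h : ∃ r ≤ q, ∃ y, (ProdNode.tree S e).le x y ∧ B.mem r y
  · obtain ⟨r, hr, y, hxy, hy⟩ := h
    obtain ⟨s, hs, hn⟩ := (B.node hy).exists
    exact ⟨s, hs.trans hr, y, hxy, hn, .inl ⟨y, .inl rfl, B.mono hs hy⟩⟩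
  · push Not at h
    exact ⟨q, le_rfl, x, .inl rfl, hx, .inr h⟩

/-- The tuples of nodes of the top levels. -/
def TopTuple (q : JSeq.{u}) (α : Ordinal.{u}) (t : e → Node.{u}) : Prop :=
  ∀ i : e, t i ∈ (q i).nodes ∧ (t i).len = α

/-- The `S`-coordinates of the nodes above `t` that extensions of `q` can decide are dense in `S`
above height `α`, so the Suslin property of `S` yields one level for all `s`. The extension `r`
depends on `s`, but the bound `γ` does not; the closing-off argument rests on this. -/
theorem exists_level (q : JSeq.{u}) (α : Ordinal.{u}) (hα : α < ω₁) (t : e → Node.{u})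
    (ht : TopTuple q α t) : ∃ γ < (ω₁ : Ordinal.{u}), α ≤ γ ∧ ∀ s, S.ht s = γ →
      ∃ r ≤ q, ∃ x : ProdNode S e, S.le x.1.1 s ∧ (∀ i : e, Node.tree.le (t i) (x.1.2 i)) ∧
        (∀ i : e, x.1.2 i ∈ (r i).nodes) ∧ B.Dec r x := by
  have hD : ∀ s, α ≤ S.ht s → ∃ d ∈ {d | ∃ r ≤ q, ∃ x : ProdNode S e, x.1.1 = d ∧
      (∀ i : e, Node.tree.le (t i) (x.1.2 i)) ∧ (∀ i : e, x.1.2 i ∈ (r i).nodes) ∧ B.Dec r x},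
      S.le s d := by
    intro s hs
    obtain ⟨r, hr, β, hβ, hr'⟩ := q.exists_top (S.ht s) (S.ht_lt_omega s)
    obtain ⟨s', hs', hs'β⟩ := S.ext_le s hβ (hr' 0).lt
    choose t' ht' htt' ht'β using fun i : e => (hr' i.1).ext ((hr i).1 (ht i).1)
    obtain ⟨r', hr'', y, hy, hyr, hyd⟩ := B.exists_dec r ⟨(s', t'), fun i => by
      rw [hs'β]; exact ht'β i⟩ ht'
    replace hy := ProdNode.le_iff.1 hy
    exact ⟨y.1.1, ⟨r', hr''.trans hr, y, rfl, fun i => LTree.le_trans (htt' i) (hy.2 i), hyr, hyd⟩,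
      LTree.le_trans hs' hy.1⟩
  obtain ⟨γ, hγ, hαγ, h⟩ := S.exists_level_of_dense _ α hα hD
  refine ⟨γ, hγ, hαγ, fun s hs => ?_⟩
  obtain ⟨d, ⟨r, hr, x, rfl, h⟩, hd⟩ := h s hs
  exact ⟨r, hr, x, hd, h⟩

/-- One step of the construction. Besides the extension `r` it provides a map `c` that prolongs
every node of `q` to the new top level, and that leads the nodes of the tuple `t` through the
decided node `x`. -/
theorem exists_step (q : JSeq.{u}) (α : Ordinal.{u}) (hα : ∀ i, (q i).Top α) (t : e → Node.{u})
    (ht : TopTuple q α t) : ∃ γ < (ω₁ : Ordinal.{u}), α ≤ γ ∧ ∀ s, S.ht s = γ → ∀ h < ω₁,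
      ∃ r ≤ q, ∃ β, h ≤ β ∧ (∀ i, (r i).Top β) ∧ ∃ c : ℕ → Node.{u} → Node.{u},
        (∀ i, ∀ x ∈ (q i).nodes, c i x ∈ (r i).nodes ∧ Node.tree.le x (c i x) ∧ (c i x).len = β) ∧
        ∃ x : ProdNode S e, S.le x.1.1 s ∧ (∀ i : e, Node.tree.le (x.1.2 i) (c i (t i))) ∧
          B.Dec r x := by
  classical
  obtain ⟨γ, hγ, hαγ, h⟩ := B.exists_level q α (hα 0).lt t ht
  refine ⟨γ, hγ, hαγ, fun s hs h' hh' => ?_⟩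
  obtain ⟨r₀, hr₀, x, hxs, htx, hxr, hx⟩ := h s hs
  obtain ⟨r, hr, β, hβ, hrβ⟩ := r₀.exists_top h' hh'
  -- Only the nodes `t i` are steered through `x`; every other node may be prolonged arbitrarily.
  have hc : ∀ i, ∀ y, ∃ z, y ∈ (q i).nodes → z ∈ (r i).nodes ∧ Node.tree.le y z ∧ z.len = β ∧
      ∀ hi : i ∈ e, y = t ⟨i, hi⟩ → Node.tree.le (x.1.2 ⟨i, hi⟩) z := by
    intro i y
    by_cases hy : y ∈ (q i).nodes
    swap
    · exact ⟨y, fun h => absurd h hy⟩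
    by_cases hi : ∃ hi : i ∈ e, y = t ⟨i, hi⟩
    · obtain ⟨hi, rfl⟩ := hi
      obtain ⟨z, hz, hxz, hzβ⟩ := (hrβ i).ext ((hr i).1 (hxr ⟨i, hi⟩))
      exact ⟨z, fun _ => ⟨hz, LTree.le_trans (htx ⟨i, hi⟩) hxz, hzβ, fun _ _ => hxz⟩⟩
    · obtain ⟨z, hz, hxz, hzβ⟩ := (hrβ i).ext ((hr i).1 ((hr₀ i).1 hy))
      exact ⟨z, fun _ => ⟨hz, hxz, hzβ, fun h h' => (hi ⟨h, h'⟩).elim⟩⟩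
  choose c hc using hc
  exact ⟨r, hr.trans hr₀, β, hβ, hrβ, c, fun i y hy => ⟨(hc i y hy).1, (hc i y hy).2.1,
    (hc i y hy).2.2.1⟩, x, hxs, fun i => (hc i (t i) (ht i).1).2.2.2 i.2 rfl, hx.mono hr⟩

end AntichainName

end
end JechForcing

/-! ### Construction of the sealing condition -/

namespace JechForcing
open Ordinal

theorem JT.Top.unique {u : JT.{u}} {α β : Ordinal.{u}} (h : u.Top α) (h' : u.Top β) : α = β := by
  obtain ⟨⟨t, ht, rfl⟩, h⟩ := h
  obtain ⟨⟨t', ht', rfl⟩, h'⟩ := h'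
  exact (h' t ht).antisymm (h t' ht')

/-- Every task recurs infinitely often because it can be carried out only after the nodes it
mentions have entered the conditions. -/
theorem exists_enum_frequently {τ : Type w} (T : Set τ) (hT : T.Countable) (hne : T.Nonempty) :
    ∃ f : ℕ → τ, (∀ n, f n ∈ T) ∧ ∀ x ∈ T, ∀ m, ∃ n, m ≤ n ∧ f n = x := by
  obtain ⟨g, hg⟩ := hT.exists_eq_range hne
  refine ⟨fun n => g n.unpair.1, fun n => hg ▸ ⟨_, rfl⟩, fun x hx m => ?_⟩
  rw [hg] at hx
  obtain ⟨k, rfl⟩ := hx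
  exact ⟨Nat.pair k m, Nat.right_le_pair k m, by simp⟩

section

variable {σ : Type w} {S : SuslinTree.{u} σ} {e : Finset ℕ}

namespace AntichainName

variable (B : AntichainName S e)

/-- The conditions all of whose trees have a top level of the same height. -/
def Uniform : Type (u + 1) := {q : JSeq.{u} // ∃ α, ∀ i, (q i).Top α}

namespace Uniform

/-- The common height of the top levels. -/
noncomputable def top (q : Uniform.{u}) : Ordinal.{u} := q.2.choose

theorem top_spec (q : Uniform.{u}) (i : ℕ) : (q.1 i).Top q.top := q.2.choose_spec i

theorem countable_topTuple (q : Uniform.{u}) (e : Finset ℕ) :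
    {t : e → Node.{u} | TopTuple q.1 q.top t}.Countable := by
  refine (Set.countable_univ_pi (s := fun i : e => (q.1 i).nodes)
    fun i => (q.1 i).countable).mono ?_
  intro t ht i _
  exact (ht i).1

theorem exists_topTuple (q : Uniform.{u}) (e : Finset ℕ) :
    ∃ t : e → Node.{u}, TopTuple q.1 q.top t := by
  choose t ht ht' using fun i : e => (q.top_spec i).1
  exact ⟨t, fun i => ⟨ht i, ht' i⟩⟩

end Uniform

/-- The extension steps of the construction of a sealing condition, together with a bound for the
height at which they work. -/
theorem exists_operation : ∃ (gam : Uniform.{u} → (e → Node.{u}) → Ordinal.{u})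
    (op : Uniform.{u} → (e → Node.{u}) → σ → Ordinal.{u} → Uniform.{u})
    (c : Uniform.{u} → (e → Node.{u}) → σ → Ordinal.{u} → ℕ → Node.{u} → Node.{u}),
    (∀ q t, gam q t < ω₁) ∧ ∀ q t s h, TopTuple q.1 q.top t → S.ht s = gam q t → h < ω₁ →
      (op q t s h).1 ≤ q.1 ∧ h ≤ (op q t s h).top ∧
      (∀ i, ∀ x ∈ (q.1 i).nodes, c q t s h i x ∈ ((op q t s h).1 i).nodes ∧
        Node.tree.le x (c q t s h i x) ∧ (c q t s h i x).len = (op q t s h).top) ∧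
      ∃ x : ProdNode S e, S.le x.1.1 s ∧ (∀ i : e, Node.tree.le (x.1.2 i) (c q t s h i (t i))) ∧
        B.Dec (op q t s h).1 x := by
  have h₁ : ∀ (q : Uniform.{u}) (t : e → Node.{u}), ∃ γ < (ω₁ : Ordinal.{u}),
      TopTuple q.1 q.top t → ∀ s, S.ht s = γ → ∀ h < ω₁,
      ∃ r : Uniform.{u}, r.1 ≤ q.1 ∧ h ≤ r.top ∧ ∃ c : ℕ → Node.{u} → Node.{u},
        (∀ i, ∀ x ∈ (q.1 i).nodes, c i x ∈ (r.1 i).nodes ∧ Node.tree.le x (c i x) ∧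
          (c i x).len = r.top) ∧
        ∃ x : ProdNode S e, S.le x.1.1 s ∧ (∀ i : e, Node.tree.le (x.1.2 i) (c i (t i))) ∧
          B.Dec r.1 x := by
    intro q t
    by_cases ht : TopTuple q.1 q.top t
    · obtain ⟨γ, hγ, _, h⟩ := B.exists_step q.1 q.top q.top_spec t ht
      refine ⟨γ, hγ, fun _ s hs h' hh' => ?_⟩
      obtain ⟨r, hr, β, hβ, hrβ, h⟩ := h s hs h' hh'
      have hβ' : Uniform.top ⟨r, β, hrβ⟩ = β := (Uniform.top_spec ⟨r, β, hrβ⟩ 0).unique (hrβ 0)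
      refine ⟨⟨r, β, hrβ⟩, hr, ?_⟩
      rw [hβ']
      exact ⟨hβ, h⟩
    -- A dummy value off the relevant tuples, so that the bound becomes a total function.
    · exact ⟨0, omega_pos 1, fun h => absurd h ht⟩
  choose gam hgam h₂ using h₁
  have h₃ : ∀ (q : Uniform.{u}) (t : e → Node.{u}) (s : σ) (h : Ordinal.{u}), ∃ (r : Uniform.{u})
      (c : ℕ → Node.{u} → Node.{u}), TopTuple q.1 q.top t → S.ht s = gam q t → h < ω₁ →
      r.1 ≤ q.1 ∧ h ≤ r.top ∧
      (∀ i, ∀ x ∈ (q.1 i).nodes, c i x ∈ (r.1 i).nodes ∧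
        Node.tree.le x (c i x) ∧ (c i x).len = r.top) ∧
      ∃ x : ProdNode S e, S.le x.1.1 s ∧ (∀ i : e, Node.tree.le (x.1.2 i) (c i (t i))) ∧
        B.Dec r.1 x := by
    intro q t s h
    by_cases hyp : TopTuple q.1 q.top t ∧ S.ht s = gam q t ∧ h < ω₁
    · obtain ⟨r, hr, hr', c, hc⟩ := h₂ q t hyp.1 s hyp.2.1 h hyp.2.2
      exact ⟨r, c, fun _ _ _ => ⟨hr, hr', hc⟩⟩
    · exact ⟨q, fun _ x => x, fun h₁ h₂ h₃ => absurd ⟨h₁, h₂, h₃⟩ hyp⟩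
  choose op c hop using h₃
  exact ⟨gam, op, c, hgam, hop⟩

/-- Densely, a condition bounds the heights of the members of an antichain. -/
theorem exists_bound (q₀ : JSeq.{u}) : ∃ r ≤ q₀, ∃ γ < (ω₁ : Ordinal.{u}), ∀ r' ≤ r, ∀ x,
    B.mem r' x → S.ht x.1.1 < γ := by
  classical
  obtain ⟨gam, op, c, hgam, hop⟩ := B.exists_operation
  obtain ⟨q₁, hq₁, α₁, -, hα₁⟩ := q₀.exists_top 0 (omega_pos 1)
  -- a countable set of conditions that is closed under the operations
  have hdel : ∀ X : Set Uniform.{u}, ∃ δ < (ω₁ : Ordinal.{u}), X.Countable → ∀ q ∈ X,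
      q.top < δ ∧ ∀ t, TopTuple q.1 q.top t → gam q t < δ := by
    intro X
    by_cases hX : X.Countable
    · have := hX.to_subtype
      have hC := fun q : X => (q.1.countable_topTuple e).to_subtype
      obtain ⟨δ, hδ, h⟩ := exists_lt_omega_one_bound
        (α := Σ q : X, {t : e → Node.{u} | TopTuple q.1.1 q.1.top t}) (fun p => gam p.1 p.2)
        fun p => hgam _ _
      obtain ⟨δ', hδ', h'⟩ := exists_lt_omega_one_bound (fun q : X => q.1.top)
        fun q => (q.1.top_spec 0).lt
      exact ⟨max δ δ', max_lt hδ hδ', fun _ q hq => ⟨(h' ⟨q, hq⟩).trans_le (le_max_right _ _),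
        fun t ht => (h ⟨⟨q, hq⟩, t, ht⟩).trans_le (le_max_left _ _)⟩⟩
    · exact ⟨0, omega_pos 1, fun h => absurd h hX⟩
  choose del hdel hdel' using hdel
  -- The height `δ` of the limit must be known in advance, since the tasks range over level `δ` of
  -- `S`. So `M` collects all conditions that any sequence of choices could produce. It stays
  -- countable because each condition has countably many top tuples and the relevant level of `S` is
  -- countable.
  let M : ℕ → Set Uniform.{u} := fun k => Nat.rec {⟨q₁, α₁, hα₁⟩}
    (fun _ X => (fun p : Uniform.{u} × (e → Node.{u}) × σ => op p.1 p.2.1 p.2.2 (del X)) ''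
      {p | p.1 ∈ X ∧ TopTuple p.1.1 p.1.top p.2.1 ∧ S.ht p.2.2 = gam p.1 p.2.1}) k
  have hM : ∀ k, (M k).Countable := by
    intro k
    induction k with
    | zero => exact Set.countable_singleton _
    | succ k ih =>
      refine Set.Countable.image (Set.Countable.mono (s₂ := ⋃ q ∈ M k,
        ⋃ t ∈ {t : e → Node.{u} | TopTuple q.1 q.top t},
        (fun s => (q, t, s)) '' {s | S.ht s = gam q t}) ?_ (ih.biUnion fun q _ =>
          (q.countable_topTuple e).biUnion fun t _ => (S.level _).image _)) _
      rintro ⟨q, t, s⟩ ⟨h₁, h₂, h₃⟩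
      exact Set.mem_biUnion h₁ (Set.mem_biUnion h₂ ⟨s, h₃, rfl⟩)
  let d : ℕ → Ordinal.{u} := fun k => del (M k)
  have hd : ∀ k, ∀ q ∈ M k, q.top < d k ∧ ∀ t, TopTuple q.1 q.top t → gam q t < d k :=
    fun k => hdel' (M k) (hM k)
  let δ : Ordinal.{u} := ⨆ k, d k
  have hδ : δ < ω₁ := Ordinal.iSup_lt_omega_one fun k => hdel _
  have hdδ : ∀ k, d k ≤ δ := Ordinal.le_iSup d
  -- the tasks
  let N : Set Node.{u} := ⋃ k, ⋃ q ∈ M k, ⋃ i, (q.1 i).nodes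
  have hN : N.Countable := Set.countable_iUnion fun k => (hM k).biUnion fun q _ =>
    Set.countable_iUnion fun i => (q.1 i).countable
  -- A task consists of a tuple of nodes occurring somewhere in `M` and a node of `S` of height `δ`.
  obtain ⟨τ, hτ, hτ'⟩ := exists_enum_frequently
    ({w : e → Node.{u} | w ∈ Set.univ.pi fun _ => N} ×ˢ {s : σ | S.ht s = δ})
    ((Set.countable_univ_pi fun _ => hN).prod (S.level δ)) (by
      obtain ⟨s, hs⟩ := S.exists_ht hδ
      exact ⟨(fun _ => Node.nil, s), fun i _ => Set.mem_iUnion.2 ⟨0, Set.mem_biUnion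
        (Set.mem_singleton _) (Set.mem_iUnion.2 ⟨0, JT.nil_mem _⟩)⟩, hs⟩)
  -- the construction
  choose dflt hdflt using fun q : Uniform.{u} => q.exists_topTuple e
  have hres : ∀ s γ, ∃ x, γ ≤ S.ht s → S.le x s ∧ S.ht x = γ := by
    intro s γ
    by_cases h : γ ≤ S.ht s
    · obtain ⟨x, hx⟩ := LTree.exists_le h
      exact ⟨x, fun _ => hx⟩
    · exact ⟨s, fun h' => absurd h' h⟩
  choose res hres using hres
  -- The current prolongations of the nodes of the task, if they form a tuple of top nodes.
  -- Otherwise the task is premature and a default tuple keeps the construction going.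
  let tup : ℕ → Uniform.{u} × (ℕ → Node.{u} → Node.{u}) → e → Node.{u} := fun k st =>
    if TopTuple st.1.1 st.1.top (fun i : e => st.2 i ((τ k).1 i)) then
      fun i : e => st.2 i ((τ k).1 i) else dflt st.1
  have htup : ∀ k st, TopTuple st.1.1 st.1.top (tup k st) := by
    intro k st
    by_cases h : TopTuple st.1.1 st.1.top (fun i : e => st.2 i ((τ k).1 i))
    · simp only [tup, if_pos h]; exact h
    · simp only [tup, if_neg h]; exact hdflt _
  let sv : ℕ → Uniform.{u} × (ℕ → Node.{u} → Node.{u}) → σ := fun k st =>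
    res (τ k).2 (gam st.1 (tup k st))
  -- The second component of a state follows the chosen branch through each node. A node stays put
  -- until it belongs to the current tree, and from then on it is moved to each new top level.
  let next : ℕ → Uniform.{u} × (ℕ → Node.{u} → Node.{u}) →
      Uniform.{u} × (ℕ → Node.{u} → Node.{u}) := fun k st =>
    (op st.1 (tup k st) (sv k st) (d k), fun i n => if st.2 i n ∈ (st.1.1 i).nodes then
      c st.1 (tup k st) (sv k st) (d k) i (st.2 i n) else st.2 i n)
  let st : ℕ → Uniform.{u} × (ℕ → Node.{u} → Node.{u}) := fun k =>
    Nat.rec (⟨q₁, α₁, hα₁⟩, fun _ n => n) next k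
  have hst : ∀ k, st (k + 1) = next k (st k) := fun k => rfl
  have hsv' : ∀ k, (st k).1 ∈ M k → S.le (sv k (st k)) (τ k).2 ∧
      S.ht (sv k (st k)) = gam (st k).1 (tup k (st k)) := fun k hk =>
    hres _ _ ((((hd k _ hk).2 _ (htup k _)).le.trans (hdδ k)).trans_eq (hτ k).2.symm)
  have hmem : ∀ k, (st k).1 ∈ M k := by
    intro k
    induction k with
    | zero => exact Set.mem_singleton _
    | succ k ih =>
      exact ⟨((st k).1, tup k (st k), sv k (st k)), ⟨ih, htup _ _, (hsv' k ih).2⟩, rfl⟩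
  have hsv := fun k => hsv' k (hmem k)
  have hspec := fun k => hop (st k).1 (tup k (st k)) (sv k (st k)) (d k) (htup _ _) (hsv k).2 (hdel _)
  let q : ℕ → JSeq.{u} := fun k => (st k).1.1
  let ε : ℕ → ℕ → Node.{u} → Node.{u} := fun k => (st k).2
  have hq : ∀ k, q (k + 1) ≤ q k := fun k => (hspec k).1
  have hqanti : Antitone q := antitone_nat_of_succ_le hq
  have hdtop : ∀ k, d k ≤ (st (k + 1)).1.top := fun k => (hspec k).2.1
  have htopd : ∀ k, (st k).1.top < d k := fun k => (hd k _ (hmem k)).1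
  -- Each `d k` is at most the top height of stage `k + 1`, which is less than `d (k + 1)`. So the
  -- top heights are cofinal in `δ`.
  have hdmono : StrictMono d := strictMono_nat_of_lt_succ fun k => (hdtop k).trans_lt (htopd (k + 1))
  have hε₁ : ∀ k i n, ε k i n ∈ (q k i).nodes → ε (k + 1) i n ∈ (q (k + 1) i).nodes ∧
      Node.tree.le (ε k i n) (ε (k + 1) i n) ∧ (ε (k + 1) i n).len = (st (k + 1)).1.top ∧
      ε (k + 1) i n = c (st k).1 (tup k (st k)) (sv k (st k)) (d k) i (ε k i n) := by
    intro k i n h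
    have h' : ε (k + 1) i n = c (st k).1 (tup k (st k)) (sv k (st k)) (d k) i (ε k i n) := if_pos h
    rw [h']
    have := (hspec k).2.2.1 i _ h
    exact ⟨this.1, this.2.1, this.2.2, rfl⟩
  have hε₂ : ∀ k i n, ε k i n ∉ (q k i).nodes → ε (k + 1) i n = ε k i n :=
    fun k i n h => if_neg h
  have hεle : ∀ k i n, Node.tree.le (ε k i n) (ε (k + 1) i n) := by
    intro k i n
    by_cases h : ε k i n ∈ (q k i).nodes
    · exact (hε₁ k i n h).2.1
    · exact .inl (hε₂ k i n h).symm
  have hε₃ : ∀ k i n, ε k i n ∈ (q k i).nodes ∨ ε k i n = n := by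
    intro k i n
    induction k with
    | zero => exact .inr rfl
    | succ k ih =>
      by_cases h : ε k i n ∈ (q k i).nodes
      · exact .inl (hε₁ k i n h).1
      · exact .inr ((hε₂ k i n h).trans (ih.resolve_left h))
  -- The inequality is strict: a node of `q K i` need not lie on the top level at stage `K`, and one
  -- step moves it there.
  have hε₄ : ∀ K i, ∀ n ∈ (q K i).nodes, ∀ k, K < k → ε k i n ∈ (q k i).nodes ∧
      (ε k i n).len = (st k).1.top := by
    intro K i n hn k hk
    have hK : ε K i n ∈ (q K i).nodes := by
      rcases hε₃ K i n with h | h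
      · exact h
      · rwa [h]
    induction k, hk using Nat.le_induction with
    | base => exact ⟨(hε₁ K i n hK).1, (hε₁ K i n hK).2.2.1⟩
    | succ k _ ih => exact ⟨(hε₁ k i n ih.1).1, (hε₁ k i n ih.1).2.2.1⟩
  have hεmono : ∀ i n {j k}, j ≤ k → (ε j i n).len ≤ (ε k i n).len := fun i n _ _ h =>
    monotone_nat_of_le_succ (f := fun k => (ε k i n).len) (fun k => LTree.ht_le (hεle k i n)) h
  -- the limit
  choose u hu huq using fun i => JT.exists_iUnion (fun k => q k i) fun m n h => hqanti h i
  choose b hb hb' using fun i n => Node.exists_iSup (fun k => ε k i n) fun k => hεle k i n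
  have hmu : ∀ {i n}, n ∈ (u i).nodes → ∃ K, n ∈ (q K i).nodes := fun {i n} h => by
    rw [hu] at h
    exact Set.mem_iUnion.1 h
  have hulen : ∀ i, ∀ n ∈ (u i).nodes, n.len < δ := by
    intro i n hn
    obtain ⟨K, hK⟩ := hmu hn
    exact (((st K).1.top_spec i).2 n hK).trans_lt ((htopd K).trans_le (hdδ K))
  have hblen : ∀ i, ∀ n ∈ (u i).nodes, (b i n).len = δ := by
    intro i n hn
    obtain ⟨K, hK⟩ := hmu hn
    rw [hb]
    refine le_antisymm (Ordinal.iSup_le fun k => ?_) (Ordinal.iSup_le fun k => ?_)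
    · have h₁ := (hε₄ K i n hK (max k K + 1) (by omega)).2
      have h₂ : (ε k i n).len ≤ (ε (max k K + 1) i n).len :=
        hεmono i n ((le_max_left k K).trans (Nat.le_succ _))
      exact h₂.trans (h₁.le.trans ((htopd (max k K + 1)).le.trans (hdδ (max k K + 1))))
    · have h₁ := (hε₄ K i n hK (max k K + 1) (by omega)).2
      have h₂ : d k ≤ (ε (max k K + 1) i n).len := by
        rw [h₁]
        exact (hdmono.monotone (le_max_left k K)).trans (hdtop _)
      exact h₂.trans (Ordinal.le_iSup (fun k => (ε k i n).len) (max k K + 1))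
  -- Only the branches followed during the construction receive a node on level `δ`. This is the
  -- sealing: every tuple of nodes of that level comes from a task.
  have hr : ∀ i, ∃ r ≤ u i, r.nodes = (u i).nodes ∪ b i '' (u i).nodes ∧ r.Top δ := by
    intro i
    refine (u i).exists_addLevel _ ((u i).countable.image _) δ ?_ (hulen i) ?_ ?_ ?_
    · rintro _ ⟨n, hn, rfl⟩
      exact hblen i n hn
    · intro n hn
      obtain ⟨K, hK⟩ := hmu hn
      obtain ⟨t, ht, ht'⟩ := ((st (K + 1)).1.top_spec i).1
      refine ⟨t, (huq i (K + 1)).1 ht, ?_⟩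
      rw [ht']
      exact (((st K).1.top_spec i).2 n hK).trans_lt ((htopd K).trans_le (hdtop K))
    · intro n hn
      refine ⟨b i n, ⟨n, hn, rfl⟩, (hb' i n 0).resolve_left fun h => ?_⟩
      have h : n = b i n := h
      have := hulen i n hn
      rw [h, hblen i n hn] at this
      exact this.false
    · rintro _ ⟨n, hn, rfl⟩ x hx
      obtain ⟨K, hK⟩ := hmu hn
      have hlt := Node.tree.ht_lt hx
      rw [Node.tree_ht, Node.tree_ht, hb, Ordinal.lt_iSup_iff] at hlt
      obtain ⟨k, hk⟩ := hlt
      have h₂ : (ε k i n).len ≤ (ε (max k K + 1) i n).len :=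
        hεmono i n ((le_max_left k K).trans (Nat.le_succ _))
      exact (huq i (max k K + 1)).1 (JT.down_le (LTree.le_of_le_of_le (.inr hx) (hb' i n (max k K + 1))
        (hk.le.trans h₂)) (hε₄ K i n hK (max k K + 1) (by omega)).1)
  choose r hru hrn hrtop using hr
  have hrq : ∀ k, r ≤ q k := fun k i => (hru i).trans (huq i k)
  -- The bound is `δ + 1` since the contradiction is for a member `y` strictly above level `δ`,
  -- which has a predecessor on that level.
  refine ⟨r, (hrq 0).trans hq₁, δ + 1, add_one_lt_omega_one hδ, fun r' hr' y hy => ?_⟩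
  by_contra! hlt
  have hlt : δ < S.ht y.1.1 := Order.add_one_le_iff.1 hlt
  obtain ⟨r'', hr'', hyn⟩ := (B.node hy).exists
  obtain ⟨s, hs, hsδ⟩ := S.res hlt
  -- By end-extension the predecessor of `y.1.2 i` on level `δ` already belongs to `r i`, so it is
  -- one of the followed branches.
  have hw : ∀ i : e, ∃ w ∈ (u i).nodes, Node.tree.lt (b i w) (y.1.2 i) := by
    intro i
    obtain ⟨n, hn, hnδ⟩ := Node.tree.res (y := y.1.2 i) (β := δ) (hlt.trans_eq (y.2 i).symm)
    obtain ⟨t, ht, htδ⟩ := (hrtop i).1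
    have hnr : n ∈ (r i).nodes := JT.mem_of_le ((hr''.trans hr') i) ((r'' i).down hn (hyn i)) ht
      (hnδ.trans htδ.symm).le
    rw [hrn] at hnr
    rcases hnr with hnr | ⟨w, hw, rfl⟩
    · exact absurd hnδ (hulen i n hnr).ne
    · exact ⟨w, hw, hn⟩
  choose w hwu hwy using hw
  choose K hK using fun i : e => hmu (hwu i)
  have hwN : (w, s) ∈ {w : e → Node.{u} | w ∈ Set.univ.pi fun _ => N} ×ˢ {s : σ | S.ht s = δ} :=
    ⟨fun i _ => Set.mem_iUnion.2 ⟨K i, Set.mem_biUnion (hmem (K i)) (Set.mem_iUnion.2 ⟨i, hK i⟩)⟩,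
      hsδ⟩
  obtain ⟨k, hk, hkτ⟩ := hτ' _ hwN ((Finset.univ.sup K) + 1)
  have hKk : ∀ i, K i < k := fun i => Nat.lt_of_le_of_lt (Finset.le_sup (Finset.mem_univ i)) hk
  have hvalid : TopTuple (st k).1.1 (st k).1.top (fun i : e => (st k).2 i ((τ k).1 i)) := by
    rw [hkτ]
    exact fun i => hε₄ (K i) i (w i) (hK i) k (hKk i)
  have htupk : tup k (st k) = fun i : e => ε k i (w i) := by
    have : tup k (st k) = fun i : e => (st k).2 i ((τ k).1 i) := if_pos hvalid
    rw [this, hkτ]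
  obtain ⟨x, hxs, hxc, hx⟩ := (hspec k).2.2.2
  -- In `S`, the decided `x` is below `sv k (st k)`, which is below `s` and so below `y`. In
  -- coordinate `i` it is below the prolongation of `w i` at stage `k + 1`, hence below `b i (w i)`
  -- and `y`.
  have hxy : (ProdNode.tree S e).lt x y := by
    refine ProdNode.lt_of_le (LTree.lt_of_le_of_lt (LTree.le_trans hxs ?_) hs) fun i => ?_
    · have := (hsv k).1
      rwa [hkτ] at this
    · have h₁ := hxc i
      have h₂ := hε₁ k i (w i) (hε₄ (K i) i (w i) (hK i) k (hKk i)).1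
      have h₃ : tup k (st k) i = ε k i (w i) := congrFun htupk i
      rw [h₃, ← h₂.2.2.2] at h₁
      exact LTree.le_trans h₁ (LTree.le_trans (hb' i (w i) (k + 1)) (.inr (hwy i)))
  have hr'q : r' ≤ q (k + 1) := hr'.trans (hrq (k + 1))
  -- A positive decision puts a member `z` of the antichain strictly below `y`; a negative one
  -- forbids `y` to be a member.
  rcases hx with ⟨z, hz, hzB⟩ | hx
  · exact B.anti (B.mono hr'q hzB) hy (LTree.lt_of_le_of_lt hz hxy)
  · exact hx r' hr'q y (.inr hxy) hy

end AntichainName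

end
end JechForcing

namespace JechForcing
open Fml Ordinal

/-! ### Truth in the universe of sets -/

section Holds

variable {x y z f X Y A R h α β : ZFSet.{u}}

theorem holds_isPair : Holds (isPair z x y) ↔ z = {x, y} := by
  simp only [isPair, Fml.iff, Holds]
  refine ⟨fun h => ZFSet.ext fun w => ?_, ?_⟩
  · rw [ZFSet.mem_pair]
    exact ⟨(h w).1, (h w).2⟩
  · rintro rfl w
    simp

theorem holds_isOPair : Holds (isOPair z x y) ↔ z = ZFSet.pair x y := by
  simp only [isOPair, Fml.iff, Holds, holds_isPair, ZFSet.pair_eq_singleton]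
  refine ⟨fun h => ZFSet.ext fun w => ?_, ?_⟩
  · rw [ZFSet.pair, ZFSet.mem_pair]
    exact ⟨(h w).1, (h w).2⟩
  · rintro rfl w
    simp [ZFSet.pair]

theorem holds_pairMem : Holds (pairMem x y f) ↔ ZFSet.pair x y ∈ f := by
  simp only [pairMem, exIn, Holds, holds_isOPair]
  exact ⟨fun ⟨z, hz, h⟩ => h ▸ hz, fun h => ⟨_, h, rfl⟩⟩

theorem holds_subset : Holds (subset x y) ↔ x ⊆ y := Iff.rfl

theorem holds_isFunction : Holds (isFunction f X Y) ↔
    (∀ z ∈ f, ∃ x ∈ X, ∃ y ∈ Y, z = ZFSet.pair x y) ∧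
    ∀ x ∈ X, ∃ y, ZFSet.pair x y ∈ f ∧ ∀ y', ZFSet.pair x y' ∈ f → y' = y := by
  simp only [isFunction, allIn, exIn, Holds, holds_isOPair, holds_pairMem]

theorem holds_isInjective : Holds (isInjective f) ↔
    ∀ x x' y, ZFSet.pair x y ∈ f → ZFSet.pair x' y ∈ f → x = x' := by
  simp only [isInjective, Holds, holds_pairMem]

theorem holds_isOrdinal : Holds (isOrdinal x) ↔ x.IsOrdinal :=
  ZFSet.isOrdinal_iff_forall_mem_isTransitive.symm

theorem holds_isLimit {o : Ordinal.{u}} : Holds (isLimit o.toZFSet) ↔ LimOrd o := by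
  simp only [isLimit, allIn, exIn, Holds, mem_toZFSet_iff]
  constructor
  · rintro ⟨⟨_, a, ha, rfl⟩, h⟩
    refine ⟨zero_le.trans_lt ha, fun a ha => ?_⟩
    obtain ⟨_, ⟨b, hb, rfl⟩, hab⟩ := h _ ⟨a, ha, rfl⟩
    rw [toZFSet_mem_toZFSet_iff] at hab
    exact (Order.add_one_le_iff.2 hab).trans_lt hb
  · rintro ⟨h₁, h₂⟩
    refine ⟨⟨_, 0, h₁, rfl⟩, ?_⟩
    rintro _ ⟨a, ha, rfl⟩
    exact ⟨_, ⟨a + 1, h₂ a ha, rfl⟩, toZFSet_mem_toZFSet_iff.2 (lt_add_one a)⟩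

theorem holds_isOmega : Holds (isOmega x) ↔ x = toZFSet ω := by
  simp only [isOmega, Fml.not, allIn, Holds, holds_isOrdinal]
  constructor
  · rintro ⟨h₁, h₂, h₃⟩
    obtain ⟨o, rfl⟩ := ZFSet.isOrdinal_iff_mem_range_toZFSet.1 h₁
    rw [holds_isLimit] at h₂
    rcases h₂.omega0_le.eq_or_lt with rfl | hlt
    · rfl
    · exact (h₃ _ (toZFSet_mem_toZFSet_iff.2 hlt) (holds_isLimit.2 limOrd_omega0)).elim
  · rintro rfl
    refine ⟨ZFSet.isOrdinal_toZFSet _, holds_isLimit.2 limOrd_omega0, fun n hn hl => ?_⟩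
    obtain ⟨a, ha, rfl⟩ := mem_toZFSet_iff.1 hn
    obtain ⟨n, rfl⟩ := lt_omega0.1 ha
    exact not_limOrd_nat n (holds_isLimit.1 hl)

theorem exists_function (g : X → Ordinal.{u}) (hg : Function.Injective g) (o : Ordinal.{u})
    (ho : ∀ x, g x < o) : ∃ f, Holds (isFunction f X o.toZFSet) ∧ Holds (isInjective f) := by
  refine ⟨ZFSet.range fun x : X => ZFSet.pair x (g x).toZFSet, holds_isFunction.2 ⟨fun z hz => ?_,
    fun x hx => ⟨(g ⟨x, hx⟩).toZFSet, ?_, fun y hy => ?_⟩⟩, holds_isInjective.2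
    fun x x' y h h' => ?_⟩
  · obtain ⟨x, rfl⟩ := ZFSet.mem_range.1 hz
    exact ⟨x, x.2, _, toZFSet_mem_toZFSet_iff.2 (ho x), rfl⟩
  · exact ZFSet.mem_range.2 ⟨⟨x, hx⟩, rfl⟩
  · obtain ⟨x', h⟩ := ZFSet.mem_range.1 hy
    obtain ⟨rfl, rfl⟩ := ZFSet.pair_inj.1 h
    rfl
  · obtain ⟨a, h⟩ := ZFSet.mem_range.1 h
    obtain ⟨a', h'⟩ := ZFSet.mem_range.1 h'
    obtain ⟨rfl, rfl⟩ := ZFSet.pair_inj.1 h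
    obtain ⟨rfl, h''⟩ := ZFSet.pair_inj.1 h'
    rw [hg (toZFSet_injective h'')]

theorem holds_isCountable : Holds (isCountable X) ↔ (X : Set ZFSet.{u}).Countable := by
  simp only [isCountable, Holds, holds_isOmega]
  constructor
  · rintro ⟨_, rfl, f, hf, hinj⟩
    rw [holds_isFunction] at hf
    rw [holds_isInjective] at hinj
    choose! g hg _ using hf.2
    refine Set.MapsTo.countable_of_injOn (f := g) (t := (toZFSet ω : Set ZFSet.{u})) ?_ ?_ ?_
    · intro x hx
      obtain ⟨x', -, y, hy, h⟩ := hf.1 _ (hg x hx)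
      rw [(ZFSet.pair_inj.1 h).2]
      exact hy
    · intro x hx x' hx' h
      exact hinj x x' _ (hg x hx) (h ▸ hg x' hx')
    · rw [coe_toZFSet]
      exact ((lt_omega_one_iff_countable_Iio.1 omega0_lt_omega_one).image _)
  · intro hX
    have := hX.to_subtype
    obtain ⟨g, hg⟩ := exists_injective_nat (X : Set ZFSet.{u})
    exact ⟨_, rfl, exists_function (fun x => (g x : Ordinal.{u}))
      (fun x y h => hg (by simpa using h)) ω fun x => natCast_lt_omega0 _⟩

theorem holds_isFinite_of_finite (hX : (X : Set ZFSet.{u}).Finite) : Holds (isFinite X) := by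
  have := hX.to_subtype
  obtain ⟨n, ⟨g⟩⟩ := Finite.exists_equiv_fin (X : Set ZFSet.{u})
  simp only [isFinite, exIn, Holds, holds_isOmega]
  exact ⟨_, rfl, toZFSet n, toZFSet_mem_toZFSet_iff.2 (natCast_lt_omega0 n), exists_function
    (fun x => ((g x : ℕ) : Ordinal.{u})) (fun x y h => g.injective (Fin.ext (by simpa using h))) n
    fun x => by simp⟩

theorem holds_isOmega1 (h : Holds (isOmega1 x)) : x = toZFSet ω₁ := by
  simp only [isOmega1, Fml.not, allIn, Holds, holds_isOrdinal, holds_isCountable] at h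
  obtain ⟨h₁, h₂, h₃⟩ := h
  obtain ⟨o, rfl⟩ := ZFSet.isOrdinal_iff_mem_range_toZFSet.1 h₁
  have key : ∀ a : Ordinal.{u}, (a.toZFSet : Set ZFSet.{u}).Countable ↔ a < ω₁ := by
    intro a
    rw [coe_toZFSet, lt_omega_one_iff_countable_Iio]
    exact ⟨fun h => Set.countable_of_injective_of_countable_image toZFSet_injective.injOn h,
      fun h => h.image _⟩
  rw [key] at h₂
  rcases (not_lt.1 h₂).eq_or_lt with h | h
  · rw [h]
  · exact absurd ((key _).1 (h₃ _ (toZFSet_mem_toZFSet_iff.2 h))) (lt_irrefl _)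

theorem holds_isHeightFn : Holds (isHeightFn A R h) ↔ (∃ Y, Holds (isFunction h A Y)) ∧
    ∀ x α, ZFSet.pair x α ∈ h → ∀ β, β ∈ α ↔ ∃ y, ZFSet.pair y x ∈ R ∧ ZFSet.pair y β ∈ h := by
  simp only [isHeightFn, Fml.iff, Holds, holds_pairMem, ← iff_iff_implies_and_implies]

theorem holds_isTree : Holds (isTree A R) ↔
    (∀ z ∈ R, ∃ x ∈ A, ∃ y ∈ A, z = ZFSet.pair x y) ∧
    (∀ x, ZFSet.pair x x ∉ R) ∧
    (∀ x y z, ZFSet.pair x y ∈ R → ZFSet.pair y z ∈ R → ZFSet.pair x z ∈ R) ∧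
    (∀ x y z, ZFSet.pair x z ∈ R → ZFSet.pair y z ∈ R →
      ZFSet.pair x y ∈ R ∨ x = y ∨ ZFSet.pair y x ∈ R) ∧
    ∀ B ⊆ A, (∃ x, x ∈ B) → ∃ m ∈ B, ∀ y ∈ B, ZFSet.pair y m ∉ R := by
  simp only [isTree, Fml.not, allIn, exIn, Holds, holds_isOPair, holds_pairMem, holds_subset]

theorem tree_induction (hT : Holds (isTree A R)) {p : ZFSet.{u} → Prop}
    (ih : ∀ x ∈ A, (∀ y, ZFSet.pair y x ∈ R → p y) → p x) : ∀ x ∈ A, p x := by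
  rw [holds_isTree] at hT
  by_contra! hne
  obtain ⟨x, hx, hpx⟩ := hne
  obtain ⟨m, hm, hm'⟩ := hT.2.2.2.2 (ZFSet.sep (fun x => ¬ p x) A) ZFSet.sep_subset
    ⟨x, ZFSet.mem_sep.2 ⟨hx, hpx⟩⟩
  rw [ZFSet.mem_sep] at hm
  refine hm.2 (ih m hm.1 fun y hy => ?_)
  by_contra hpy
  obtain ⟨a, ha, b, _, h⟩ := hT.1 _ hy
  rw [(ZFSet.pair_inj.1 h).1] at hy hpy
  exact hm' a (ZFSet.mem_sep.2 ⟨ha, hpy⟩) hy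

/-- The heights of the nodes of a tree. -/
theorem exists_heights (hT : Holds (isTree A R)) : ∃ o : ZFSet.{u} → Ordinal.{u}, ∀ h,
    Holds (isHeightFn A R h) → ∀ x α, ZFSet.pair x α ∈ h ↔ x ∈ A ∧ α = (o x).toZFSet := by
  have hT' := holds_isTree.1 hT
  -- The ordinal must serve all height functions at once. If there is none, any ordinal will do;
  -- otherwise one of them determines it and the others agree by induction along the tree.
  have key : ∀ x ∈ A, ∃ o : Ordinal.{u}, ∀ h, Holds (isHeightFn A R h) →
      ∀ α, ZFSet.pair x α ∈ h → α = o.toZFSet := by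
    refine tree_induction hT fun x hx ih => ?_
    by_cases hex : ∃ h, Holds (isHeightFn A R h)
    swap
    · exact ⟨0, fun h hh => absurd ⟨h, hh⟩ hex⟩
    obtain ⟨h₀, hh₀⟩ := hex
    have hh₀' := holds_isHeightFn.1 hh₀
    obtain ⟨Y, hY⟩ := hh₀'.1
    have hY := holds_isFunction.1 hY
    obtain ⟨α₀, hα₀, -⟩ := hY.2 x hx
    choose! o ho using ih
    have hα₀' := hh₀'.2 x α₀ hα₀
    have hord : α₀.IsOrdinal := by
      refine ZFSet.isOrdinal_iff_forall_mem_isTransitive.2 ⟨fun β hβ γ hγ => ?_, fun β hβ => ?_⟩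
      · obtain ⟨y, hyx, hy⟩ := (hα₀' β).1 hβ
        obtain ⟨z, hzy, hz⟩ := (hh₀'.2 y β hy γ).1 hγ
        exact (hα₀' γ).2 ⟨z, hT'.2.2.1 _ _ _ hzy hyx, hz⟩
      · obtain ⟨y, hyx, hy⟩ := (hα₀' β).1 hβ
        rw [ho y hyx h₀ hh₀ β hy]
        exact (ZFSet.isOrdinal_toZFSet _).isTransitive
    obtain ⟨a, rfl⟩ := ZFSet.isOrdinal_iff_mem_range_toZFSet.1 hord
    refine ⟨a, fun h hh α hα => ZFSet.ext fun β => ?_⟩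
    have hh' := holds_isHeightFn.1 hh
    rw [hh'.2 x α hα β, hα₀' β]
    have transfer : ∀ h₁ h₂, Holds (isHeightFn A R h₁) → Holds (isHeightFn A R h₂) → ∀ y,
        ZFSet.pair y x ∈ R → ZFSet.pair y β ∈ h₁ → ZFSet.pair y β ∈ h₂ := by
      intro h₁ h₂ hh₁ hh₂ y hyx hy
      obtain ⟨Y₂, hY₂⟩ := (holds_isHeightFn.1 hh₂).1
      obtain ⟨y', hy', _, _, he⟩ := hT'.1 _ hyx
      rw [(ZFSet.pair_inj.1 he).1] at hyx hy ⊢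
      obtain ⟨β', hβ', -⟩ := (holds_isFunction.1 hY₂).2 y' hy'
      rwa [ho y' hyx h₁ hh₁ β hy, ← ho y' hyx h₂ hh₂ β' hβ']
    exact ⟨fun ⟨y, hyx, hy⟩ => ⟨y, hyx, transfer h h₀ hh hh₀ y hyx hy⟩,
      fun ⟨y, hyx, hy⟩ => ⟨y, hyx, transfer h₀ h hh₀ hh y hyx hy⟩⟩
  choose! o ho using key
  refine ⟨o, fun h hh x α => ?_⟩
  obtain ⟨Y, hY⟩ := (holds_isHeightFn.1 hh).1
  have hY := holds_isFunction.1 hY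
  constructor
  · intro hx
    obtain ⟨x', hx', _, _, he⟩ := hY.1 _ hx
    rw [← (ZFSet.pair_inj.1 he).1] at hx'
    exact ⟨hx', ho x hx' h hh α hx⟩
  · rintro ⟨hx, rfl⟩
    obtain ⟨α, hα, -⟩ := hY.2 x hx
    rwa [← ho x hx h hh α hα]

/-- A set that is a Suslin tree is given by a Suslin tree in terms of types. -/
theorem exists_suslinTree {S : ZFSet.{u}} (hS : Holds (isSuslin S)) :
    ∃ (A R : ZFSet.{u}) (T : SuslinTree.{u} {x // x ∈ A}), S = ZFSet.pair A R ∧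
      ∀ z, z ∈ R ↔ ∃ x y, T.lt x y ∧ z = ZFSet.pair x.1 y.1 := by
  obtain ⟨A, R, hSAR, ⟨hT, h, hh, ⟨r, hr, hroot⟩, hlevel, hsucc, hext, hlim⟩,
    ⟨h', hh', w, hw, hw'⟩, hanti⟩ := hS
  obtain ⟨o, ho⟩ := exists_heights hT
  have hpair := ho h hh
  have hpair' := ho h' hh'
  have hrec := (holds_isHeightFn.1 hh).2
  have hT' := holds_isTree.1 hT
  obtain rfl := holds_isOmega1 hw
  have hwx : ∀ α, (α ∈ toZFSet ω₁ ↔ ∃ x ∈ A, α = (o x).toZFSet) := by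
    intro α
    have : α ∈ toZFSet ω₁ ↔ ∃ x, Holds (pairMem x α h') := ⟨(hw' α).1, (hw' α).2⟩
    simp only [this, holds_pairMem, hpair']
  have holt : ∀ x ∈ A, o x < ω₁ := fun x hx =>
    toZFSet_mem_toZFSet_iff.1 ((hwx _).2 ⟨x, hx, rfl⟩)
  have hrec' : ∀ x ∈ A, ∀ β : Ordinal.{u}, β < o x ↔
      ∃ y ∈ A, ZFSet.pair y x ∈ R ∧ β = o y := by
    intro x hx β
    rw [← toZFSet_mem_toZFSet_iff, hrec x _ ((hpair x _).2 ⟨hx, rfl⟩)]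
    simp only [hpair, toZFSet_injective.eq_iff]
    exact exists_congr fun y => by tauto
  have hlt : ∀ x y, ZFSet.pair x y ∈ R → x ∈ A ∧ y ∈ A ∧ o x < o y := by
    intro x y hxy
    obtain ⟨x', hx', y', hy', he⟩ := hT'.1 _ hxy
    obtain ⟨rfl, rfl⟩ := ZFSet.pair_inj.1 he
    exact ⟨hx', hy', (hrec' y hy' _).2 ⟨x, hx', hxy, rfl⟩⟩
  -- Normality speaks only about levels occupied by some node; height `ω₁` provides a node on each
  -- level below `ω₁`.
  have hext' : ∀ x ∈ A, ∀ α < (ω₁ : Ordinal.{u}), o x < α →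
      ∃ y, ZFSet.pair x y ∈ R ∧ o y = α := by
    intro x hx α hα hxα
    obtain ⟨z, hz, hzα⟩ := (hwx α.toZFSet).1 (toZFSet_mem_toZFSet_iff.2 hα)
    obtain ⟨y, hy, hy'⟩ := hext x (o x).toZFSet z α.toZFSet
      (holds_pairMem.2 ((hpair _ _).2 ⟨hx, rfl⟩)) (holds_pairMem.2 ((hpair _ _).2 ⟨hz, hzα⟩))
      (toZFSet_mem_toZFSet_iff.2 hxα)
    rw [holds_pairMem] at hy hy'
    exact ⟨y, hy, (toZFSet_injective ((hpair _ _).1 hy').2).symm⟩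
  have hsep : ∀ p : {x // x ∈ A} → Prop, ∃ L : ZFSet.{u}, (∀ x, x ∈ L ↔ ∃ hx : x ∈ A, p ⟨x, hx⟩) ∧
      (L : Set ZFSet.{u}) = Subtype.val '' {x | p x} := by
    intro p
    have hL : ∀ x, x ∈ ZFSet.sep (fun x => ∃ hx : x ∈ A, p ⟨x, hx⟩) A ↔ ∃ hx : x ∈ A, p ⟨x, hx⟩ :=
      fun x => ZFSet.mem_sep.trans ⟨fun h => h.2, fun h => ⟨h.1, h⟩⟩
    refine ⟨_, hL, Set.ext fun x => (hL x).trans ?_⟩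
    simp
  have hsep' : ∀ p : {x // x ∈ A} → Prop, (∀ L : ZFSet.{u}, (∀ x, x ∈ L ↔ ∃ hx : x ∈ A, p ⟨x, hx⟩) →
      Holds (isCountable L)) → {x | p x}.Countable := by
    intro p hp
    obtain ⟨L, hL, hL'⟩ := hsep p
    have := holds_isCountable.1 (hp L hL)
    rw [hL'] at this
    exact Set.countable_of_injective_of_countable_image Subtype.val_injective.injOn this
  let T : LTree.{u} {x // x ∈ A} :=
    { lt := fun x y => ZFSet.pair x.1 y.1 ∈ R
      ht := fun x => o x.1
      trans := fun h h' => hT'.2.2.1 _ _ _ h h'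
      ht_lt := fun h => (hlt _ _ h).2.2
      res := fun {y β} hβ => by
        obtain ⟨x, hx, h, rfl⟩ := (hrec' y.1 y.2 β).1 hβ
        exact ⟨⟨x, hx⟩, h, rfl⟩
      cmp := fun {x y z} h₁ h₂ hxy => by
        rcases hT'.2.2.2.1 _ _ _ h₁ h₂ with h | h | h
        · exact h
        · rw [h] at hxy
          exact absurd hxy (lt_irrefl _)
        · exact absurd (hlt _ _ h).2.2 hxy.not_gt
      uniq := fun {x y z} h₁ h₂ hxy => by
        rcases hT'.2.2.2.1 _ _ _ h₁ h₂ with h | h | h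
        · exact absurd hxy (hlt _ _ h).2.2.ne
        · exact Subtype.ext h
        · exact absurd hxy (hlt _ _ h).2.2.ne'
      lim := fun {x y} hl hxy hz => Subtype.ext <| by
        refine hlim (o x.1).toZFSet (holds_isLimit.2 hl) x.1 y.1
          (holds_pairMem.2 ((hpair _ _).2 ⟨x.2, rfl⟩))
          (holds_pairMem.2 ((hpair _ _).2 ⟨y.2, by rw [hxy]⟩)) fun z => ⟨fun h => ?_, fun h => ?_⟩
        · rw [holds_pairMem] at h ⊢
          exact (hz ⟨z, (hlt _ _ h).1⟩).1 h
        · rw [holds_pairMem] at h ⊢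
          exact (hz ⟨z, (hlt _ _ h).1⟩).2 h }
  refine ⟨A, R, ⟨T, ⟨r, hr⟩, ?_, fun x => holt x x.2, fun α => hsep' _ fun L hL => ?_,
    fun x => ?_, fun x α h h' => ?_, fun B hB => ?_⟩, holds_isOPair.1 hSAR,
    fun z => ⟨fun hz => ?_, ?_⟩⟩
  · rintro ⟨x, hx⟩
    rcases hroot x hx with h | h
    · exact .inl (Subtype.ext h)
    · exact .inr (holds_pairMem.1 h)
  · refine hlevel α.toZFSet L fun x => ?_
    have : x ∈ L ↔ Holds (pairMem x α.toZFSet h) := by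
      rw [hL, holds_pairMem, hpair, toZFSet_injective.eq_iff]
      exact ⟨fun ⟨h, h'⟩ => ⟨h, h'.symm⟩, fun ⟨h, h'⟩ => ⟨h, h'.symm⟩⟩
    exact ⟨this.1, this.2⟩
  · intro hfin
    obtain ⟨L, hL, hL'⟩ := hsep fun y => T.lt x y ∧ T.ht y = T.ht x + 1
    obtain ⟨y, hy, -⟩ := hext' x x.2 _ (add_one_lt_omega_one (holt x x.2)) (lt_add_one _)
    refine hsucc x.1 x.2 ⟨y, holds_pairMem.2 hy⟩ L (fun y => ?_) (holds_isFinite_of_finite ?_)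
    · have : y ∈ L ↔ Holds (isImmSucc R x.1 y) := by
        simp only [isImmSucc, Fml.not, Holds, holds_pairMem, hL]
        constructor
        · rintro ⟨hy, h₁, h₂⟩
          refine ⟨h₁, fun ⟨z, hxz, hzy⟩ => ?_⟩
          have h₂ : o y = o x + 1 := h₂
          have h₃ := (hlt _ _ hzy).2.2
          rw [h₂, Order.lt_add_one_iff] at h₃
          exact (hlt _ _ hxz).2.2.not_ge h₃
        · rintro ⟨hxy, hn⟩
          have hxy' := hlt _ _ hxy
          refine ⟨hxy'.2.1, hxy, ?_⟩
          rcases (Order.add_one_le_iff.2 hxy'.2.2).eq_or_lt with h | h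
          · exact h.symm
          · obtain ⟨z, hz, hz'⟩ := T.res (y := ⟨y, hxy'.2.1⟩) h
            exact (hn ⟨z.1, T.cmp (z := ⟨y, hxy'.2.1⟩) hxy hz
              ((lt_add_one _).trans_eq hz'.symm), hz⟩).elim
      exact ⟨this.1, this.2⟩
    · rw [hL']
      exact hfin.image _
  · obtain ⟨y, hy, hy'⟩ := hext' x x.2 α h' h
    exact ⟨⟨y, (hlt _ _ hy).2.1⟩, hy, hy'⟩
  · refine hsep' (fun x => x ∈ B) fun L hL => hanti L ⟨fun x hx => ((hL x).1 hx).1,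
      fun x hx y hy hxy => ?_⟩
    obtain ⟨hx, hxB⟩ := (hL x).1 hx
    obtain ⟨hy, hyB⟩ := (hL y).1 hy
    exact hB _ hxB _ hyB (holds_pairMem.1 hxy)
  · obtain ⟨x, hx, y, hy, rfl⟩ := hT'.1 _ hz
    exact ⟨⟨x, hx⟩, ⟨y, hy⟩, hz, rfl⟩
  · rintro ⟨x, y, hxy, rfl⟩
    exact hxy

end Holds
end JechForcing

namespace JechForcing
open Fml Ordinal

/-! ### Sequences and trees of sequences in generic extensions -/

namespace Node

variable {s t : Node.{u}}

/-- The sequence as a set of ordered pairs. -/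
noncomputable def toZF (t : Node.{u}) : ZFSet.{u} :=
  ZFSet.range fun β : Set.Iio t.len =>
    ZFSet.pair β.1.toZFSet (toZFSet (t.val β))

theorem mem_toZF {z : ZFSet.{u}} :
    z ∈ t.toZF ↔ ∃ β < t.len, z = ZFSet.pair β.toZFSet (toZFSet (t.val β)) := by
  rw [toZF, ZFSet.mem_range]
  constructor
  · rintro ⟨β, rfl⟩
    exact ⟨β, β.2, rfl⟩
  · rintro ⟨β, hβ, rfl⟩
    exact ⟨⟨β, hβ⟩, rfl⟩

theorem pair_mem_toZF {β : Ordinal.{u}} {n : ℕ} :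
    ZFSet.pair β.toZFSet (toZFSet n) ∈ t.toZF ↔ β < t.len ∧ t.val β = n := by
  rw [mem_toZF]
  constructor
  · rintro ⟨β', hβ', h⟩
    obtain ⟨h₁, h₂⟩ := ZFSet.pair_inj.1 h
    obtain rfl := toZFSet_injective h₁
    exact ⟨hβ', by simpa using (toZFSet_injective h₂).symm⟩
  · rintro ⟨h, rfl⟩
    exact ⟨β, h, rfl⟩

theorem toZF_subset : s.toZF ⊆ t.toZF ↔ tree.le s t := by
  rw [le_iff]
  constructor
  · intro h
    have h' : ∀ β < s.len, β < t.len ∧ s.val β = t.val β := fun β hβ => by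
      have := pair_mem_toZF.1 (h (pair_mem_toZF.2 ⟨hβ, rfl⟩))
      exact ⟨this.1, this.2.symm⟩
    exact ⟨le_of_forall_lt fun β hβ => (h' β hβ).1, fun β hβ => (h' β hβ).2⟩
  · rintro ⟨h, h'⟩ z hz
    obtain ⟨β, hβ, rfl⟩ := mem_toZF.1 hz
    exact pair_mem_toZF.2 ⟨hβ.trans_le h, (h' β hβ).symm⟩

theorem toZF_injective : Function.Injective toZF.{u} := fun s t h => by
  have h₁ := le_iff.1 (toZF_subset.1 h.subset)
  have h₂ := le_iff.1 (toZF_subset.1 h.symm.subset)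
  exact ext' (h₁.1.antisymm h₂.1) h₁.2

end Node

section

variable {Q : Type w} {P : Type u} [Preorder Q] [Preorder P] [Proj Q P]
variable {q r : Q} {x y z A R α β : Name P} {s t : Node.{u}}

theorem frc_mem_toZF : (q ⊩ x ∈' .check t.toZF) ↔
    Dn q fun r => ∃ β < t.len, r ⊩ x =' .opair (.ord β) (.ord (t.val β)) := by
  rw [frc_mem_check]
  refine ⟨fun h => h.imp fun r _ ⟨a, ha, h⟩ => ?_, fun h => h.imp fun r _ ⟨β, hβ, h⟩ => ?_⟩
  · obtain ⟨β, hβ, rfl⟩ := Node.mem_toZF.1 ha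
    exact ⟨β, hβ, h.trans (frc_check_pair _ _)⟩
  · exact ⟨_, Node.mem_toZF.2 ⟨β, hβ, rfl⟩, h.trans (frc_check_pair _ _).symm⟩

theorem frc_opair_ord_mem_toZF {β : Ordinal.{u}} (h : q ⊩ .opair (.ord β) y ∈' .check t.toZF) :
    β < t.len ∧ (q ⊩ y =' .ord (t.val β)) := by
  have : Dn q fun r => β < t.len ∧ (r ⊩ y =' .ord (t.val β)) :=
    (frc_mem_toZF.1 h).imp fun r _ ⟨β', hβ', h⟩ => by
      obtain ⟨h₁, h₂⟩ := frc_opair_inj.1 h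
      obtain rfl := frc_ord_eq.1 h₁
      exact ⟨hβ', h₂⟩
  obtain ⟨_, _, h', _⟩ := this.exists
  exact ⟨h', this.frc fun _ _ h => h.2⟩

theorem frc_isSeq :
    (q ⊩ isSeq x α) ↔ (q ⊩ isOrdinal α) ∧ (q ⊩ isFunction x α (.ord ω)) := by
  refine and_congr Iff.rfl (frc_ex.trans ⟨fun h => h.frc fun r _ ⟨w, hw, h⟩ => ?_, fun h => ?_⟩)
  · exact Frc.isFunction_congr h (frc_refl _ _) (frc_isOmega.1 hw)
  · exact Dn.of_forall fun r hr => ⟨.ord ω, frc_isOmega.2 (frc_refl _ _), h.mono hr⟩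

theorem Frc.isSeq_congr (h : q ⊩ isSeq x α) (hα : q ⊩ α =' β) (hβ : q ⊩ isOrdinal β) :
    q ⊩ isSeq x β :=
  frc_isSeq.2 ⟨hβ, (frc_isSeq.1 h).2.isFunction_congr hα (frc_refl _ _)⟩

theorem Frc.isSeq_congr_left (h : q ⊩ isSeq x α) (hx : q ⊩ x =' y) : q ⊩ isSeq y α := by
  rw [frc_isSeq, frc_isFunction] at h ⊢
  refine ⟨h.1, fun z r hr hz => h.2.1 z r hr (hz.mem_right (hx.mono hr).symm), fun z r hr hz => ?_⟩
  refine (h.2.2 z r hr hz).imp fun s hs ⟨y, hy, hy'⟩ => ⟨y, ?_, fun y' t ht hy'' => ?_⟩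
  · exact hy.mem_right (hx.mono (hs.trans hr))
  · exact hy' y' t ht (hy''.mem_right (hx.mono (ht.trans (hs.trans hr))).symm)

theorem Frc.isSeq_dn (h : q ⊩ isSeq x α) :
    Dn q fun r => ∃ o, (r ⊩ α =' .ord o) ∧ (r ⊩ isSeq x (.ord o)) :=
  (dn_eq_ord (frc_isSeq.1 h).1).imp fun _ hr ⟨o, ho⟩ =>
    ⟨o, ho, (h.mono hr).isSeq_congr ho (frc_isOrdinal_of_eq_ord (frc_refl _ _))⟩

theorem Frc.isSeq_unique (h : q ⊩ isSeq x α) (h' : q ⊩ isSeq x β) : q ⊩ α =' β := by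
  have key : ∀ {γ δ : Name P}, (q ⊩ isSeq x γ) → (q ⊩ isSeq x δ) → (q ⊩ subset γ δ) := by
    intro γ δ h h'
    rw [frc_isSeq] at h h'
    refine frc_subset.2 fun z r hr hz => ?_
    exact ((h.2.mono hr).isFunction_total hz).frc fun s hs ⟨y, _, hy⟩ =>
      ((h'.2.mono (hs.trans hr)).isFunction_mem hy).1
  exact (key h h').antisymm (key h' h)

theorem Frc.isSeq_value {γ β : Ordinal.{u}} (h : q ⊩ isSeq x (.ord γ)) (hβ : β < γ) :
    Dn q fun r => ∃ n : ℕ, r ⊩ .opair (.ord β) (.ord n) ∈' x := by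
  refine ((frc_isSeq.1 h).2.isFunction_total (frc_ord_mem.2 hβ)).bind fun r hr ⟨y, hy, hy'⟩ => ?_
  refine (frc_mem_omega.1 hy).imp fun s hs ⟨n, hn⟩ => ⟨n, ?_⟩
  exact (hy'.mono hs).mem_left (frc_opair_congr (frc_refl _ _) hn)

theorem frc_isSeq_toZF : q ⊩ isSeq (.check t.toZF : Name P) (.ord t.len) := by
  refine frc_isSeq.2 ⟨frc_isOrdinal_of_eq_ord (frc_refl _ _), frc_isFunction.2 ⟨?_, ?_⟩⟩
  · intro z r hr hz
    exact (frc_mem_toZF.1 hz).imp fun s hs ⟨β, hβ, h⟩ => ⟨.ord β, _, frc_ord_mem.2 hβ,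
      frc_ord_mem.2 (natCast_lt_omega0 _), h⟩
  · intro z r hr hz
    refine (frc_mem_ord.1 hz).imp fun s hs ⟨β, hβ, h⟩ => ⟨.ord (t.val β), ?_, ?_⟩
    · exact frc_mem_toZF.2 (Dn.of_forall fun s' hs' => ⟨β, hβ,
        frc_opair_congr (h.mono hs') (frc_refl _ _)⟩)
    · intro y' s' hs' hy'
      exact (frc_opair_ord_mem_toZF
        (hy'.mem_left (frc_opair_congr (h.mono hs') (frc_refl _ _)))).2

theorem frc_eq_toZF (hx : q ⊩ isSeq x (.ord t.len))
    (hv : ∀ β < t.len, q ⊩ .opair (.ord β) (.ord (t.val β)) ∈' x) : q ⊩ x =' .check t.toZF := by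
  have hx := (frc_isSeq.1 hx).2
  refine frc_ext fun z r hr => ⟨fun hz => ?_, fun hz => ?_⟩
  · refine ((frc_isFunction.1 hx).1 z r hr hz).frc fun s hs ⟨a, b, ha, _, hz'⟩ => ?_
    refine (frc_mem_ord.1 ha).frc fun s' hs' ⟨β, hβ, hβ'⟩ => ?_
    refine frc_mem_toZF.2 (Dn.of_forall fun t ht => ⟨β, hβ, (hz'.mono (ht.trans hs')).trans
      (frc_opair_congr (hβ'.mono ht) ?_)⟩)
    have hts : t ≤ q := ht.trans (hs'.trans (hs.trans hr))
    refine (hx.mono hts).isFunction_unique (x := .ord β) ?_ ((hv β hβ).mono hts)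
    exact ((hz.mono (ht.trans (hs'.trans hs))).mem_left (hz'.mono (ht.trans hs'))).mem_left
      (frc_opair_congr (hβ'.mono ht) (frc_refl _ _))
  · exact (frc_mem_toZF.1 hz).frc fun s hs ⟨β, hβ, h⟩ =>
      ((hv β hβ).mono (hs.trans hr)).mem_left h.symm

/-- Once its length is decided to be `γ`, such a sequence agrees with `t` below `γ`, so it is the
ground-model restriction of `t`. Trees of the ground model thus remain closed under restriction. -/
theorem frc_subset_toZF (hs : q ⊩ subset x (.check t.toZF)) (hx : q ⊩ isSeq x α) :
    Dn q fun r => ∃ s : Node.{u}, Node.tree.le s t ∧ (r ⊩ x =' .check s.toZF) := by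
  refine hx.isSeq_dn.imp fun r hr ⟨γ, _, hγ⟩ => ?_
  have hval : ∀ β < γ, β < t.len ∧ (r ⊩ .opair (.ord β) (.ord (t.val β)) ∈' x) := by
    intro β hβ
    have : Dn r fun r' => β < t.len ∧ (r' ⊩ .opair (.ord β) (.ord (t.val β)) ∈' x) := by
      refine (hγ.isSeq_value hβ).imp fun r' hr' ⟨n, hn⟩ => ?_
      obtain ⟨h₁, h₂⟩ := frc_opair_ord_mem_toZF (frc_subset.1 hs _ r' (hr'.trans hr) hn)
      exact ⟨h₁, hn.mem_left (frc_opair_congr (frc_refl _ _) h₂)⟩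
    obtain ⟨_, _, h, _⟩ := this.exists
    exact ⟨h, this.frc fun _ _ h => h.2⟩
  have hle : γ ≤ t.len := le_of_forall_lt fun β hβ => (hval β hβ).1
  refine ⟨t.restrict γ, t.restrict_le γ, frc_eq_toZF ?_ fun β hβ => ?_⟩
  · rwa [Node.restrict_len hle]
  · rw [Node.restrict_len hle] at hβ
    rw [Node.restrict_val hβ]
    exact (hval β hβ).2

/-! ### Trees of sequences ordered by inclusion -/

/-- The tree of the sequences `t` with `In p t` for some `p` in the generic filter. -/
noncomputable def seqTree (In : P → Node.{u} → Prop)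
    (mono : ∀ {p p' i}, p ≤ p' → In p' i → In p i)
    (down : ∀ {p i j}, Node.tree.lt i j → In p j → In p i) : NTree P Node.{u} where
  toLTree := Node.tree
  code := Node.toZF
  inj := Node.toZF_injective
  In := In
  mono := mono
  down := down

variable {In : P → Node.{u} → Prop} {mono : ∀ {p p' i}, p ≤ p' → In p' i → In p i}
  {down : ∀ {p i j}, Node.tree.lt i j → In p j → In p i}

theorem frc_isStrictIncl (hA : (seqTree In mono down).Nodes q A) :
    (q ⊩ isStrictIncl A R) ↔ (seqTree In mono down).Order q R := by
  have key : ∀ r ≤ q, ∀ z, (r ⊩ exIn A fun x => exIn A fun y =>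
      isOPair z x y ∧' subset x y ∧' not (x =' y)) ↔
      Dn r fun s => ∃ i j, Node.tree.lt i j ∧ In (Proj.π s) i ∧ In (Proj.π s) j ∧
        (s ⊩ z =' .opair (.check i.toZF) (.check j.toZF)) := by
    intro r hr z
    constructor
    · intro h
      refine (frc_exIn.1 h).bind fun r₁ hr₁ ⟨x, hx, h⟩ => (frc_exIn.1 h).bind
        fun r₂ hr₂ ⟨y, hy, h₁, h₂, h₃⟩ => ?_
      refine ((hA.le (hr₂.trans (hr₁.trans hr))).dn (hx.mono hr₂)).bind
        fun r₃ hr₃ ⟨i, hi, hxi⟩ => ?_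
      refine ((hA.le (hr₃.trans (hr₂.trans (hr₁.trans hr)))).dn (hy.mono hr₃)).imp
        fun r₄ hr₄ ⟨j, hj, hyj⟩ => ?_
      replace hxi := hxi.mono hr₄
      refine ⟨i, j, ?_, NTree.in_mono hi hr₄, hj, (Frc.mono (q := r₂)
        (frc_isOPair.1 h₁) (hr₄.trans hr₃)).trans (frc_opair_congr hxi hyj)⟩
      have h₂ := (frc_subset_congr hxi hyj).1 (Frc.mono (q := r₂) h₂ (hr₄.trans hr₃))
      rcases Node.toZF_subset.1 (frc_subset_check.1 h₂) with h | h
      · subst h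
        exact (frc_not.1 h₃ r₄ (hr₄.trans hr₃) (hxi.trans hyj.symm)).elim
      · exact h
    · refine fun h => h.frc fun s hs ⟨i, j, hij, hi, hj, hz⟩ => ?_
      have hA := hA.le (hs.trans hr)
      refine frc_exIn_of _ (hA.mem hi) (frc_exIn_of _ (hA.mem hj) (frc_and.2 ⟨frc_isOPair.2 hz,
        frc_and.2 ⟨frc_subset_check.2 (Node.toZF_subset.2 (.inr hij)), frc_not.2 fun r hr h => ?_⟩⟩))
      exact hij.1.ne (congrArg _ (Node.toZF_injective (frc_check_eq.1 h)))
  constructor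
  · exact fun h r hr z => (frc_iff.1 (h z) r hr).trans (key r hr z)
  · exact fun h z => frc_iff.2 fun r hr => (h r hr z).trans (key r hr z).symm

/-! ### Codes of conditions -/

/-- Codes mention only ordinals below `ordinalBound P`; this leaves room for all countable sequences
of the ground model. -/
theorem omega_one_le_ordinalBound (P : Type u) : (ω₁ : Ordinal.{u}) ≤ ordinalBound P := by
  rw [ordinalBound, ← Cardinal.ord_aleph, Cardinal.ord_le_ord, ← Cardinal.succ_aleph0]
  exact Order.succ_le_succ (le_max_right _ _)

/-- The code of a sequence in the ground model. -/
def Node.seqCode (P : Type u) (t : Node.{u}) : SeqCode P :=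
  {x | (x.2.1 : Ordinal.{u}) < t.len ∧ x.2.2 = t.val x.2.1}

theorem frc_seqName : q ⊩ seqName (t.seqCode P) =' .check t.toZF := by
  refine frc_ext fun z r hr => ?_
  rw [frc_mem_toZF]
  refine frc_mem_mk.trans ⟨fun h => h.imp fun s _ => ?_, fun h => h.imp fun s _ => ?_⟩
  · rintro ⟨⟨⟨p, β, n⟩, hβ, hn⟩, -, h⟩
    exact ⟨β, hβ, by rw [← show n = t.val β from hn]; exact h⟩
  · rintro ⟨β, hβ, h⟩
    refine ⟨⟨⟨Proj.π s, ToType.mk ⟨β, hβ.trans (t.len_lt.trans_le (omega_one_le_ordinalBound P))⟩,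
      t.val β⟩, ?_, ?_⟩, le_rfl, ?_⟩ <;> simp [hβ, h]

/-- The code of a countable normal tree in the ground model. -/
def JT.code (P : Type u) (u : JT.{u}) : TreeCode P := {x | ∃ t ∈ u.nodes, x.2 = t.seqCode P}

/-- The canonical name of a countable normal tree in the ground model. -/
noncomputable abbrev JT.name (P : Type u) (u : JT.{u}) : Name P := treeName (u.code P)

/-- A countable normal tree in the ground model. -/
noncomputable def JT.toNTree (P : Type u) [Preorder P] (u : JT.{u}) : NTree P Node.{u} :=
  seqTree (fun _ t => t ∈ u.nodes) (fun _ h => h) fun h h' => u.down h h'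

variable {u v : JT.{u}}

theorem frc_mem_jtName :
    (q ⊩ x ∈' u.name P) ↔ Dn q fun r => ∃ t ∈ u.nodes, r ⊩ x =' .check t.toZF := by
  refine frc_mem_mk.trans ⟨fun h => h.imp fun s _ => ?_, fun h => h.imp fun s _ => ?_⟩
  · rintro ⟨⟨⟨p, c⟩, t, ht, hc⟩, -, h⟩
    replace h : s ⊩ x =' seqName c := h
    rw [show c = _ from hc] at h
    exact ⟨t, ht, h.trans frc_seqName⟩
  · rintro ⟨t, ht, h⟩
    exact ⟨⟨⟨Proj.π s, t.seqCode P⟩, t, ht, rfl⟩, le_rfl, h.trans frc_seqName.symm⟩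

theorem JT.nodes_name : (u.toNTree P).Nodes q (u.name P) := fun _ _ _ => frc_mem_jtName

theorem frc_check_mem_jtName : (q ⊩ .check t.toZF ∈' u.name P) ↔ t ∈ u.nodes := by
  rw [frc_mem_jtName]
  refine ⟨fun h => ?_, fun h => Dn.of_forall fun _ _ => ⟨t, h, frc_refl _ _⟩⟩
  obtain ⟨_, _, s, hs, h⟩ := h.exists
  rwa [Node.toZF_injective (frc_check_eq.1 h)]

/-- Countability and normality of a ground-model tree persist to every extension, and no new
restrictions of its nodes appear. No closure of the forcing is needed here. -/
theorem frc_isJechCondition_name (q : Q) (u : JT.{u}) : q ⊩ isJechCondition (u.name P) := by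
  refine frc_and.2 ⟨?_, frc_and.2 ⟨?_, frc_and.2 ⟨?_, ?_⟩⟩⟩
  · refine frc_allIn.2 fun z r hr hz => (frc_mem_jtName.1 hz).frc fun s hs ⟨t, ht, h⟩ => ?_
    exact frc_ex_of (.ord t.len) (frc_isSeq_toZF.isSeq_congr_left h.symm)
  · refine frc_allIn.2 fun z r hr hz => frc_all.2 fun s => frc_all.2 fun α => ?_
    refine frc_imp.2 fun r₁ hr₁ hs => frc_imp.2 fun r₂ hr₂ hα => ?_
    refine (frc_mem_jtName.1 (hz.mono (hr₂.trans hr₁))).frc fun r₃ hr₃ ⟨t, ht, h⟩ => ?_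
    have hs' := (frc_subset_congr (frc_refl _ _) h).1 (hs.mono (hr₃.trans hr₂))
    refine frc_mem_jtName.2 ((frc_subset_toZF hs' (hα.mono hr₃)).imp
      fun r₄ hr₄ ⟨s', hs', h'⟩ => ⟨s', JT.down_le hs' ht, h'⟩)
  · refine frc_isCountable_of (u.countable.image Node.toZF) fun z r hr hz => ?_
    exact (frc_mem_jtName.1 hz).imp fun s hs ⟨t, ht, h⟩ => ⟨_, ⟨t, ht, rfl⟩, h⟩
  · obtain ⟨R, hR⟩ := NTree.exists_order (Q := Q) (u.toNTree P)
    have hA := JT.nodes_name (q := q) (u := u) (P := P)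
    refine frc_ex_of R (frc_and.2 ⟨(frc_isStrictIncl hA).2 (hR q),
      NTree.frc_isNormalTree hA (hR q) Node.nil u.nil_mem Node.eq_nil_or_lt ?_ ?_ ?_⟩)
    · exact fun α r hr => Dn.of_forall fun s hs => ⟨u.nodes, u.countable, fun t _ i hi _ => hi⟩
    · exact fun r hr i j hij hj => Dn.of_forall fun s hs => u.succ hij hj
    · exact fun r hr i j hi hj hij => Dn.of_forall fun s hs => u.ext hi hj hij

theorem forced_isJechCondition_name {P : Type u} [Preorder P] (u : JT.{u}) :
    Forced (isJechCondition (u.name P)) := by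
  -- The identity is a projection, which turns the statement into one about `Forces`.
  let _ : Proj P P := ⟨id, fun h => h, fun q p h => ⟨p, h, le_rfl⟩⟩
  exact fun p => frc_isJechCondition_name p u

/-- End-extension of ground-model trees is absolute, so the order of the iteration agrees with the
product order on `JSeq`. -/
theorem frc_endExtends_name : (q ⊩ endExtends (u.name P) (v.name P)) ↔ u ≤ v := by
  constructor
  · rintro ⟨h₁, h₂⟩
    have hsub : v.nodes ⊆ u.nodes := fun t ht => frc_check_mem_jtName.1
      (frc_subset.1 h₁ (.check t.toZF) q le_rfl (frc_check_mem_jtName.2 ht))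
    refine ⟨hsub, fun t ht htv s hs => ?_⟩
    have h₃ := frc_imp.1 (frc_allIn.1 h₂ _ q le_rfl (frc_check_mem_jtName.2 ht)) q le_rfl
      (frc_not.2 fun r _ h => htv (frc_check_mem_jtName.1 h))
    have h₄ := frc_allIn.1 h₃ _ q le_rfl (frc_check_mem_jtName.2 hs) (.ord s.len) (.ord t.len)
    exact frc_ord_mem.1 (frc_imp.1 (frc_imp.1 h₄ q le_rfl frc_isSeq_toZF) q le_rfl frc_isSeq_toZF)
  · intro h
    refine frc_and.2 ⟨frc_subset.2 fun z r hr hz => frc_mem_jtName.2 ((frc_mem_jtName.1 hz).imp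
      fun s hs ⟨t, ht, h'⟩ => ⟨t, h.1 ht, h'⟩), ?_⟩
    refine frc_allIn.2 fun z r hr hz => frc_imp.2 fun r₁ hr₁ hn => frc_allIn.2 fun y r₂ hr₂ hy => ?_
    refine frc_all.2 fun α => frc_all.2 fun β => ?_
    refine frc_imp.2 fun r₃ hr₃ hα => frc_imp.2 fun r₄ hr₄ hβ => ?_
    have h4 : r₄ ≤ r₂ := hr₄.trans hr₃
    refine (frc_mem_jtName.1 (hz.mono (h4.trans (hr₂.trans hr₁)))).frc fun r₅ hr₅ ⟨t, ht, hzt⟩ => ?_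
    refine (frc_mem_jtName.1 (hy.mono (hr₅.trans h4))).frc fun r₆ hr₆ ⟨s, hs, hys⟩ => ?_
    replace hzt := hzt.mono hr₆
    replace hα := hα.mono (hr₆.trans (hr₅.trans hr₄))
    replace hβ := hβ.mono (hr₆.trans hr₅)
    have hseq : ∀ {x α : Name P} {t : Node.{u}}, (r₆ ⊩ isSeq x α) → (r₆ ⊩ x =' .check t.toZF) →
        (r₆ ⊩ α =' .ord t.len) := by
      exact fun h h' => h.isSeq_unique (frc_isSeq_toZF.isSeq_congr_left h'.symm)
    have htv : t ∉ v.nodes := fun htv => frc_not.1 hn r₆ (hr₆.trans (hr₅.trans (h4.trans hr₂)))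
      (frc_mem_jtName.2 (Dn.of_forall fun _ h => ⟨t, htv, hzt.mono h⟩))
    exact ((frc_ord_mem.2 (h.2 t ht htv s hs)).mem_left (hseq hα hys).symm).mem_right
      (hseq hβ hzt).symm

end
end JechForcing

namespace JechForcing
open Fml Ordinal

/-! ### Names for conditions of Jech's forcing -/

section

variable {Q : Type w} {P : Type u} [Preorder Q] [Preorder P] [Proj Q P]
variable {q r : Q} {x y z A R α β : Name P}

/-- The restriction of a sequence exists. -/
theorem exists_restriction {γ β : Ordinal.{u}} (h : q ⊩ isSeq x (.ord γ)) (hβ : β ≤ γ) :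
    ∃ y : Name P, (q ⊩ subset y x) ∧ (q ⊩ isSeq y (.ord β)) := by
  let y : Name P := .of (K := Set.Iio β × ULift.{u} ℕ)
    (fun k => .opair (.ord k.1) (.ord (k.2.down : Ordinal.{u})))
    fun p k => Forces p (.opair (.ord k.1) (.ord (k.2.down : Ordinal.{u})) ∈' x)
  have hy : ∀ {r : Q} {z : Name P}, (r ⊩ z ∈' y) ↔ Dn r fun s => ∃ k : Set.Iio β × ULift.{u} ℕ,
      (s ⊩ .opair (.ord k.1) (.ord (k.2.down : Ordinal.{u})) ∈' x) ∧
      (s ⊩ z =' .opair (.ord k.1) (.ord (k.2.down : Ordinal.{u}))) :=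
    fun {r z} => frc_mem_of fun _ _ _ h h' => Forces.mono h' h
  have hsub : q ⊩ subset y x := frc_subset.2 fun z r hr hz =>
    (hy.1 hz).frc fun s hs ⟨k, hk, h⟩ => hk.mem_left h.symm
  refine ⟨y, hsub, frc_isSeq.2 ⟨frc_isOrdinal_of_eq_ord (frc_refl _ _),
    frc_isFunction.2 ⟨fun z r hr hz => (hy.1 hz).imp fun s hs ⟨k, hk, h⟩ => ⟨_, _,
      frc_ord_mem.2 k.1.2, frc_ord_mem.2 (natCast_lt_omega0 _), h⟩, fun z r hr hz => ?_⟩⟩⟩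
  refine (frc_mem_ord.1 hz).bind fun s hs ⟨δ, hδ, hzδ⟩ => ?_
  refine ((h.mono (hs.trans hr)).isSeq_value (hδ.trans_le hβ)).imp fun t ht ⟨n, hn⟩ =>
    ⟨.ord n, ?_, fun y' t' ht' hy' => ?_⟩
  · refine hy.2 (Dn.of_forall fun t' ht' => ⟨⟨⟨δ, hδ⟩, ⟨n⟩⟩, hn.mono ht',
      frc_opair_congr (hzδ.mono (ht'.trans ht)) (frc_refl _ _)⟩)
  · have hle : t' ≤ q := ht'.trans (ht.trans (hs.trans hr))
    refine Frc.isFunction_unique (x := .ord δ) (frc_isSeq.1 (h.mono hle)).2 ?_ (hn.mono ht')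
    exact (frc_subset.1 hsub _ t' hle hy').mem_left
      (frc_opair_congr (hzδ.mono (ht'.trans ht)) (frc_refl _ _))

/-- Countably many elements of a Jech condition can be decided at once. -/
theorem SigmaClosed.dn_nodes (hQ : SigmaClosed Q) (h : q ⊩ isJechCondition x) :
    Dn q fun r => ∃ U : Set Node.{u}, U.Countable ∧ ∀ s ≤ r, ∀ z, (s ⊩ z ∈' x) ↔
      Dn s fun s' => ∃ t ∈ U, s' ⊩ z =' .check t.toZF := by
  obtain ⟨h₁, h₂, h₃, -⟩ := h
  refine (hQ.dn_enum h₃).bind fun r hr ⟨nm, hnm⟩ => ?_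
  have hlen := hQ.dn_nat (q := r) (Φ := fun n s => (∃ γ : Ordinal.{u}, (s ⊩ nm n ∈' x) ∧
    (s ⊩ isSeq (nm n) (.ord γ))) ∨ ∀ s' ≤ s, ¬ (s' ⊩ nm n ∈' x)) ?_ ?_
  rotate_left
  · refine fun n => (dn_em r (nm n ∈' x)).bind fun s hs hn => ?_
    rcases hn with hn | hn
    · refine (frc_ex.1 (frc_allIn.1 h₁ _ s (hs.trans hr) hn)).bind fun s₁ hs₁ ⟨α, hα⟩ => ?_
      exact hα.isSeq_dn.imp fun s₂ hs₂ ⟨γ, _, hγ⟩ => .inl ⟨γ, hn.mono (hs₂.trans hs₁), hγ⟩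
    · exact Dn.of_forall fun s₁ hs₁ => .inr fun s' hs' => hn s' (hs'.trans hs₁)
  · rintro n r s hs (⟨γ, h, h'⟩ | h)
    · exact .inl ⟨γ, h.mono hs, h'.mono hs⟩
    · exact .inr fun s' hs' => h s' (hs'.trans hs)
  refine hlen.bind fun r₂ hr₂ hγ => ?_
  let D : Set ℕ := {n | ∃ γ : Ordinal.{u}, (r₂ ⊩ nm n ∈' x) ∧ (r₂ ⊩ isSeq (nm n) (.ord γ))}
  have hD : ∀ n, ∀ s ≤ r₂, (s ⊩ nm n ∈' x) → n ∈ D := fun n s hs hn =>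
    (hγ n).elim id fun h => (h s hs hn).elim
  have hmem : ∀ n : D, ∃ γ : Ordinal.{u}, (r₂ ⊩ nm n ∈' x) ∧ (r₂ ⊩ isSeq (nm n) (.ord γ)) :=
    fun n => n.2
  choose γ hγx hγ using hmem
  -- A Jech condition is not explicitly required to have nodes of countable length. Closure under
  -- restriction makes the countable set of lengths an initial segment of the ordinals, so each
  -- length is below `ω₁`.
  have hcov : ∀ n β, β ≤ γ n → β ∈ Set.range γ := by
    intro n β hβ
    obtain ⟨y, hy, hy'⟩ := exists_restriction (hγ n) hβ
    have hyx : r₂ ⊩ y ∈' x := by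
      have := frc_all.1 (frc_all.1 (frc_allIn.1 h₂ (nm n) r₂ (hr₂.trans hr) (hγx n)) y) (.ord β)
      exact frc_imp.1 (frc_imp.1 this r₂ le_rfl hy) r₂ le_rfl hy'
    obtain ⟨s, hs, m, hm, hym⟩ := (hnm y r₂ hr₂ hyx).exists
    refine ⟨⟨m, hD m s hs hm⟩, ?_⟩
    exact frc_ord_eq.1 (((hγ _).mono hs).isSeq_unique ((hy'.mono hs).isSeq_congr_left hym))
  have hlt : ∀ n, γ n < ω₁ := fun n => lt_omega_one_iff_countable_Iio.2
    ((Set.countable_range γ).mono fun β hβ => hcov n β (le_of_lt hβ))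
  have hcount : ∀ n, Countable (Set.Iio (γ n)) := fun n =>
    (lt_omega_one_iff_countable_Iio.1 (hlt n)).to_subtype
  -- All values of countably many sequences of countable length are decided at once.
  refine (hQ.dn_countable (K := Σ n : D, Set.Iio (γ n)) (Φ := fun k s => ∃ m : ℕ,
    s ⊩ .opair (.ord k.2.1) (.ord m) ∈' nm k.1) (fun k => (hγ k.1).isSeq_value k.2.2)
    fun k r s hs ⟨m, hm⟩ => ⟨m, hm.mono hs⟩).imp fun r₃ hr₃ hv => ?_
  choose v hv using hv
  classical
  let t : D → Node.{u} := fun n =>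
    ⟨γ n, fun β => if h : β < γ n then v ⟨n, β, h⟩ else 0, hlt n, fun β h => dif_neg h.not_gt⟩
  have ht : ∀ n : D, r₃ ⊩ nm n =' .check (t n).toZF := by
    refine fun n => frc_eq_toZF ((hγ n).mono hr₃) fun β hβ => ?_
    have : (t n).val β = v ⟨n, β, hβ⟩ := dif_pos hβ
    rw [this]
    exact hv ⟨n, β, hβ⟩
  refine ⟨Set.range t, Set.countable_range t, fun s hs z => ⟨fun hz => ?_, fun hz => ?_⟩⟩
  · refine (hnm z s (hs.trans (hr₃.trans hr₂)) hz).imp fun s' hs' ⟨n, hn, hzn⟩ => ?_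
    have hs'' := hs'.trans hs
    have hnD := hD n s' (hs''.trans hr₃) hn
    exact ⟨_, ⟨⟨n, hnD⟩, rfl⟩, hzn.trans ((ht ⟨n, hnD⟩).mono hs'')⟩
  · refine hz.frc fun s' hs' ⟨_, ⟨n, rfl⟩, hzn⟩ => ?_
    have hs'' := hs'.trans hs
    exact ((hγx n).mono (hs''.trans hr₃)).mem_left (((ht n).mono hs'').trans hzn.symm)

/-- A σ-closed forcing adds no conditions to Jech's forcing. -/
theorem SigmaClosed.dn_jt (hQ : SigmaClosed Q) (h : q ⊩ isJechCondition x) :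
    Dn q fun r => ∃ u : JT.{u}, r ⊩ x =' u.name P := by
  refine (hQ.dn_nodes h).bind fun r hr ⟨U, hU, hUx⟩ => ?_
  obtain ⟨-, h₂, -, h₄⟩ := Frc.mono h hr
  have hUt : ∀ t : Node.{u}, ∀ s ≤ r, (s ⊩ .check t.toZF ∈' x) ↔ t ∈ U := by
    refine fun t s hs => (hUx s hs _).trans ⟨fun h => ?_, fun h =>
      Dn.of_forall fun _ _ => ⟨t, h, frc_refl _ _⟩⟩
    obtain ⟨_, _, t', ht', h⟩ := h.exists
    rwa [Node.toZF_injective (frc_check_eq.1 h)]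
  have hdown : ∀ {s t}, Node.tree.lt s t → t ∈ U → s ∈ U := by
    intro s t hst ht
    have h₃ := frc_allIn.1 h₂ _ r le_rfl ((hUt t r le_rfl).2 ht) (.check s.toZF) (.ord s.len)
    exact (hUt s r le_rfl).1 (frc_imp.1 (frc_imp.1 h₃ r le_rfl (frc_subset_check.2
      (Node.toZF_subset.2 (.inr hst)))) r le_rfl frc_isSeq_toZF)
  -- With its nodes fixed, `x` is a constant family of trees, and each clause of its forced
  -- normality can be read back in the ground model.
  let T : NTree P Node.{u} := seqTree (fun _ t => t ∈ U) (fun _ h => h) hdown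
  have hA : T.Nodes r x := fun s hs z => hUx s hs z
  obtain ⟨r₁, hr₁, R, hR, -, hN⟩ := (frc_ex.1 h₄).exists
  obtain ⟨r₂, hr₂, h, hh, hroot, -, hsucc, hext, -⟩ := (frc_ex.1 hN).exists
  have hR : T.Order r₂ R := ((frc_isStrictIncl (hA.le hr₁)).1 hR).le hr₂
  have hr₂r := hr₂.trans hr₁
  have hA₂ := hA.le hr₂r
  have hh : T.Height r₂ h := (NTree.frc_isHeightFn hA₂ hR).1 hh
  have hpair : ∀ {s}, s ∈ U → r₂ ⊩ pairMem (.check s.toZF) (.ord s.len) h := fun {s} hs =>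
    frc_pairMem.2 (NTree.Height.mem (i := s) hh hs (frc_refl _ _) (frc_refl _ _))
  refine Dn.of_forall fun r' hr' => ⟨⟨U, hU, ?_, hdown, fun {s t} hst ht => ?_,
    fun {s t} hs ht hst => ?_⟩, NTree.Nodes.eq (T := T) (hA.le hr') JT.nodes_name⟩
  · obtain ⟨s, hs, y, hy, -⟩ := (frc_exIn.1 hroot).exists
    obtain ⟨_, _, t, ht, -⟩ := ((hUx s (hs.trans hr₂r) y).1 hy).exists
    rcases Node.eq_nil_or_lt t with rfl | hlt
    · exact ht
    · exact hdown hlt ht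
  · intro hfin
    let F : Set Node.{u} := {j | Node.tree.lt s j ∧ j.len = s.len + 1 ∧ j ∈ U}
    have hF : ∀ {j}, j ∈ F ↔ Node.tree.lt s j ∧ j.len = s.len + 1 ∧ j ∈ U := Iff.rfl
    -- The forced clause on immediate successors is applied to a name for the set `F`; were `F`
    -- finite, this name would be forced to be finite.
    let I : Name P := .of (K := F) (fun j => .check j.1.toZF) fun _ _ => True
    have hI : ∀ {r : Q} {z : Name P}, (r ⊩ z ∈' I) ↔
        Dn r fun s => ∃ j : F, True ∧ (s ⊩ z =' .check j.1.toZF) := fun {r z} =>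
      frc_mem_of fun _ _ _ _ _ => trivial
    have hs := hdown hst ht
    have h₅ := frc_imp.1 (frc_allIn.1 hsucc _ r₂ le_rfl ((hUt s _ hr₂r).2 hs)) r₂ le_rfl
      (frc_ex_of (.check t.toZF) (frc_pairMem.2
        (NTree.Order.mem (i := s) (j := t) hR hst ht (frc_refl _ _) (frc_refl _ _))))
    refine frc_not.1 (frc_imp.1 (frc_all.1 h₅ I) r₂ le_rfl (frc_all.2 fun y =>
      frc_iff.2 fun r₃ hr₃ => ⟨fun hy => ?_, fun hy => ?_⟩)) r₂ le_rfl
      (frc_isFinite_of (hfin.image Node.toZF) fun z r₃ hr₃ hz => ?_)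
    · refine (hI.1 hy).frc fun r₄ hr₄ ⟨j, _, hj⟩ => ?_
      have hR := hR.le (hr₄.trans hr₃)
      refine frc_and.2 ⟨frc_pairMem.2 (NTree.Order.mem (i := s) hR j.2.1 j.2.2.2 (frc_refl _ _) hj),
        frc_not.2 fun r₅ hr₅ hz => ?_⟩
      obtain ⟨r₆, hr₆, z, hz₁, hz₂⟩ := (frc_ex.1 hz).exists
      obtain ⟨r₇, hr₇, k, hsk, -, hzk⟩ := ((hR.le (hr₆.trans hr₅)).dn_left (i := s)
        (frc_pairMem.1 hz₁) (frc_refl _ _)).exists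
      have hkj := (hR.le (hr₇.trans (hr₆.trans hr₅))).lt_of
        ((frc_pairMem.1 hz₂).mono hr₇) hzk (hj.mono (hr₇.trans (hr₆.trans hr₅)))
      have := T.ht_lt hkj
      rw [show T.ht j.1 = T.ht s + 1 from j.2.2.1, Order.lt_add_one_iff] at this
      exact (T.ht_lt hsk).not_ge this
    · obtain ⟨hy₁, hy₂⟩ := hy
      refine hI.2 (((hR.le hr₃).dn_left (i := s) (frc_pairMem.1 hy₁) (frc_refl _ _)).imp
        fun r₄ hr₄ ⟨j, hsj, hj, hyj⟩ => ⟨⟨j, hsj, ?_, hj⟩, trivial, hyj⟩)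
      rcases (Order.add_one_le_iff.2 (T.ht_lt hsj)).eq_or_lt with h | h
      · exact h.symm
      · obtain ⟨k, hk, hk'⟩ := T.res h
        have hk'' : T.lt s k := T.cmp hsj hk ((lt_add_one _).trans_eq hk'.symm)
        have hR := hR.le (hr₄.trans hr₃)
        refine (frc_not.1 hy₂ r₄ hr₄ (frc_ex_of (.check k.toZF) (frc_and.2
          ⟨frc_pairMem.2 ?_, frc_pairMem.2 ?_⟩))).elim
        · exact NTree.Order.mem (i := s) (j := k) hR hk'' (hdown hk hj) (frc_refl _ _)
            (frc_refl _ _)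
        · exact NTree.Order.mem (i := k) (j := j) hR hk hj (frc_refl _ _) hyj
    · exact (hI.1 hz).imp fun s hs ⟨j, _, hj⟩ => ⟨_, ⟨j.1, j.2, rfl⟩, hj⟩
  · have h₅ := frc_imp.1 (hext (.check s.toZF) (.ord s.len) (.check t.toZF) (.ord t.len)) r₂ le_rfl
      (hpair hs)
    have h₆ := frc_imp.1 (frc_imp.1 h₅ r₂ le_rfl (hpair ht)) r₂ le_rfl (frc_ord_mem.2 hst)
    obtain ⟨r₃, hr₃, y, hy₁, hy₂⟩ := (frc_ex.1 h₆).exists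
    obtain ⟨r₄, hr₄, j, hsj, hj, hyj⟩ := ((hR.le hr₃).dn_left (i := s) (frc_pairMem.1 hy₁)
      (frc_refl _ _)).exists
    have := ((hh.le (hr₄.trans hr₃)).dn_code (i := j) ((frc_pairMem.1 hy₂).mono hr₄) hyj).1
    exact ⟨j, hsj, (frc_ord_eq.1 this).symm, hj⟩

end
end JechForcing

/-! ### The product inside the iteration -/

namespace JechForcing
open Fml Ordinal

section

variable {Q : Type w} {P : Type u} [Preorder Q] [Preorder P] [Proj Q P]
variable {q : Q} {x y x' y' : Name P}

theorem Frc.endExtends_congr (h : q ⊩ endExtends x y) (hx : q ⊩ x =' x') (hy : q ⊩ y =' y') :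
    q ⊩ endExtends x' y' := by
  refine frc_and.2 ⟨(frc_subset_congr hy hx).1 (frc_and.1 h).1, frc_allIn.2 fun t r hr ht =>
    frc_imp.2 fun r₁ hr₁ hn => frc_allIn.2 fun s r₂ hr₂ hs => ?_⟩
  have h₁ := frc_allIn.1 (frc_and.1 h).2 t r hr (ht.mem_right (hx.mono hr).symm)
  have h₂ := frc_imp.1 h₁ r₁ hr₁ (frc_not.2 fun s hs hts => frc_not.1 hn s hs
    (hts.mem_right (hy.mono (hs.trans (hr₁.trans hr)))))
  exact frc_allIn.1 h₂ s r₂ hr₂ (hs.mem_right (hy.mono (hr₂.trans (hr₁.trans hr))).symm)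

end

/-! ### A dense subset of the iteration -/

/-- The condition of length `n` with the given coordinates. -/
noncomputable def stageProj : ∀ n, JSeq.{u} → jechStage.{u} n
  | 0, _ => PUnit.unit
  | n + 1, q => (stageProj n q, ⟨(q n).code _, forced_isJechCondition_name (q n)⟩)

theorem stageProj_congr : ∀ {n : ℕ} {q r : JSeq.{u}}, (∀ i < n, q i = r i) →
    stageProj n q = stageProj n r
  | 0, _, _, _ => rfl
  | n + 1, q, r, h => by
    have h₁ := stageProj_congr (n := n) fun i hi => h i (hi.trans n.lt_succ_self)
    simp only [stageProj, h₁, h n n.lt_succ_self]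
    rfl

theorem stage_le_iff {n : ℕ} {p p' : jechStage.{u} (n + 1)} : p ≤ p' ↔
    jechInit p ≤ jechInit p' ∧ Forces (jechInit p) (endExtends (jechLast p) (jechLast p')) := Iff.rfl

section

open Function

/-- By σ-closure of `JSeq`, the last coordinate of `p` is forced by some `r` to be a ground-model
tree `u`, which replaces coordinate `n` without affecting the earlier stages. The final clause keeps
`u` below every ground-model tree that the last coordinate end-extends, as the lifting property of
projections requires. -/
theorem exists_stageProj_le {n : ℕ} [Proj JSeq.{u} (jechStage.{u} n)]
    (hπ : ∀ q : JSeq.{u}, (Proj.π q : jechStage.{u} n) = stageProj n q) (s : JSeq.{u})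
    (p : jechStage.{u} (n + 1)) (hs : stageProj n s ≤ jechInit p) :
    ∃ r ≤ s, ∃ u : JT.{u}, stageProj (n + 1) (update r n u) ≤ p ∧
      ∀ v : JT.{u}, Forces (jechInit p) (endExtends (jechLast p) (v.name _)) → u ≤ v := by
  have hp : s ⊩ isJechCondition (jechLast p) := p.2.2 _
  obtain ⟨r, hr, u, hu⟩ := (JSeq.sigmaClosed.dn_jt hp).exists
  have hr' : stageProj n r ≤ jechInit p := by
    rw [← hπ] at hs ⊢
    exact (Proj.mono hr).trans hs
  have hr'' : stageProj n (update r n u) = stageProj n r := stageProj_congr fun i hi => by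
    rw [update_of_ne hi.ne]
  refine ⟨r, hr, u, stage_le_iff.2 ⟨?_, ?_⟩, fun v hv => ?_⟩
  · exact hr''.trans_le hr'
  · have h : r ⊩ endExtends (u.name (jechStage.{u} n)) (jechLast p) :=
      Frc.endExtends_congr (frc_endExtends_name.2 le_rfl) (frc_refl _ _) hu.symm
    rw [Frc, hπ, ← hr''] at h
    refine Eq.mp ?_ h
    simp only [stageProj, jechInit, jechLast, update_self]
  · have hv : r ⊩ endExtends (jechLast p) (v.name _) := by
      rw [Frc, hπ]
      exact Forces.mono hv hr'
    exact frc_endExtends_name.1 (hv.endExtends_congr hu (frc_refl _ _))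

/-- Induction on `n`: once `JSeq` projects to stage `n`, names for conditions over that stage can be
evaluated with `JSeq`, and this yields the projection to the next stage. -/
theorem stageProj_spec : ∀ n, (∀ {q r : JSeq.{u}}, q ≤ r → stageProj n q ≤ stageProj n r) ∧
    ∀ (q : JSeq.{u}) (p : jechStage.{u} n), p ≤ stageProj n q → ∃ r ≤ q, stageProj n r ≤ p
  | 0 => ⟨fun _ => le_rfl, fun q p _ => ⟨q, le_rfl, trivial⟩⟩
  | n + 1 => by
    have ih := stageProj_spec n
    let _ : Proj JSeq.{u} (jechStage.{u} n) := ⟨stageProj n, ih.1, ih.2⟩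
    refine ⟨fun {q r} h => stage_le_iff.2 ⟨ih.1 h, ?_⟩, fun q p hp => ?_⟩
    · exact (frc_endExtends_name (q := q) (P := jechStage.{u} n)).2 (h n)
    · obtain ⟨s, hs, hsp⟩ := ih.2 q (jechInit p) (stage_le_iff.1 hp).1
      obtain ⟨r, hr, u, hu, huv⟩ := exists_stageProj_le (fun _ => rfl) s p hsp
      refine ⟨update r n u, fun i => ?_, hu⟩
      rcases eq_or_ne i n with rfl | hi
      · rw [update_self]
        exact huv _ (stage_le_iff.1 hp).2
      · rw [update_of_ne hi]
        exact (hr i).trans (hs i)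

noncomputable instance stage.instProj (n : ℕ) : Proj JSeq.{u} (jechStage.{u} n) :=
  ⟨stageProj n, (stageProj_spec n).1, (stageProj_spec n).2⟩

/-- The condition of the iteration with the given coordinates. -/
noncomputable def iterProj (q : JSeq.{u}) : JechIteration.{u} := ⟨fun n => stageProj n q, fun _ => rfl⟩

theorem iterProj_le_iff {q r : JSeq.{u}} : iterProj q ≤ iterProj r ↔ q ≤ r :=
  ⟨fun h n => (frc_endExtends_name (q := q) (P := jechStage.{u} n)).1 (stage_le_iff.1 (h (n + 1))).2,
    fun h n => (stageProj_spec n).1 h⟩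

/-- Evaluating coordinate `n` to a ground-model tree strengthens the earlier coordinates. So each
coordinate runs through a descending sequence of trees with a lower bound, and full support admits
the limit of all coordinates. -/
theorem exists_iterProj_le (p : JechIteration.{u}) : ∃ r : JSeq.{u}, iterProj r ≤ p ∧
    ∀ q, p ≤ iterProj q → r ≤ q := by
  have step : ∀ n (s : JSeq.{u}), stageProj n s ≤ p.1 n → ∃ t : JSeq.{u},
      stageProj (n + 1) t ≤ p.1 (n + 1) ∧ (∀ i < n, t i ≤ s i) ∧
      ∀ q, p ≤ iterProj q → t n ≤ q n := by
    intro n s hs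
    obtain ⟨r, hr, u, hu, huv⟩ := exists_stageProj_le (fun _ => rfl) s (p.1 (n + 1))
      (hs.trans_eq (p.2 n).symm)
    refine ⟨update r n u, hu, fun i hi => ?_, fun q hq => ?_⟩
    · rw [update_of_ne hi.ne]
      exact hr i
    · rw [update_self]
      exact huv _ (stage_le_iff.1 (hq (n + 1))).2
  choose! f hf hfs hfq using step
  let s : ℕ → JSeq.{u} := fun n => Nat.rec (fun _ => JT.single) (fun n t => f n t) n
  have hs : ∀ n, stageProj n (s n) ≤ p.1 n := by
    intro n
    induction n with
    | zero => trivial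
    | succ n ih => exact hf n _ ih
  have hanti : ∀ i m n, i < m → m ≤ n → s n i ≤ s m i := by
    intro i m n hi hmn
    induction n, hmn using Nat.le_induction with
    | base => exact le_rfl
    | succ n hn ih => exact (hfs n _ (hs n) i (hi.trans_le hn)).trans ih
  -- Coordinate `i` is settled at stage `i + 1` and only descends from there on.
  choose r _ hr using fun i => JT.exists_iUnion (fun n => s (n + i + 1) i)
    fun m n h => hanti i (m + i + 1) (n + i + 1) (by omega) (by omega)
  have hr' : ∀ i n, i < n → r i ≤ s n i := fun i n hi => by
    have := hr i (n - i - 1)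
    rwa [show n - i - 1 + i + 1 = n by omega] at this
  refine ⟨r, fun n => ?_, fun q hq n => (hr' n (n + 1) n.lt_succ_self).trans (hfq n _ (hs n) q hq)⟩
  classical
  refine le_trans ?_ (hs n)
  -- Comparison in `JSeq` involves all coordinates, whereas `stageProj n` reads only those below
  -- `n`; the others are borrowed from `s n`.
  have h : (fun i => if i < n then r i else s n i) ≤ s n := fun i => by
    dsimp only
    split_ifs with hi
    · exact hr' i n hi
    · exact le_rfl
  refine le_trans (le_of_eq ?_) ((stageProj_spec n).1 h)
  exact stageProj_congr fun i hi => (if_pos hi).symm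

noncomputable instance iteration.instProj : Proj JSeq.{u} JechIteration.{u} where
  π := iterProj
  mono := iterProj_le_iff.2
  lift q p hp := let ⟨r, hr, hrq⟩ := exists_iterProj_le p; ⟨r, hrq q hp, hr⟩

/-- The copy of `JSeq` is dense in the iteration. -/
theorem forced_of_frc {φ : Fml (Name JechIteration.{u})} (h : ∀ q : JSeq.{u}, q ⊩ φ) :
    Forced φ := fun _ => Forces.of_dense fun p _ =>
  let ⟨r, hr, _⟩ := exists_iterProj_le p; ⟨_, hr, h r⟩

end

/-! ### Reinterpretation of names -/

section Lift

variable {Q : Type w} {P P' : Type u} [Preorder Q] [Preorder P] [Preorder P'] [Proj Q P]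
  [Proj Q P'] {f : P' → P} {q : Q}

/-- Since `Q` projects to both forcings compatibly with `f`, a name and its lift are evaluated alike
by conditions in `Q`. -/
theorem frc_mem_lift (hf : Monotone f) (hfq : ∀ q : Q, f (Proj.π q) = Proj.π q) {x : Name P'}
    {ι : Type u} {a : ι → Name P} {c : ι → P} :
    (q ⊩ x ∈' .lift f (.mk ι a c)) ↔
      Dn q fun r => ∃ i, (Proj.π r : P) ≤ c i ∧ (r ⊩ x =' .lift f (a i)) := by
  refine frc_mem_mk.trans ⟨fun h => h.imp fun r _ => ?_, fun h => h.imp fun r _ => ?_⟩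
  · rintro ⟨⟨⟨i, p⟩, hi⟩, hr, h⟩
    exact ⟨i, (hfq r).symm.trans_le ((hf hr).trans hi), h⟩
  · rintro ⟨i, hi, h⟩
    exact ⟨⟨⟨i, Proj.π r⟩, (hfq r).trans_le hi⟩, le_rfl, h⟩

theorem Frc.eq_lift (hf : Monotone f) (hfq : ∀ q : Q, f (Proj.π q) = Proj.π q) {x y : Name P}
    (h : q ⊩ x =' y) : q ⊩ .lift f x =' .lift f y := by
  induction x generalizing y q with
  | mk ι a c ih =>
  cases y with
  | mk κ b d =>
  refine frc_ext fun z r hr => ?_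
  rw [frc_mem_lift hf hfq, frc_mem_lift hf hfq]
  have h := frc_eq_mk.1 (h.mono hr)
  refine ⟨fun hz => hz.bind fun s hs ⟨i, hi, hz⟩ => ?_, fun hz => hz.bind fun s hs ⟨j, hj, hz⟩ => ?_⟩
  · exact (frc_mem_mk.1 (h.1 i s hs hi)).imp fun t ht ⟨j, hj, e⟩ =>
      ⟨j, hj, (hz.mono ht).trans (ih i e)⟩
  · exact (frc_mem_mk.1 (h.2 j s hs hj)).imp fun t ht ⟨i, hi, e⟩ =>
      ⟨i, hi, (hz.mono ht).trans (ih i e.symm).symm⟩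

theorem Frc.mem_lift (hf : Monotone f) (hfq : ∀ q : Q, f (Proj.π q) = Proj.π q) {x y : Name P}
    (h : q ⊩ x ∈' y) : q ⊩ .lift f x ∈' .lift f y := by
  cases y
  exact (frc_mem_lift hf hfq).2 ((frc_mem_mk.1 h).imp fun r _ ⟨i, hi, e⟩ =>
    ⟨i, hi, e.eq_lift hf hfq⟩)

theorem frc_lift_ofPSet (hf : Monotone f) (hfq : ∀ q : Q, f (Proj.π q) = Proj.π q)
    (X : PSet.{u}) (q : Q) : q ⊩ .lift f (.ofPSet X) =' .ofPSet X := by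
  induction X generalizing q with
  | mk ι a ih =>
  refine frc_ext fun z r hr => (frc_mem_lift hf hfq).trans (Iff.trans ?_ frc_mem_mk.symm)
  refine ⟨fun h => h.imp fun s _ => ?_, fun h => h.imp fun s _ => ?_⟩
  · rintro ⟨⟨i, p⟩, -, h⟩
    exact ⟨⟨i, Proj.π s⟩, le_rfl, h.trans (ih i s)⟩
  · rintro ⟨⟨i, p⟩, -, h⟩
    exact ⟨⟨i, Proj.π s⟩, le_rfl, h.trans (ih i s).symm⟩

theorem dn_mem_lift (hf : Monotone f) (hfq : ∀ q : Q, f (Proj.π q) = Proj.π q) {x : Name P'}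
    {y : Name P} (h : q ⊩ x ∈' .lift f y) :
    Dn q fun r => ∃ z : Name P, (r ⊩ z ∈' y) ∧ (r ⊩ x =' .lift f z) := by
  cases y
  exact ((frc_mem_lift hf hfq).1 h).imp fun r _ ⟨i, hi, e⟩ => ⟨_, frc_mem_mk.2
    (Dn.of_forall fun s hs => ⟨i, (Proj.mono hs).trans hi, frc_refl _ _⟩), e⟩

theorem frc_lift_check (hf : Monotone f) (hfq : ∀ q : Q, f (Proj.π q) = Proj.π q)
    (X : ZFSet.{u}) (q : Q) : q ⊩ .lift f (.check X) =' .check X := frc_lift_ofPSet hf hfq _ _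

end Lift

end JechForcing

/-! ### Top levels and the generic trees -/

namespace JechForcing
open Fml Ordinal

namespace JT

variable {u v : JT.{u}} {s t : Node.{u}} {α β : Ordinal.{u}}

/-- The levels of the generic tree up to the top of a condition are settled by that condition, which
is why they are countable. -/
theorem Top.mem_of_le (h : u.Top β) (hv : v ≤ u) (ht : t ∈ v.nodes) (hα : t.len ≤ β) :
    t ∈ u.nodes := by
  obtain ⟨⟨s, hs, rfl⟩, -⟩ := h
  exact JT.mem_of_le hv ht hs hα

theorem Top.exists_lt (h : u.Top β) (hs : s ∈ u.nodes) (hα : s.len < α) (hαβ : α ≤ β) :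
    ∃ j, Node.tree.lt s j ∧ j.len = α ∧ j ∈ u.nodes := by
  obtain ⟨y, hy, hsy, rfl⟩ := h.ext hs
  obtain ⟨j, hj, rfl⟩ := LTree.exists_le (T := Node.tree) (y := y) hαβ
  refine ⟨j, ?_, rfl, JT.down_le hj hy⟩
  rcases LTree.le_of_le_of_le hsy hj hα.le with rfl | h
  · exact absurd hα (lt_irrefl _)
  · exact h

theorem Top.infinite_succ (h : u.Top β) (hs : s ∈ u.nodes) (hβ : s.len < β) :
    {j | Node.tree.lt s j ∧ j.len = s.len + 1 ∧ j ∈ u.nodes}.Infinite := by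
  obtain ⟨j, hj, _, hj'⟩ := h.exists_lt hs hβ le_rfl
  exact u.succ hj hj'

end JT

/-! ### The generic trees -/

/-- `p` forces `t` to be a node of the `n`-th generic tree. -/
def GenIn (n : ℕ) (p : JechIteration.{u}) (t : Node.{u}) : Prop :=
  ∃ s : JSeq.{u}, p ≤ iterProj s ∧ t ∈ (s n).nodes

theorem GenIn.mono {n : ℕ} {p p' : JechIteration.{u}} {t : Node.{u}} (h : p ≤ p') :
    GenIn n p' t → GenIn n p t := fun ⟨s, hs, ht⟩ => ⟨s, h.trans hs, ht⟩

theorem GenIn.down {n : ℕ} {p : JechIteration.{u}} {s t : Node.{u}} (h : Node.tree.lt s t) :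
    GenIn n p t → GenIn n p s := fun ⟨r, hr, ht⟩ => ⟨r, hr, (r n).down h ht⟩

/-- The `n`-th generic tree. -/
noncomputable def genTree (n : ℕ) : NTree JechIteration.{u} Node.{u} :=
  seqTree (GenIn n) GenIn.mono GenIn.down

theorem genTree_in {n : ℕ} {q : JSeq.{u}} {t : Node.{u}} :
    (genTree n).In (Proj.π q) t ↔ t ∈ (q n).nodes :=
  ⟨fun ⟨_, hs, ht⟩ => (iterProj_le_iff.1 hs n).1 ht, fun ht => ⟨q, le_rfl, ht⟩⟩

section

variable {q : JSeq.{u}} {A R x y z : Name JechIteration.{u}} {n : ℕ}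

theorem frc_lift_mem_genericFilterName (q : JSeq.{u}) (n : ℕ) :
    q ⊩ .lift (fun r : JechIteration.{u} => r.1 n) ((q n).name (jechStage.{u} n)) ∈'
      genericFilterName n :=
  frc_mem_mk.2 (Dn.of_forall fun _ hr => ⟨iterProj q, Proj.mono hr, frc_refl _ _⟩)

/-- A member of the filter is coordinate `n` of some `p` in the generic filter. A condition below
`p` end-extends it, so its nodes occur in the ground-model tree of that condition. -/
theorem dn_mem_of_mem_genericFilterName (hx : q ⊩ x ∈' genericFilterName n) (hz : q ⊩ z ∈' x) :
    Dn q fun r => ∃ t ∈ (r n).nodes, r ⊩ z =' .check t.toZF := by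
  have hf : Monotone fun r : JechIteration.{u} => r.1 n := fun _ _ h => h n
  have hfq : ∀ q : JSeq.{u}, (Proj.π q : JechIteration.{u}).1 n = Proj.π q := fun _ => rfl
  refine (frc_mem_mk.1 hx).bind fun r hr ⟨p, hp, h⟩ => ?_
  refine (dn_mem_lift hf hfq ((hz.mono hr).mem_right h)).bind fun s hs ⟨z', hz', h'⟩ => ?_
  have hext : s ⊩ endExtends ((s n).name (jechStage.{u} n)) (jechLast (p.1 (n + 1))) :=
    (stage_le_iff.1 ((le_trans (Proj.mono hs) hp : iterProj s ≤ p) (n + 1))).2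
  refine (frc_mem_jtName.1 (frc_subset.1 (frc_and.1 hext).1 z' s le_rfl hz')).imp
    fun s' hs' ⟨t, ht, e⟩ => ⟨t, (hs' n).1 ht, ?_⟩
  exact ((h'.mono hs').trans (e.eq_lift hf hfq)).trans (frc_lift_check hf hfq _ _)

theorem frc_isUnionTree (hA : (genTree n).Nodes q A) (hR : (genTree n).Order q R)
    (hx : q ⊩ x =' .opair A R) : q ⊩ isUnionTree x (genericFilterName n) := by
  have hf : Monotone fun r : JechIteration.{u} => r.1 n := fun _ _ h => h n
  have hfq : ∀ q : JSeq.{u}, (Proj.π q : JechIteration.{u}).1 n = Proj.π q := fun _ => rfl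
  refine frc_ex_of A (frc_ex_of R (frc_and.2 ⟨frc_isOPair.2 hx, frc_and.2
    ⟨frc_all.2 fun z => frc_iff.2 fun r hr => ⟨fun hz => ?_, fun hz => ?_⟩,
      (frc_isStrictIncl (In := GenIn n) (mono := GenIn.mono) (down := GenIn.down) hA).2 hR⟩⟩))
  · refine ((hA.le hr).dn hz).frc fun s hs ⟨t, ht, e⟩ => ?_
    refine frc_exIn_of _ (frc_lift_mem_genericFilterName s n) (Frc.mem_left ?_
      ((frc_lift_check hf hfq t.toZF s).trans e.symm))
    exact Frc.mem_lift hf hfq (frc_check_mem_jtName.2 (genTree_in.1 ht))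
  · refine (hA r hr z).2 ((frc_exIn.1 hz).bind fun s hs ⟨y, hy, hzy⟩ => ?_)
    exact (dn_mem_of_mem_genericFilterName hy hzy).imp fun s' _ ⟨t, ht, e⟩ =>
      ⟨t, genTree_in.2 ht, e⟩

/-- The tree `S` is auxiliary: the preimage in `S × T_n` of an antichain of `T_n` is an antichain,
so the bound for products applies with `e = {n}`. -/
theorem frc_isSuslin_genTree {σ : Type w} (S : SuslinTree.{u} σ) (hA : (genTree n).Nodes q A)
    (hR : (genTree n).Order q R) (hx : q ⊩ x =' .opair A R) : q ⊩ isSuslin x := by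
  have hin : ∀ {r : JSeq.{u}} {t}, (genTree n).In (Proj.π r) t ↔ t ∈ (r n).nodes := genTree_in
  refine NTree.frc_isSuslin JSeq.sigmaClosed hA hR Node.nil (hin.2 (q n).nil_mem)
    Node.eq_nil_or_lt (fun t => t.len_lt) ?_ ?_ ?_ ?_ hx
  · intro α r _ s _
    rcases lt_or_ge α ω₁ with hα | hα
    · obtain ⟨s', hs', β, hβ, h⟩ := s.exists_top α hα
      refine ⟨s', hs', (s' n).nodes, (s' n).countable, fun t ht i hi hiα => ?_⟩
      exact (h n).mem_of_le (ht n) (hin.1 hi) ((le_of_eq hiα).trans hβ)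
    · exact ⟨s, le_rfl, ∅, Set.countable_empty, fun t _ i _ hi =>
        absurd i.len_lt (hi.symm ▸ hα).not_gt⟩
  · intro r _ t ht s hs
    obtain ⟨s', hs', β, hβ, h⟩ := s.exists_top _ (add_one_lt_omega_one t.len_lt)
    refine ⟨s', hs', ?_⟩
    simp only [hin]
    exact (h n).infinite_succ ((hs'.trans hs n).1 (hin.1 ht)) ((lt_add_one _).trans_le hβ)
  · intro r _ t α hα ht hlt s hs
    obtain ⟨s', hs', β, hβ, h⟩ := s.exists_top α hα
    simp only [hin]
    exact ⟨s', hs', (h n).exists_lt ((hs'.trans hs n).1 (hin.1 ht)) hlt hβ⟩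
  · intro B r _ hB hB' s hs
    let C : AntichainName S {n} :=
      -- Membership is confined to conditions below `s`, where `B` is known to be an antichain of
      -- nodes.
      { mem := fun q x => q ≤ s ∧ (q ⊩ .check (x.1.2 ⟨n, Finset.mem_singleton_self n⟩).toZF ∈' B)
        mono := fun h h' => ⟨h.trans h'.1, h'.2.mono h⟩
        anti := fun {q x y} hx hy hxy => hB q (hx.1.trans hs) _ _ hx.2 hy.2 (hxy.2 _)
        node := fun {q x} hx => (hB' q (hx.1.trans hs) _ hx.2).imp fun t _ ht i => by
          obtain ⟨i, hi⟩ := i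
          obtain rfl := Finset.mem_singleton.1 hi
          exact hin.1 ht }
    obtain ⟨s', hs', γ, hγ, h⟩ := C.exists_bound s
    refine ⟨s', hs', γ, hγ, fun t ht i hi => ?_⟩
    -- A node of `S` of the same height completes `i` to a node of the product.
    obtain ⟨a, ha⟩ := S.exists_ht i.len_lt
    have := h t ht ⟨(a, fun _ => i), fun _ => ha.symm⟩ ⟨ht.trans hs', hi⟩
    rwa [← show (genTree n).ht i = S.ht a from ha.symm] at this

end

/-- The names `A n`, `R n` and `T` are interpreted by the sets of nodes and the orders of the generic
trees, and the sequence of these trees. -/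
structure GenericTrees (A R : ℕ → Name JechIteration.{u}) (T : Name JechIteration.{u}) : Prop where
  nodes : ∀ n (q : JSeq.{u}), (genTree n).Nodes q (A n)
  order : ∀ n (q : JSeq.{u}), (genTree n).Order q (R n)
  mem_iff : ∀ (q : JSeq.{u}) z, (q ⊩ z ∈' T) ↔
    Dn q fun r => ∃ n : ℕ, r ⊩ z =' .opair (.ord n) (.opair (A n) (R n))

theorem exists_genericTrees : ∃ (A R : ℕ → Name JechIteration.{u}) (T : Name JechIteration.{u}),
    GenericTrees A R T := by
  choose A hA using fun n => NTree.exists_nodes (Q := JSeq.{u}) (genTree n)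
  choose R hR using fun n => NTree.exists_order (Q := JSeq.{u}) (genTree n)
  refine ⟨A, R, .of (fun n : ℕ => .opair (.ord n) (.opair (A n) (R n))) fun _ _ => True,
    hA, hR, fun q z => (frc_mem_of fun _ _ _ _ _ => trivial).trans ?_⟩
  simp only [true_and]

namespace GenericTrees

variable {A R : ℕ → Name JechIteration.{u}} {T : Name JechIteration.{u}} {q : JSeq.{u}}
  {x y : Name JechIteration.{u}} {n : ℕ}

theorem opair_mem (hT : GenericTrees A R T) (hx : q ⊩ x =' .ord n) :
    (q ⊩ .opair x y ∈' T) ↔ (q ⊩ y =' .opair (A n) (R n)) := by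
  rw [hT.mem_iff]
  refine ⟨fun h => h.frc fun r hr ⟨m, h⟩ => ?_, fun h => Dn.of_forall fun r hr =>
    ⟨n, frc_opair_congr (hx.mono hr) (h.mono hr)⟩⟩
  obtain ⟨h₁, h₂⟩ := frc_opair_inj.1 h
  have := frc_ord_eq.1 ((hx.mono hr).symm.trans h₁)
  obtain rfl : n = m := by simpa using this
  exact h₂

theorem isOmegaSequence (hT : GenericTrees A R T) (q : JSeq.{u}) : q ⊩ isOmegaSequence T := by
  let Y : Name JechIteration.{u} := .of (fun n : ℕ => .opair (A n) (R n)) fun _ _ => True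
  have hY : ∀ (r : JSeq.{u}) n, r ⊩ .opair (A n) (R n) ∈' Y := fun r n =>
    (frc_mem_of fun _ _ _ _ _ => trivial).2 (Dn.of_forall fun _ _ => ⟨n, trivial, frc_refl _ _⟩)
  refine frc_ex_of (.ord ω) (frc_and.2 ⟨frc_isOmega.2 (frc_refl _ _), frc_ex_of Y
    (frc_isFunction.2 ⟨fun z r hr hz => ?_, fun z r hr hz => ?_⟩)⟩)
  · exact ((hT.mem_iff r z).1 hz).imp fun s hs ⟨n, h⟩ => ⟨_, _,
      frc_ord_mem.2 (natCast_lt_omega0 n), hY s n, h⟩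
  · exact (frc_mem_omega.1 hz).imp fun s hs ⟨n, h⟩ => ⟨.opair (A n) (R n),
      (hT.opair_mem h).2 (frc_refl _ _), fun y t ht hy => (hT.opair_mem (h.mono ht)).1 hy⟩

theorem isGenericTreeSequence (hT : GenericTrees A R T) : IsGenericTreeSequence T :=
  ⟨forced_of_frc hT.isOmegaSequence, fun n => forced_of_frc fun q =>
    frc_ex_of (.opair (A n) (R n)) (frc_and.2 ⟨frc_pairMem.2 ((hT.opair_mem (frc_refl _ _)).2
      (frc_refl _ _)), frc_isUnionTree (hT.nodes n q) (hT.order n q) (frc_refl _ _)⟩)⟩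

theorem allSuslin {σ : Type w} (S : SuslinTree.{u} σ) (hT : GenericTrees A R T) (q : JSeq.{u}) :
    q ⊩ allSuslin T := by
  refine frc_all.2 fun i => frc_all.2 fun x => frc_imp.2 fun r hr h => ?_
  refine ((hT.mem_iff r _).1 (frc_pairMem.1 h)).frc fun s hs ⟨n, h⟩ => ?_
  exact frc_isSuslin_genTree S (hT.nodes n s) (hT.order n s) (frc_opair_inj.1 h).2

end GenericTrees

end JechForcing

namespace JechForcing
open Fml Ordinal

/-! ### Nodes and heights of trees in generic extensions -/

section

variable {Q : Type w} {P : Type u} [Preorder Q] [Preorder P] [Proj Q P]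
variable {q : Q} {x y z α A R X T S f Y : Name P} {ι : Type w'}

theorem frc_treeLt (hX : q ⊩ X =' .opair A R) :
    (q ⊩ treeLt X x y) ↔ (q ⊩ .opair x y ∈' R) := by
  refine frc_ex.trans ⟨fun h => h.frc fun r hr ⟨A', h⟩ => ?_, fun h => Dn.of_forall fun r hr =>
    ⟨A, frc_ex_of R (frc_and.2 ⟨frc_isOPair.2 (hX.mono hr), frc_pairMem.2 (h.mono hr)⟩)⟩⟩
  refine (frc_ex.1 h).frc fun s hs ⟨R', h₁, h₂⟩ => ?_
  have h := (hX.mono (hs.trans hr)).symm.trans (frc_isOPair.1 h₁)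
  exact (frc_pairMem.1 h₂).mem_right (frc_opair_inj.1 h).2.symm

theorem NTree.frc_nodeHeight [Small.{u} ι] {T : NTree P ι} (hA : T.Nodes q A) (hR : T.Order q R)
    (hX : q ⊩ X =' .opair A R) : (q ⊩ nodeHeight X x α) ↔
      Dn q fun s => ∃ i, T.In (Proj.π s) i ∧ (s ⊩ x =' .check (T.code i)) ∧
        (s ⊩ α =' .ord (T.ht i)) := by
  obtain ⟨h, hh⟩ := exists_height (Q := Q) T
  constructor
  · refine fun k => (frc_ex.1 k).bind fun r₁ hr₁ ⟨A', k⟩ => (frc_ex.1 k).bind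
      fun r₂ hr₂ ⟨R', k₁, k⟩ => (frc_ex.1 k).bind fun r₃ hr₃ ⟨h', k₂, k₃⟩ => ?_
    have hr₃q := hr₃.trans (hr₂.trans hr₁)
    have k := frc_opair_inj.1 ((hX.mono hr₃q).symm.trans
      (Frc.mono (q := r₂) (frc_isOPair.1 k₁) hr₃))
    have hA' : T.Nodes r₃ A' := fun s hs z =>
      (frc_mem_right (k.1.mono hs)).symm.trans (hA.le hr₃q s hs z)
    have hR' : T.Order r₃ R' := fun s hs z =>
      (frc_mem_right (k.2.mono hs)).symm.trans (hR.le hr₃q s hs z)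
    exact ((frc_isHeightFn hA' hR').1 k₂).dn (frc_pairMem.1 k₃)
  · refine fun k => k.frc fun s hs ⟨i, hi, hx, hα⟩ => ?_
    refine frc_ex_of A (frc_ex_of R (frc_and.2 ⟨frc_isOPair.2 (hX.mono hs), frc_ex_of h
      (frc_and.2 ⟨(frc_isHeightFn (hA.le hs) (hR.le hs)).2 (hh s), frc_pairMem.2 ?_⟩)⟩))
    exact (hh s).mem hi hx hα

/-! ### Finite sequences of nodes -/

variable {e : Finset ℕ} {t : e → Node.{u}}

/-- The name `x` is interpreted by the finite set `e`. -/
def EqFinset (q : Q) (x : Name P) (e : Finset ℕ) : Prop :=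
  ∀ r ≤ q, ∀ z, (r ⊩ z ∈' x) ↔ Dn r fun s => ∃ i : e, s ⊩ z =' .ord (i : ℕ)

theorem EqFinset.le {r : Q} (h : EqFinset q x e) (hr : r ≤ q) : EqFinset r x e :=
  fun s hs => h s (hs.trans hr)

theorem EqFinset.mem (h : EqFinset q x e) (i : e) : q ⊩ .ord (i : ℕ) ∈' x :=
  (h q le_rfl _).2 (Dn.of_forall fun _ _ => ⟨i, frc_refl _ _⟩)

/-- By σ-closure, membership of every natural number is decided; an infinite set of accepted numbers
would contradict finiteness. Hence only products over finite sets `e` of the ground model have to be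
considered. -/
theorem SigmaClosed.dn_eqFinset (hQ : SigmaClosed Q) (h : q ⊩ subset x (.ord ω))
    (hfin : q ⊩ isFinite x) : Dn q fun r => ∃ e : Finset ℕ, EqFinset r x e := by
  refine (hQ.dn_nat (Φ := fun (n : ℕ) r => (r ⊩ .ord n ∈' x) ∨ ∀ s ≤ r, ¬ (s ⊩ .ord n ∈' x))
    (fun n => dn_em q (.ord n ∈' x)) ?_).imp fun r hr hd => ?_
  · rintro n r s hs (h | h)
    · exact .inl (h.mono hs)
    · exact .inr fun s' hs' => h s' (hs'.trans hs)
  · have hE : {n : ℕ | r ⊩ .ord (n : Ordinal.{u}) ∈' x}.Finite := by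
      by_contra hinf
      refine not_frc_isFinite_of (q := r) (P := P) (x := x) (Set.Infinite.image (f := fun n : ℕ =>
        toZFSet (n : Ordinal.{u})) (fun m _ n _ h => ?_) hinf) ?_ (hfin.mono hr)
      · simpa using toZFSet_injective h
      · rintro _ ⟨n, hn, rfl⟩
        exact hn
    refine ⟨hE.toFinset, fun s hs z => ⟨fun hz => ?_, fun hz => hz.frc fun s' hs' ⟨i, hi⟩ => ?_⟩⟩
    · refine (frc_mem_omega.1 (frc_subset.1 h z s (hs.trans hr) hz)).imp fun s' hs' ⟨n, hn⟩ => ?_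
      refine ⟨⟨n, hE.mem_toFinset.2 ((hd n).resolve_right fun h => ?_)⟩, hn⟩
      exact h s' (hs'.trans hs) ((hz.mono hs').mem_left hn)
    · have : r ⊩ .ord ((i : ℕ) : Ordinal.{u}) ∈' x := hE.mem_toFinset.1 i.2
      exact (this.mono (hs'.trans hs)).mem_left hi.symm

/-- The function `t` as a set of ordered pairs. -/
noncomputable def graph (t : e → Node.{u}) : ZFSet.{u} :=
  ZFSet.range fun i : e => ZFSet.pair (toZFSet (i : ℕ)) (t i).toZF

theorem mem_graph {a : ZFSet.{u}} :
    a ∈ graph t ↔ ∃ i : e, a = ZFSet.pair (toZFSet (i : ℕ)) (t i).toZF := by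
  rw [graph, ZFSet.mem_range]
  exact exists_congr fun i => eq_comm

theorem pair_mem_graph {i : e} {a : ZFSet.{u}} :
    ZFSet.pair (toZFSet (i : ℕ)) a ∈ graph t ↔ a = (t i).toZF := by
  rw [mem_graph]
  constructor
  · rintro ⟨j, h⟩
    obtain ⟨h₁, rfl⟩ := ZFSet.pair_inj.1 h
    have := toZFSet_injective h₁
    obtain rfl : i = j := Subtype.ext (by simpa using this)
    rfl
  · rintro rfl
    exact ⟨i, rfl⟩

theorem graph_injective : Function.Injective (graph : (e → Node.{u}) → ZFSet.{u}) :=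
  fun s t h => funext fun i => Node.toZF_injective
    (pair_mem_graph.1 (h ▸ pair_mem_graph.2 rfl : ZFSet.pair (toZFSet (i : ℕ)) (s i).toZF ∈ graph t))

theorem frc_mem_graph : (q ⊩ z ∈' .check (graph t)) ↔
    Dn q fun r => ∃ i : e, r ⊩ z =' .opair (.ord (i : ℕ)) (.check (t i).toZF) := by
  rw [frc_mem_check]
  refine ⟨fun h => h.imp fun r _ ⟨a, ha, h⟩ => ?_, fun h => h.imp fun r _ ⟨i, h⟩ => ?_⟩
  · obtain ⟨i, rfl⟩ := mem_graph.1 ha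
    exact ⟨i, h.trans (frc_check_pair _ _)⟩
  · exact ⟨_, mem_graph.2 ⟨i, rfl⟩, h.trans (frc_check_pair _ _).symm⟩

theorem frc_opair_mem_graph {i : e} (hx : q ⊩ x =' .ord (i : ℕ)) :
    (q ⊩ .opair x y ∈' .check (graph t)) ↔ (q ⊩ y =' .check (t i).toZF) := by
  rw [frc_mem_graph]
  refine ⟨fun h => h.frc fun r hr ⟨j, h⟩ => ?_, fun h => Dn.of_forall fun r hr =>
    ⟨i, frc_opair_congr (hx.mono hr) (h.mono hr)⟩⟩
  obtain ⟨h₁, h₂⟩ := frc_opair_inj.1 h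
  have := frc_ord_eq.1 ((hx.mono hr).symm.trans h₁)
  obtain rfl : i = j := Subtype.ext (by simpa using this)
  exact h₂

theorem EqFinset.exists_isFunction_graph (hx : EqFinset q x e) (t : e → Node.{u}) :
    q ⊩ ex fun Y => isFunction (.check (graph t)) x Y := by
  refine frc_ex_of (.check (ZFSet.range fun i : e => (t i).toZF)) (frc_isFunction.2
    ⟨fun z r hr hz => (frc_mem_graph.1 hz).imp fun s hs ⟨i, h⟩ => ⟨.ord (i : ℕ), _,
      (hx.le (hs.trans hr)).mem i, frc_check_mem.2 (ZFSet.mem_range.2 ⟨i, rfl⟩), h⟩,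
    fun z r hr hz => ?_⟩)
  exact ((hx r hr z).1 hz).imp fun s hs ⟨i, h⟩ => ⟨_, (frc_opair_mem_graph h).2 (frc_refl _ _),
    fun y' s' hs' hy' => (frc_opair_mem_graph (h.mono hs')).1 hy'⟩

theorem EqFinset.eq_graph (hx : EqFinset q x e) (hf : q ⊩ isFunction f x Y)
    (h : ∀ i : e, q ⊩ .opair (.ord (i : ℕ)) (.check (t i).toZF) ∈' f) :
    q ⊩ f =' .check (graph t) := by
  refine frc_ext fun z r hr => ⟨fun hz => ?_, fun hz => (frc_mem_graph.1 hz).frc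
    fun s hs ⟨i, hi⟩ => ((h i).mono (hs.trans hr)).mem_left hi.symm⟩
  refine ((frc_isFunction.1 hf).1 z r hr hz).frc fun s hs ⟨a, b, ha, _, hz'⟩ => ?_
  have hsq := hs.trans hr
  refine ((hx s hsq a).1 ha).frc fun s' hs' ⟨i, hi⟩ => ?_
  have hab := frc_opair_congr hi (frc_refl s' b)
  refine frc_mem_graph.2 (Dn.of_forall fun s'' hs'' => ⟨i, Frc.mono (q := s')
    ((hz'.mono hs').trans (frc_opair_congr hi ?_)) hs''⟩)
  exact (hf.mono (hs'.trans hsq)).isFunction_unique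
    (((hz.mono (hs'.trans hs)).mem_left (hz'.mono hs')).mem_left hab) ((h i).mono (hs'.trans hsq))

end

end JechForcing

namespace JechForcing
open Fml Ordinal

/-! ### The product of a Suslin tree of the ground model with generic trees -/

section

variable {σ : Type w}

/-- A Suslin tree of the ground model with nodes coded by `c`. -/
def groundTree (P : Type u) [Preorder P] (S : SuslinTree.{u} σ) (c : σ → ZFSet.{u})
    (hc : Function.Injective c) : NTree P σ where
  toLTree := S.toLTree
  code := c
  inj := hc
  In _ _ := True
  mono _ h := h
  down _ h := h

variable {S : SuslinTree.{u} σ} {c : σ → ZFSet.{u}} {e : Finset ℕ}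

theorem prodCode_injective (hc : Function.Injective c) :
    Function.Injective fun x : ProdNode S e => ZFSet.pair (c x.1.1) (graph x.1.2) := by
  intro x y h
  obtain ⟨h₁, h₂⟩ := ZFSet.pair_inj.1 h
  exact Subtype.ext (Prod.ext (hc h₁) (graph_injective h₂))

/-- The product of a Suslin tree of the ground model with the generic trees for `i ∈ e`. -/
noncomputable def prodTree (S : SuslinTree.{u} σ) (c : σ → ZFSet.{u}) (hc : Function.Injective c)
    (e : Finset ℕ) : NTree JechIteration.{u} (ProdNode S e) where
  toLTree := ProdNode.tree S e
  code x := ZFSet.pair (c x.1.1) (graph x.1.2)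
  inj := prodCode_injective hc
  In p x := ∀ i : e, GenIn i p (x.1.2 i)
  mono h h' i := (h' i).mono h
  down h h' i := (h' i).down (h.2 i)

instance [Small.{u} σ] : Small.{u} (ProdNode S e) := by
  unfold ProdNode
  infer_instance

variable {hc : Function.Injective c} {q r : JSeq.{u}}

theorem prodTree_in {x : ProdNode S e} :
    (prodTree S c hc e).In (Proj.π q) x ↔ ∀ i : e, x.1.2 i ∈ (q i).nodes :=
  forall_congr' fun _ => genTree_in

variable {A R : ℕ → Name JechIteration.{u}} {T A₀ R₀ X Y Z z z' e' : Name JechIteration.{u}}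

/-- The finitely many coordinates of a product node are nodes of generic trees, hence ground-model
sequences. One condition decides them together, and the node becomes a ground-model pair. -/
theorem frc_isProdNode [Small.{u} σ] (hT : GenericTrees A R T)
    (hA₀ : (groundTree _ S c hc).Nodes q A₀) (hR₀ : (groundTree _ S c hc).Order q R₀)
    (hX : q ⊩ X =' .opair A₀ R₀) (he : EqFinset q e' e) :
    (q ⊩ isProdNode X T e' z) ↔ Dn q fun r => ∃ x, (prodTree S c hc e).In (Proj.π r) x ∧
      (r ⊩ z =' .check ((prodTree S c hc e).code x)) := by
  have hgen : ∀ {r : JSeq.{u}} {n : ℕ} {U x α : Name JechIteration.{u}},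
      (r ⊩ U =' .opair (A n) (R n)) → ((r ⊩ nodeHeight U x α) ↔ Dn r fun s => ∃ t : Node.{u},
        t ∈ (s n).nodes ∧ (s ⊩ x =' .check t.toZF) ∧ (s ⊩ α =' .ord t.len)) := by
    intro r n U x α hU
    rw [NTree.frc_nodeHeight (hT.nodes n r) (hT.order n r) hU]
    simp only [genTree_in]
    rfl
  constructor
  · refine fun h => (frc_ex.1 h).bind fun r₁ hr₁ ⟨s, h⟩ => (frc_ex.1 h).bind
      fun r₂ hr₂ ⟨f, hz, hf, h⟩ => (frc_ex.1 hf).bind fun r₃ hr₃ ⟨Y, hf⟩ =>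
      ((frc_ex.1 h).mono hr₃).bind fun r₄ hr₄ ⟨α, hα, h⟩ => ?_
    have h₄ := hr₄.trans (hr₃.trans (hr₂.trans hr₁))
    refine ((NTree.frc_nodeHeight (hA₀.le h₄) (hR₀.le h₄) (hX.mono h₄)).1 hα).bind
      fun r₅ hr₅ ⟨a, _, hsa, hαa⟩ => ?_
    have h₅ := hr₅.trans h₄
    have key : ∀ i : e, Dn r₅ fun r => ∃ t : Node.{u}, t ∈ (r i).nodes ∧ t.len = S.ht a ∧
        (r ⊩ .opair (.ord (i : ℕ)) (.check t.toZF) ∈' f) := by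
      intro i
      refine (frc_ex.1 (frc_allIn.1 h _ r₅ hr₅ ((he.le h₅).mem i))).bind fun r₆ hr₆ ⟨U, h⟩ =>
        (frc_ex.1 h).bind fun r₇ hr₇ ⟨x, h₁, h₂, h₃⟩ => ?_
      refine ((hgen ((hT.opair_mem (frc_refl _ _)).1 (frc_pairMem.1 h₁))).1 h₃).imp
        fun r₈ hr₈ ⟨t, ht, hxt, hαt⟩ => ⟨t, ht, ?_, ?_⟩
      · exact (frc_ord_eq.1 ((hαa.mono (hr₈.trans (hr₇.trans hr₆))).symm.trans hαt)).symm
      · exact (Frc.mono (q := r₇) (frc_pairMem.1 h₂) hr₈).mem_left (frc_opair_congr (frc_refl _ _) hxt)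
    have := JSeq.sigmaClosed.dn_countable key fun i r s hs ⟨t, ht, hl, h⟩ =>
      ⟨t, (hs i).1 ht, hl, h.mono hs⟩
    refine this.imp fun r hr h => ?_
    choose t ht hl h using h
    refine ⟨⟨(a, t), hl⟩, prodTree_in.2 ht, ?_⟩
    have hf := he.le (hr.trans h₅) |>.eq_graph (Frc.mono (q := r₃) hf (hr.trans (hr₅.trans hr₄))) h
    refine (Frc.mono (q := r₂) (frc_isOPair.1 hz) (hr.trans (hr₅.trans (hr₄.trans hr₃)))).trans ?_
    exact (frc_opair_congr (hsa.mono hr) hf).trans (frc_check_pair _ _).symm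
  · refine fun h => h.frc fun r hr ⟨x, hx, hz⟩ => ?_
    rw [prodTree_in] at hx
    refine frc_ex_of (.check (c x.1.1)) (frc_ex_of (.check (graph x.1.2)) (frc_and.2
      ⟨frc_isOPair.2 (hz.trans (frc_check_pair _ _)), frc_and.2
      ⟨(he.le hr).exists_isFunction_graph _, frc_ex_of (.ord (S.ht x.1.1)) (frc_and.2 ⟨?_, ?_⟩)⟩⟩))
    · exact (NTree.frc_nodeHeight (hA₀.le hr) (hR₀.le hr) (hX.mono hr)).2 (Dn.of_forall
        fun s hs => ⟨x.1.1, trivial, frc_refl _ _, frc_refl _ _⟩)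
    · refine frc_allIn.2 fun j s hs hj => ((he s (hs.trans hr) j).1 hj).frc fun s' hs' ⟨i, hi⟩ => ?_
      refine frc_ex_of (.opair (A i) (R i)) (frc_ex_of (.check (x.1.2 i).toZF) (frc_and.2
        ⟨frc_pairMem.2 ((hT.opair_mem hi).2 (frc_refl _ _)), frc_and.2
        ⟨frc_pairMem.2 ((frc_opair_mem_graph hi).2 (frc_refl _ _)), (hgen (frc_refl _ _)).2
          (Dn.of_forall fun s'' hs'' => ⟨x.1.2 i, ?_, frc_refl _ _, ?_⟩)⟩⟩))
      · exact ((hs''.trans (hs'.trans hs)) i).1 (hx i)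
      · rw [x.2 i]
        exact frc_refl _ _

theorem frc_isProdLt [Small.{u} σ] {x y : ProdNode S e} (hT : GenericTrees A R T)
    (hR₀ : (groundTree _ S c hc).Order q R₀)
    (hX : q ⊩ X =' .opair A₀ R₀) (he : EqFinset q e' e)
    (hx : q ⊩ z =' .check ((prodTree S c hc e).code x))
    (hy : q ⊩ z' =' .check ((prodTree S c hc e).code y))
    (hyin : (prodTree S c hc e).In (Proj.π q) y) :
    (q ⊩ isProdLt X T e' z z') ↔ (ProdNode.tree S e).lt x y := by
  replace hx := hx.trans (frc_check_pair _ _)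
  replace hy := hy.trans (frc_check_pair _ _)
  constructor
  · intro h
    obtain ⟨r₁, hr₁, s, h⟩ := (frc_ex.1 h).exists
    obtain ⟨r₂, hr₂, f, h⟩ := (frc_ex.1 h).exists
    obtain ⟨r₃, hr₃, s', h⟩ := (frc_ex.1 h).exists
    obtain ⟨r₄, hr₄, f', hz, hz', hS, h⟩ := (frc_ex.1 h).exists
    have h₄ := hr₄.trans (hr₃.trans (hr₂.trans hr₁))
    obtain ⟨hs, hf⟩ := frc_opair_inj.1 ((hx.mono h₄).symm.trans (frc_isOPair.1 hz))
    obtain ⟨hs', hf'⟩ := frc_opair_inj.1 ((hy.mono h₄).symm.trans (frc_isOPair.1 hz'))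
    refine ⟨(hR₀.le h₄).lt_of ((frc_treeLt (hX.mono h₄)).1 hS) hs.symm hs'.symm, fun i => ?_⟩
    obtain ⟨r₅, hr₅, U, h⟩ := (frc_ex.1 (frc_allIn.1 h _ r₄ le_rfl ((he.le h₄).mem i))).exists
    obtain ⟨r₆, hr₆, a, h⟩ := (frc_ex.1 h).exists
    obtain ⟨r₇, hr₇, b, hU, ha, hb, h⟩ := (frc_ex.1 h).exists
    have h₇ := hr₇.trans (hr₆.trans hr₅)
    have hU := (hT.opair_mem (frc_refl _ _)).1 (frc_pairMem.1 hU)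
    refine (hT.order i r₇).lt_of ((frc_treeLt hU).1 h) (i := x.1.2 i) (j := y.1.2 i) ?_ ?_
    · exact (frc_opair_mem_graph (frc_refl _ _)).1
        ((frc_pairMem.1 ha).mem_right (hf.mono h₇).symm)
    · exact (frc_opair_mem_graph (frc_refl _ _)).1
        ((frc_pairMem.1 hb).mem_right (hf'.mono h₇).symm)
  · intro h
    rw [prodTree_in] at hyin
    refine frc_ex_of _ (frc_ex_of _ (frc_ex_of _ (frc_ex_of _ (frc_and.2 ⟨frc_isOPair.2 hx,
      frc_and.2 ⟨frc_isOPair.2 hy, frc_and.2 ⟨(frc_treeLt hX).2 ?_, ?_⟩⟩⟩))))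
    · exact NTree.Order.mem (i := x.1.1) (j := y.1.1) hR₀ h.1 trivial (frc_refl _ _) (frc_refl _ _)
    · refine frc_allIn.2 fun j r hr hj => ((he r hr j).1 hj).frc fun s hs ⟨i, hi⟩ => ?_
      refine frc_ex_of (.opair (A i) (R i)) (frc_ex_of (.check (x.1.2 i).toZF)
        (frc_ex_of (.check (y.1.2 i).toZF) (frc_and.2
        ⟨frc_pairMem.2 ((hT.opair_mem hi).2 (frc_refl _ _)), frc_and.2
        ⟨frc_pairMem.2 ((frc_opair_mem_graph hi).2 (frc_refl _ _)), frc_and.2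
        ⟨frc_pairMem.2 ((frc_opair_mem_graph hi).2 (frc_refl _ _)),
          (frc_treeLt (frc_refl _ _)).2 ?_⟩⟩⟩)))
      exact NTree.Order.mem (i := x.1.2 i) (j := y.1.2 i) (hT.order i s) (h.2 i)
        (genTree_in.2 (((hs.trans hr) i).1 (hyin i))) (frc_refl _ _) (frc_refl _ _)

theorem frc_isTreeProduct [Small.{u} σ] (hT : GenericTrees A R T)
    (hA₀ : (groundTree _ S c hc).Nodes q A₀) (hR₀ : (groundTree _ S c hc).Order q R₀)
    (hX : q ⊩ X =' .opair A₀ R₀) (he : EqFinset q e' e)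
    (hY : (prodTree S c hc e).Nodes q Y) (hZ : (prodTree S c hc e).Order q Z) :
    q ⊩ isTreeProduct (.opair Y Z) X T e' := by
  refine frc_ex_of Y (frc_ex_of Z (frc_and.2 ⟨frc_isOPair.2 (frc_refl _ _), frc_and.2
    ⟨frc_all.2 fun z => frc_iff.2 fun r hr => ?_, frc_all.2 fun w => frc_iff.2 fun r hr => ?_⟩⟩))
  · rw [frc_isProdNode hT (hA₀.le hr) (hR₀.le hr) (hX.mono hr) (he.le hr)]
    exact hY r hr z
  · refine (hZ r hr w).trans ⟨fun h => h.frc fun s hs ⟨x, y, hxy, hx, hy, hw⟩ => ?_, fun h =>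
      (frc_exIn.1 h).bind fun r₁ hr₁ ⟨z, hz, h⟩ => (frc_exIn.1 h).bind
        fun r₂ hr₂ ⟨z', hz', hw, hlt⟩ => ?_⟩
    · have hs := hs.trans hr
      exact frc_exIn_of _ ((hY.le hs).mem hx) (frc_exIn_of _ ((hY.le hs).mem hy) (frc_and.2
        ⟨frc_isOPair.2 hw, (frc_isProdLt hT (hR₀.le hs) (hX.mono hs) (he.le hs) (frc_refl _ _)
          (frc_refl _ _) hy).2 hxy⟩))
    · have h₂ := hr₂.trans (hr₁.trans hr)
      refine ((hY.le h₂).dn (hz.mono hr₂)).bind fun r₃ hr₃ ⟨x, hx, hzx⟩ => ?_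
      refine ((hY.le (hr₃.trans h₂)).dn (hz'.mono hr₃)).imp fun r₄ hr₄ ⟨y, hy, hzy⟩ => ?_
      have h₄ := hr₄.trans (hr₃.trans h₂)
      have h₄₂ := hr₄.trans hr₃
      replace hzx := hzx.mono hr₄
      refine ⟨x, y, (frc_isProdLt hT (hR₀.le h₄) (hX.mono h₄) (he.le h₄) hzx hzy hy).1
        (Frc.mono (q := r₂) hlt h₄₂), NTree.in_mono hx hr₄, hy, ?_⟩
      exact (Frc.mono (q := r₂) (frc_isOPair.1 hw) h₄₂).trans (frc_opair_congr hzx hzy)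

theorem frc_isSuslin_prodTree [Small.{u} σ] (hY : (prodTree S c hc e).Nodes q Y)
    (hZ : (prodTree S c hc e).Order q Z) : q ⊩ isSuslin (.opair Y Z) := by
  have hin : ∀ {r : JSeq.{u}} {x}, (prodTree S c hc e).In (Proj.π r) x ↔
      ∀ i : e, x.1.2 i ∈ (r i).nodes := prodTree_in
  let ρ : ProdNode S e := ⟨(S.root, fun _ => Node.nil), fun _ => S.ht_root.symm⟩
  refine NTree.frc_isSuslin JSeq.sigmaClosed hY hZ ρ
    (hin.2 fun i => (q i).nil_mem) (fun x => ?_) (fun x => S.ht_lt_omega x.1.1) ?_ ?_ ?_ ?_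
    (frc_refl _ _)
  · have : (ProdNode.tree S e).le ρ x := by
      refine ProdNode.le_iff.2 ⟨?_, fun i => ?_⟩
      · exact (S.root_le x.1.1).imp_left Eq.symm
      · exact (Node.eq_nil_or_lt _).imp_left Eq.symm
    exact this.imp_left Eq.symm
  · intro α r _ s _
    rcases lt_or_ge α ω₁ with hα | hα
    · obtain ⟨s', hs', β, hβ, h⟩ := s.exists_top α hα
      refine ⟨s', hs', {x | S.ht x.1.1 = α ∧ ∀ i : e, x.1.2 i ∈ (s' i).nodes}, ?_,
        fun t ht x hx hxα => ⟨hxα, fun i => ?_⟩⟩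
      · have h₁ := (S.level α).prod (Set.countable_univ_pi fun i : e => (s' i).countable)
        refine (h₁.preimage_of_injOn (f := Subtype.val) Subtype.val_injective.injOn).mono ?_
        rintro x ⟨hx₁, hx₂⟩
        exact ⟨hx₁, fun i _ => hx₂ i⟩
      · exact (h i).mem_of_le (ht i) (hin.1 hx i) ((x.2 i).trans_le (hxα.trans_le hβ))
    · exact ⟨s, le_rfl, ∅, Set.countable_empty, fun t _ x _ hx =>
        absurd (S.ht_lt_omega x.1.1) (not_lt.2 (hα.trans_eq hx.symm))⟩
  · intro r _ x hx s hs
    obtain ⟨s', hs', β, hβ, h⟩ := s.exists_top _ (add_one_lt_omega_one (S.ht_lt_omega x.1.1))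
    have : ∀ i : e, ∃ j, Node.tree.lt (x.1.2 i) j ∧ j.len = S.ht x.1.1 + 1 ∧ j ∈ (s' i).nodes :=
      fun i => (h i).exists_lt ((hs'.trans hs i).1 (hin.1 hx i))
        ((x.2 i).trans_lt (lt_add_one _)) hβ
    choose t ht hl ht' using this
    refine ⟨s', hs', ?_⟩
    -- Infinitely many successors arise by varying the `S`-coordinate alone, with one fixed
    -- successor in each generic tree; this also covers empty `e`.
    have hinf := (S.infinite_succ x.1.1).to_subtype
    let g : {y | S.lt x.1.1 y ∧ S.ht y = S.ht x.1.1 + 1} → ProdNode S e :=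
      fun y => ⟨(y.1, t), fun i => (hl i).trans y.2.2.symm⟩
    have hg : Function.Injective g := fun y y' h =>
      Subtype.ext (congrArg (fun z : ProdNode S e => z.1.1) h)
    refine (Set.infinite_range_of_injective hg).mono ?_
    rintro _ ⟨y, rfl⟩
    exact ⟨⟨y.2.1, ht⟩, y.2.2, hin.2 ht'⟩
  · intro r _ x α hα hx hlt s hs
    obtain ⟨s', hs', β, hβ, h⟩ := s.exists_top α hα
    have : ∀ i : e, ∃ j, Node.tree.lt (x.1.2 i) j ∧ j.len = α ∧ j ∈ (s' i).nodes :=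
      fun i => (h i).exists_lt ((hs'.trans hs i).1 (hin.1 hx i)) ((x.2 i).trans_lt hlt) hβ
    choose t ht hl ht' using this
    obtain ⟨y, hy, hyα⟩ := S.ext x.1.1 α hlt hα
    exact ⟨s', hs', ⟨(y, t), fun i => (hl i).trans hyα.symm⟩, ⟨hy, ht⟩, hyα, hin.2 ht'⟩
  · intro B r _ hB hB' s hs
    let C : AntichainName S e :=
      { mem := fun q x => q ≤ s ∧ (q ⊩ .check ((prodTree S c hc e).code x) ∈' B)
        mono := fun h h' => ⟨h.trans h'.1, h'.2.mono h⟩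
        anti := fun {q x y} hx hy => hB q (hx.1.trans hs) _ _ hx.2 hy.2
        node := fun {q x} hx => (hB' q (hx.1.trans hs) _ hx.2).imp fun t _ ht => hin.1 ht }
    obtain ⟨s', hs', γ, hγ, h⟩ := C.exists_bound s
    exact ⟨s', hs', γ, hγ, fun t ht x hx => h t ht x ⟨ht.trans hs', hx⟩⟩

theorem frc_finiteProductsSuslin [Small.{u} σ] (hT : GenericTrees A R T)
    (hA₀ : (groundTree _ S c hc).Nodes q A₀) (hR₀ : (groundTree _ S c hc).Order q R₀)
    (hX : q ⊩ X =' .opair A₀ R₀) : q ⊩ finiteProductsSuslin X T := by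
  refine frc_ex_of (.ord ω) (frc_and.2 ⟨frc_isOmega.2 (frc_refl _ _), frc_all.2 fun x =>
    frc_imp.2 fun r hr hsub => frc_imp.2 fun r₁ hr₁ hfin => ?_⟩)
  refine (JSeq.sigmaClosed.dn_eqFinset (hsub.mono hr₁) hfin).frc fun r₂ hr₂ ⟨e, he⟩ => ?_
  have h₂ := hr₂.trans (hr₁.trans hr)
  obtain ⟨Y, hY⟩ := NTree.exists_nodes (Q := JSeq.{u}) (prodTree S c hc e)
  obtain ⟨Z, hZ⟩ := NTree.exists_order (Q := JSeq.{u}) (prodTree S c hc e)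
  exact frc_ex_of (.opair Y Z) (frc_and.2 ⟨frc_isTreeProduct hT (hA₀.le h₂) (hR₀.le h₂)
    (hX.mono h₂) he (hY _) (hZ _), frc_isSuslin_prodTree (hY _) (hZ _)⟩)

end

end JechForcing

/-! ### Conclusion for a Suslin tree given as a set -/

namespace JechForcing

theorem frc_finiteProductsSuslin_check {S : ZFSet.{u}} {A R : ℕ → Name JechIteration.{u}}
    {T : Name JechIteration.{u}} (hS : Holds (Fml.isSuslin S)) (hT : GenericTrees A R T)
    (q : JSeq.{u}) : q ⊩ Fml.finiteProductsSuslin (.check S) T := by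
  obtain ⟨A₀, R₀, U, rfl, hR₀⟩ := exists_suslinTree hS
  refine frc_finiteProductsSuslin (S := U) (hc := Subtype.val_injective) hT (A₀ := .check A₀)
    (R₀ := .check R₀) (fun r _ z => ?_) (fun r _ z => ?_) (frc_check_pair A₀ R₀)
  · exact frc_mem_check.trans ⟨fun h => h.imp fun s _ ⟨a, ha, h⟩ => ⟨⟨a, ha⟩, trivial, h⟩,
      fun h => h.imp fun s _ ⟨a, _, h⟩ => ⟨a.1, a.2, h⟩⟩
  · refine frc_mem_check.trans ⟨fun h => h.imp fun s _ ⟨a, ha, h⟩ => ?_,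
      fun h => h.imp fun s _ ⟨x, y, hxy, _, _, h⟩ => ?_⟩
    · obtain ⟨x, y, hxy, rfl⟩ := (hR₀ a).1 ha
      exact ⟨x, y, hxy, trivial, trivial, h.trans (frc_check_pair _ _)⟩
    · exact ⟨_, (hR₀ _).2 ⟨x, y, hxy, rfl⟩, h.trans (frc_check_pair _ _).symm⟩

end JechForcing

theorem mainTheorem9 (S : ZFSet.{u}) (hS : JechForcing.Holds (JechForcing.Fml.isSuslin S)) :
    Nonempty JechForcing.JechIteration.{u} ∧
    ∃ T : JechForcing.Name JechForcing.JechIteration.{u},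
      JechForcing.IsGenericTreeSequence T ∧
      JechForcing.Forced (JechForcing.Fml.allSuslin T) ∧
      JechForcing.Forced (JechForcing.Fml.finiteProductsSuslin (.check S) T) := by
  obtain ⟨A, R, T, hT⟩ := JechForcing.exists_genericTrees.{u}
  -- The typed Suslin tree is needed even for the single trees `T n`, whose antichains are bounded
  -- through a product with it.
  obtain ⟨_, _, U, -, -⟩ := JechForcing.exists_suslinTree hS
  exact ⟨⟨JechForcing.iterProj fun _ => JechForcing.JT.single⟩, T, hT.isGenericTreeSequence,
    JechForcing.forced_of_frc (hT.allSuslin U),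
    JechForcing.forced_of_frc (JechForcing.frc_finiteProductsSuslin_check hS hT)⟩
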